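/- Work with infinite time Turing machines: a finite program controls a single head on four one-way infinite tapes of zeros and ones (input, scratch, output, oracle). The computation on input $x$ starts in the start state with the head on the left-most cell, $x$ on the input tape and the other tapes blank; successor stages follow the program as for a classical Turing machine; at a limit ordinal stage the head is reset to the left-most cell, the machine enters the limit state, and each cell shows the $\limsup$ of its previous values. The computation stops when it reaches the halt state, and its output is then the content of the output tape. With a set $A\subseteq\mathbb{R}$ as oracle, where $\mathbb{R}$ denotes $2^{\omega}$ and its members are called reals, an attempt to enter the query state leads to the yes state if the real on the oracle tape is in $A$, and to the no state otherwise. A natural number $n$ is identified with the real $1^n000\cdots$, and a real $z\in 2^\omega$, taken as an oracle or a degree, is identified with the set $\{n\in\mathbb{N} : z(n)=1\}\subseteq\mathbb{R}$; in particular $0=\emptyset$. For $A,B\subseteq\mathbb{R}$ write $A\leq_\infty B$ if some program with oracle $B$ halts on every real input $x$, with output $1$ if $x\in A$ and output $0$ if $x\notin A$; write $A\equiv_\infty B$ if $A\leq_\infty B$ and $B\leq_\infty A$, and $A<_\infty B$ if $A\leq_\infty B$ and $A\not\equiv_\infty B$. A real is writable if it is the output of a computation on input $0$ without oracle (equivalently,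 with oracle $\emptyset$). Let $A\oplus B$ consist of the sequences $0^\frown x$ with $x\in A$ and $1^\frown x$ with $x\in B$, and let $0^{\triangledown}=\emptyset\oplus h$ be the lightface jump of $0$, where $h$ is the set of (codes, in a standard effective numbering, of) programs $p$ that halt on input $0$ without oracle. Theorem. There are no reals $z$ such that $0<_\infty z<_\infty 0^{\triangledown}$. Moreover, for every real $z$ with $z\leq_\infty 0^{\triangledown}$, either $z$ is writable or $0^{\triangledown}\leq_\infty z$. -/

import Mathlib

/-! Infinite time Turing machines with set-of-reals oracles, the degrees they induce,
and the lightface jump. -/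

namespace ITTM

/-- A "real": a point of Cantor space, i.e. an infinite binary sequence. -/
abbrev CReal : Type := ℕ → Bool

/-- The real number identified with the natural number `n`: the sequence `1ⁿ000…`. -/
def natReal (n : ℕ) : CReal := fun k => decide (k < n)

/-! ### Programs -/

/-- Names of the four tapes; each tape is a one-way infinite sequence of cells, and the single head
rests on cell `head` of all four tapes simultaneously. -/
abbrev Tape : Type := Fin 4

abbrev inputTape : Tape := 0
abbrev scratchTape : Tape := 1
abbrev outputTape : Tape := 2
abbrev oracleTape : Tape := 3

/-- States are named by natural numbers (a program mentions only finitely many of them).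
The first six names are reserved for the special states. -/
abbrev startState : ℕ := 0
abbrev limitState : ℕ := 1
abbrev haltState : ℕ := 2
abbrev queryState : ℕ := 3
abbrev yesState : ℕ := 4
abbrev noState : ℕ := 5

/-- Head movements: `0` is one cell to the left (the head stays put if it is already on the
left-most cell), `1` is no movement, `2` is one cell to the right. -/
abbrev Move : Type := Fin 3

def Move.apply (m : Move) (h : ℕ) : ℕ :=
  if m = 0 then h - 1 else if m = 1 then h else h + 1

/-- "In state `state`, scanning the bits `read`: write the bits `write`, move the head by `move`
and switch to state `next`." -/
structure Instruction where
  state : ℕ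
  read : Tape → Bool
  write : Tape → Bool
  move : Move
  next : ℕ

def Instruction.equivProd :
    Instruction ≃ (ℕ × (Tape → Bool)) × ((Tape → Bool) × Move × ℕ) where
  toFun i := ((i.state, i.read), (i.write, i.move, i.next))
  invFun t := ⟨t.1.1, t.1.2, t.2.1, t.2.2.1, t.2.2.2⟩
  left_inv _ := rfl
  right_inv _ := rfl

/-- The standard effective coding of instructions by natural numbers. -/
instance : Primcodable Instruction := Primcodable.ofEquiv _ Instruction.equivProd

/-- A program is a finite list of instructions. -/
abbrev Program : Type := List Instruction

/-- The (effective, injective) Gödel number of a program. -/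
def Program.code (p : Program) : ℕ := Encodable.encode p

/-- The instruction of `p` that applies in state `q` when the bits `s` are scanned
(the first one on the list, so that the machine is deterministic). -/
def Program.lookup (p : Program) (q : ℕ) (s : Tape → Bool) : Option Instruction :=
  p.find? fun i => decide (i.state = q ∧ i.read = s)

/-! ### Computations -/

/-- A complete configuration of the machine. -/
structure Config where
  state : ℕ
  head : ℕ
  tape : Tape → CReal

/-- The configuration at stage `0`: start state, head on the left-most cell, `x` on the input tape
and all other tapes blank. -/
def initConfig (x : CReal) : Config where
  state := startState
  head := 0
  tape t := if t = inputTape then x else fun _ => false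

open scoped Classical in
/-- Entering state `q` with the real `y` on the oracle tape: an attempt to enter the query state
leads to the yes or the no state, according to whether `y` belongs to the oracle `A`. -/
noncomputable def enterState (A : Set CReal) (q : ℕ) (y : CReal) : ℕ :=
  if q = queryState then (if y ∈ A then yesState else noState) else q

/-- Writing the bits `s` on the four cells scanned by the head. -/
def Config.written (c : Config) (s : Tape → Bool) : Tape → CReal :=
  fun t => Function.update (c.tape t) c.head (s t)

/-- One classical step of computation with oracle `A`. If no instruction applies, the machine
halts. -/
noncomputable def step (A : Set CReal) (p : Program) (c : Config) : Config :=
  match p.lookup c.state (fun t => c.tape t c.head) with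
  | none => { c with state := haltState }
  | some i =>
    { state := enterState A i.next (c.written i.write oracleTape)
      head := i.move.apply c.head
      tape := c.written i.write }

open scoped Classical in
/-- The configuration at a limit stage `l`, given the configurations at all earlier stages: limit
state, head on the left-most cell, and every cell has the `limsup` of its previous values, i.e. it
shows `1` iff it showed `1` at unboundedly many earlier stages. -/
noncomputable def limitConfig (l : Ordinal.{0}) (c : ∀ β < l, Config) : Config where
  state := limitState
  head := 0
  tape t n := decide (∀ β < l, ∃ γ, ∃ h : γ < l, β ≤ γ ∧ (c γ h).tape t n = true)

/-- The configuration of program `p` with oracle `A` on input `x` at the ordinal stage `α`.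
(Only the stages up to the first one in the halt state are ever used.) -/
noncomputable def run (A : Set CReal) (p : Program) (x : CReal) (α : Ordinal.{0}) : Config :=
  Ordinal.limitRecOn α (initConfig x) (fun _ c => step A p c) (fun l _ c => limitConfig l c)

/-- The computation reaches the halt state (for the first time) exactly at stage `α`. -/
def HaltsAt (A : Set CReal) (p : Program) (x : CReal) (α : Ordinal.{0}) : Prop :=
  (run A p x α).state = haltState ∧ ∀ β < α, (run A p x β).state ≠ haltState

/-- Program `p` halts on input `x` with oracle `A`. -/
def Halts (A : Set CReal) (p : Program) (x : CReal) : Prop := ∃ α, HaltsAt A p x α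

/-- Program `p` on input `x` with oracle `A` halts and gives the output `y`. -/
def Yields (A : Set CReal) (p : Program) (x y : CReal) : Prop :=
  ∃ α, HaltsAt A p x α ∧ (run A p x α).tape outputTape = y

/-! ### Degrees and the jump -/

/-- A real is writable if it is the output of a computation on input `0` (without oracle, i.e. with
the empty oracle). -/
def Writable (z : CReal) : Prop := ∃ p, Yields ∅ p (natReal 0) z

open scoped Classical in
/-- The characteristic function of a set of reals, with values the reals `1` and `0`. -/
noncomputable def charFun (A : Set CReal) (x : CReal) : CReal :=
  if x ∈ A then natReal 1 else natReal 0

/-- `A ≤ B` : the set `A` is infinite time decidable using oracle `B`. -/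
def Reducible (A B : Set CReal) : Prop := ∃ p, ∀ x, Yields B p x (charFun A x)

/-- `A ≡ B`. -/
def Equivalent (A B : Set CReal) : Prop := Reducible A B ∧ Reducible B A

/-- `A < B` : `A ≤ B` and not `A ≡ B`. -/
def StrictlyBelow (A B : Set CReal) : Prop := Reducible A B ∧ ¬ Equivalent A B

/-- `A ⊕ B` : the disjoint sum, tagging the members of `A` with a leading `0` and those of `B` with
a leading `1`. -/
def join (A B : Set CReal) : Set CReal :=
  {x | (x 0 = false ∧ (fun n => x (n + 1)) ∈ A) ∨ (x 0 = true ∧ (fun n => x (n + 1)) ∈ B)}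

/-- The lightface halting problem relative to `A` : the set of (codes of) programs that halt on
input `0` with oracle `A`; a natural number is regarded as a real. -/
def lightHalting (A : Set CReal) : Set CReal :=
  {x | ∃ p : Program, x = natReal p.code ∧ Halts A p (natReal 0)}

/-- The lightface jump `A ⊕ h^A`. -/
def lightJump (A : Set CReal) : Set CReal := join A (lightHalting A)

/-- A real `z` regarded as an oracle, or as a degree: the set of natural numbers with characteristic
function `z`, which is a set of reals since natural numbers are reals. -/
def realSet (z : CReal) : Set CReal := {x | ∃ n, z n = true ∧ x = natReal n}

end ITTM

namespace ITTM

/-! ### Stages of a computation -/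

/-! Let `z` be computed from the jump by a program `p`. Run, side by side, all programs on input `0`
without oracle and `p` on every number `n`, answering the queries of `p` by the approximation to the
jump that consists of the programs halted so far. Whenever a further program halts, all computations
of `p` are restarted. The halting stages are bounded, so after the last restart the approximation is
the jump itself, and at some stage all computations of `p` have halted with the bits of `z` as their
answers (`exists_agrees`).

Consider any stage `α` at which the answers are the bits of `z`, and suppose that some program halts
at `α` or later. Up to the first such halt nothing is restarted, so the answers are still there; a
machine without oracle that waits for this particular program to halt and then copies the answers
writes `z` (`writable_of_stops`). Hence, if `z` is not writable, all programs that ever halt have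
done so before `α` (`stops_lt_of_agrees`). With oracle `z` such a stage can be recognised by
comparing the answers with the oracle, and at the first one the halting problem is read off
(`lightJump_reducible`). Conversely a writable `z` is decidable without oracle
(`reducible_of_writable`), so nothing lies strictly in between.

The remaining work is to show that this procedure is carried out by actual programs. The procedure
is a transfinite iteration, with limits superior at limit stages, of a transformation of an array of
bits whose rules have finite witnesses (`Sig`). Such iterations are compiled through several layers:
machines that rewrite all blocks of cells in `ω` stages, word machines with registers holding reals,
primitive recursive functions on registers, an endless loop that applies a list of rules in `ω` word
steps (`exists_loop_program`), a two-phase version that allows auxiliary existential bits to be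
negated, and an observer that sees the input and the oracle and decides when to halt and what to
print (`exists_observer_program`). The recurring obligation is that the stages between two
meaningful ones do not disturb the limits superior. -/

theorem run_zero (A : Set CReal) (p : Program) (x : CReal) : run A p x 0 = initConfig x :=
  Ordinal.limitRecOn_zero ..

theorem run_add_one (A : Set CReal) (p : Program) (x : CReal) (α : Ordinal.{0}) :
    run A p x (α + 1) = step A p (run A p x α) :=
  Ordinal.limitRecOn_add_one ..

theorem run_limit (A : Set CReal) (p : Program) (x : CReal) {l : Ordinal.{0}}
    (hl : Order.IsSuccLimit l) : run A p x l = limitConfig l fun β _ => run A p x β :=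
  Ordinal.limitRecOn_limit _ _ _ _ hl

theorem run_add_nat (A : Set CReal) (p : Program) (x : CReal) (α : Ordinal.{0}) (k : ℕ) :
    run A p x (α + k) = (step A p)^[k] (run A p x α) := by
  induction k with
  | zero => simp
  | succ k ih => rw [Function.iterate_succ_apply', ← ih, ← run_add_one, add_assoc]; norm_cast

theorem run_limit_tape (A : Set CReal) (p : Program) (x : CReal) {l : Ordinal.{0}}
    (hl : Order.IsSuccLimit l) (t : Tape) (n : ℕ) :
    (run A p x l).tape t n = true ↔
      ∀ β < l, ∃ γ < l, β ≤ γ ∧ (run A p x γ).tape t n = true := by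
  rw [run_limit A p x hl]
  simp only [limitConfig, decide_eq_true_eq, exists_prop]

theorem run_limit_eq (A : Set CReal) (p : Program) (x : CReal) {l : Ordinal.{0}}
    (hl : Order.IsSuccLimit l) {τ : Tape → CReal}
    (h : ∀ t n, (∀ β < l, ∃ γ < l, β ≤ γ ∧ (run A p x γ).tape t n = true) ↔ τ t n = true) :
    run A p x l = ⟨limitState, 0, τ⟩ := by
  have h1 : (run A p x l).tape = τ := by
    funext t n
    rw [Bool.eq_iff_iff, run_limit_tape A p x hl, h]
  rw [← h1, run_limit A p x hl]
  rfl

theorem lt_add_omega0_iff {a b : Ordinal.{0}} :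
    b < a + Ordinal.omega0 ↔ ∃ k : ℕ, b ≤ a + k := by
  rw [Ordinal.lt_add_iff Ordinal.omega0_ne_zero]
  constructor
  · rintro ⟨d, hd, h⟩
    obtain ⟨k, rfl⟩ := Ordinal.lt_omega0.1 hd
    exact ⟨k, h⟩
  · rintro ⟨k, h⟩
    exact ⟨k, Ordinal.natCast_lt_omega0 k, h⟩

theorem exists_add_nat {a b : Ordinal.{0}} (hab : a ≤ b) (h : b < a + Ordinal.omega0) :
    ∃ k : ℕ, b = a + k := by
  obtain ⟨c, rfl⟩ := exists_add_of_le hab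
  rw [add_lt_add_iff_left] at h
  obtain ⟨k, rfl⟩ := Ordinal.lt_omega0.1 h
  exact ⟨k, rfl⟩

theorem isSuccLimit_add_omega0 (a : Ordinal.{0}) : Order.IsSuccLimit (a + Ordinal.omega0) :=
  Ordinal.isSuccLimit_add a Ordinal.isSuccLimit_omega0

/-- A property of all large `γ < a + ω`. -/
theorem limsup_add_omega0 {a : Ordinal.{0}} {f : Ordinal.{0} → Bool} {b : Bool} {N : ℕ}
    (h : ∀ k : ℕ, N ≤ k → f (a + k) = b) :
    (∀ β < a + Ordinal.omega0, ∃ γ < a + Ordinal.omega0, β ≤ γ ∧ f γ = true) ↔ b = true := by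
  have hlt : ∀ k : ℕ, a + (k : Ordinal) < a + Ordinal.omega0 := fun k =>
    lt_add_omega0_iff.2 ⟨k, le_rfl⟩
  constructor
  · intro H
    obtain ⟨γ, hγ, hle, hf⟩ := H _ (hlt N)
    obtain ⟨k, rfl⟩ := exists_add_nat (le_trans (by simp) hle) hγ
    rw [← h k (by simpa using hle), hf]
  · rintro rfl β hβ
    obtain ⟨k, hk⟩ := lt_add_omega0_iff.1 hβ
    refine ⟨a + (max k N : ℕ), hlt _, hk.trans ?_, h _ (le_max_right _ _)⟩
    gcongr
    exact le_max_left _ _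

/-! ### Programs given by a transition table -/

/-- The program with the given transition table, for the states below `N`. -/
noncomputable def tableProgram (N : ℕ) (δ : ℕ → (Tape → Bool) → (Tape → Bool) × Move × ℕ) :
    Program :=
  (Finset.range N ×ˢ (Finset.univ : Finset (Tape → Bool))).toList.map fun u =>
    ⟨u.1, u.2, (δ u.1 u.2).1, (δ u.1 u.2).2.1, (δ u.1 u.2).2.2⟩

theorem lookup_tableProgram {N : ℕ} (δ : ℕ → (Tape → Bool) → (Tape → Bool) × Move × ℕ) {q : ℕ}
    (hq : q < N) (s : Tape → Bool) :
    (tableProgram N δ).lookup q s = some ⟨q, s, (δ q s).1, (δ q s).2.1, (δ q s).2.2⟩ := by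
  unfold Program.lookup
  cases h : List.find? (fun i => decide (i.state = q ∧ i.read = s)) (tableProgram N δ) with
  | none =>
    have := List.find?_eq_none.1 h ⟨q, s, (δ q s).1, (δ q s).2.1, (δ q s).2.2⟩
      (List.mem_map.2 ⟨(q, s), by simp [hq], rfl⟩)
    simp at this
  | some i =>
    have h1 := List.find?_some h
    obtain ⟨u, -, rfl⟩ := List.mem_map.1 (List.mem_of_find?_eq_some h)
    simp only [decide_eq_true_eq] at h1
    obtain ⟨rfl, rfl⟩ := h1
    rfl

theorem step_tableProgram (A : Set CReal) {N : ℕ}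
    (δ : ℕ → (Tape → Bool) → (Tape → Bool) × Move × ℕ) {c : Config} (hq : c.state < N) :
    step A (tableProgram N δ) c =
      { state := enterState A (δ c.state fun t => c.tape t c.head).2.2
          (c.written (δ c.state fun t => c.tape t c.head).1 oracleTape)
        head := (δ c.state fun t => c.tape t c.head).2.1.apply c.head
        tape := c.written (δ c.state fun t => c.tape t c.head).1 } := by
  unfold step
  rw [lookup_tableProgram δ hq]

/-! ### Machines with a finite type of states -/

/-- The four states in which a computation is begun or resumed from outside. -/
inductive Mode
  | start | limit | yes | no

def Mode.code : Mode → ℕ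
  | start => startState
  | limit => limitState
  | yes => yesState
  | no => noState

/-- What to do after an instruction: halt, query the oracle, or go to a proper state. -/
inductive Target (Q : Type)
  | halt | query | state (q : Q)

/-- A table of instructions with a type `Q` of proper states. In each of the states of `Mode` the
machine behaves as in a proper state. -/
structure Table (Q : Type) where
  tr : Q → (Tape → Bool) → (Tape → Bool) × Move × Target Q
  ini : Mode → Q

namespace Table

variable {Q : Type} [Finite Q] (M : Table Q)

noncomputable def index (q : Q) : ℕ := Finite.equivFin Q q

noncomputable def stateCode (q : Q) : ℕ := 6 + index q

noncomputable def targetCode : Target Q → ℕ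
  | .halt => haltState
  | .query => queryState
  | .state q => stateCode q

-- Proper states are coded from `6` on. The halt and query states fall under the last default, which
-- is harmless: no step that matters is taken from them.
open scoped Classical in
noncomputable def decodeState (n : ℕ) : Q :=
  if h : ∃ q : Q, stateCode q = n then h.choose
  else if n = 0 then M.ini .start
  else if n = 1 then M.ini .limit
  else if n = 4 then M.ini .yes
  else M.ini .no

theorem stateCode_injective : Function.Injective (stateCode : Q → ℕ) := by
  intro q q' h
  simpa [stateCode, index, Fin.val_inj] using h

theorem decodeState_stateCode (q : Q) : M.decodeState (stateCode q) = q := by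
  have h : ∃ q' : Q, stateCode q' = stateCode q := ⟨q, rfl⟩
  rw [decodeState, dif_pos h]
  exact stateCode_injective h.choose_spec

theorem six_le_stateCode (q : Q) : 6 ≤ stateCode q := Nat.le_add_right _ _

theorem decodeState_mode (m : Mode) : M.decodeState m.code = M.ini m := by
  have h : ¬ ∃ q : Q, stateCode q = m.code := by
    rintro ⟨q, hq⟩
    have := six_le_stateCode q
    cases m <;> simp only [Mode.code, startState, limitState, yesState, noState] at hq <;> omega
  rw [decodeState, dif_neg h]
  cases m <;> simp [Mode.code, startState, limitState, yesState, noState]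

noncomputable def program : Program :=
  tableProgram (6 + Nat.card Q) fun n s =>
    ((M.tr (M.decodeState n) s).1, (M.tr (M.decodeState n) s).2.1,
      targetCode (M.tr (M.decodeState n) s).2.2)

open scoped Classical in
/-- The state reached with a given target and a given real on the oracle tape. -/
noncomputable def enter (A : Set CReal) (y : CReal) : Target Q → ℕ
  | .halt => haltState
  | .query => if y ∈ A then yesState else noState
  | .state q => stateCode q

/-- One step from the proper state `q`. -/
noncomputable def next (A : Set CReal) (q : Q) (h : ℕ) (τ : Tape → CReal) : Config :=
  let r := M.tr q fun t => τ t h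
  { state := enter A (Function.update (τ oracleTape) h (r.1 oracleTape)) r.2.2
    head := r.2.1.apply h
    tape := fun t => Function.update (τ t) h (r.1 t) }

theorem step_of_decodeState (A : Set CReal) {n : ℕ} (hn : n < 6 + Nat.card Q) (h : ℕ)
    (τ : Tape → CReal) : step A M.program ⟨n, h, τ⟩ = M.next A (M.decodeState n) h τ := by
  rw [program, step_tableProgram A _ hn]
  unfold next
  have hw : ∀ s, Config.written ⟨n, h, τ⟩ s = fun t => Function.update (τ t) h (s t) := fun _ => rfl
  simp only [hw]
  cases hT : (M.tr (M.decodeState n) fun t => τ t h).2.2 with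
  | halt => simp [targetCode, enterState, enter]
  | query => simp [targetCode, enterState, enter]
  | state q =>
    have := six_le_stateCode q
    have e : ∀ y, enterState A (targetCode (Target.state q)) y = stateCode q := fun y =>
      if_neg (show stateCode q ≠ queryState by unfold queryState; omega)
    simp only [e, enter]

theorem step_stateCode (A : Set CReal) (q : Q) (h : ℕ) (τ : Tape → CReal) :
    step A M.program ⟨stateCode q, h, τ⟩ = M.next A q h τ := by
  rw [step_of_decodeState, decodeState_stateCode]
  exact Nat.add_lt_add_left (Fin.is_lt _) 6

theorem step_mode (A : Set CReal) (m : Mode) (h : ℕ) (τ : Tape → CReal) :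
    step A M.program ⟨m.code, h, τ⟩ = M.next A (M.ini m) h τ := by
  rw [step_of_decodeState, decodeState_mode]
  cases m <;> simp only [Mode.code, startState, limitState, yesState, noState] <;> omega

end Table

end ITTM

namespace ITTM

/-! ### Block machines

A block machine treats `K` consecutive cells of all tapes as one block, and in `ω` stages
replaces every block by a function of its old content and that of its two neighbours. -/

abbrev Block (K : ℕ) : Type := Fin K → Tape → Bool

def block (K : ℕ) (τ : Tape → CReal) (n : ℕ) : Block K := fun i t => τ t (K * n + i)

/-- What a block machine does when it finds the block at the left end in a given mode. -/
inductive Begin (Ω : Type)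
  | halt | query | go (o : Ω)

structure BlockMachine (K : ℕ) (Ω : Type) where
  start : Mode → Block K → Begin Ω
  rule : Ω → Option (Block K) → Block K → Block K → Block K

namespace BlockMachine

variable {K : ℕ} {Ω : Type} (M : BlockMachine K Ω)

/-- The result of a sweep. -/
def sweep (o : Ω) (τ : Tape → CReal) (hK : 0 < K) : Tape → CReal := fun t n =>
  M.rule o (if n / K = 0 then none else some (block K τ (n / K - 1))) (block K τ (n / K))
    (block K τ (n / K + 1)) ⟨n % K, Nat.mod_lt _ hK⟩ t

/-- The proper states: a context (the mode at the left end; further right the operation and the old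
content of the previous block), a clock and a buffer for two blocks. -/
abbrev St (K : ℕ) (Ω : Type) : Type :=
  (Mode ⊕ (Ω × Block K)) × Fin (5 * K) × (Fin (2 * K) → Tape → Bool)

instance : Finite Mode :=
  Finite.of_surjective (![.start, .limit, .yes, .no] : Fin 4 → Mode) fun m => by
    cases m
    exacts [⟨0, rfl⟩, ⟨1, rfl⟩, ⟨2, rfl⟩, ⟨3, rfl⟩]

def mkSt (hK : 0 < K) (c : Mode ⊕ (Ω × Block K)) (j : ℕ) (b : Fin (2 * K) → Tape → Bool) :
    St K Ω :=
  (c, ⟨j % (5 * K), Nat.mod_lt _ (by omega)⟩, b)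

def lo (b : Fin (2 * K) → Tape → Bool) : Block K := fun i => b ⟨i, by omega⟩
def hi (b : Fin (2 * K) → Tape → Bool) : Block K := fun i => b ⟨K + i, by omega⟩

def action : Mode ⊕ (Ω × Block K) → (Fin (2 * K) → Tape → Bool) → Begin Ω
  | .inl m, b => M.start m (lo b)
  | .inr (o, _), _ => .go o

def prev : Mode ⊕ (Ω × Block K) → Option (Block K)
  | .inl _ => none
  | .inr (_, b) => some b

/-- A round on one block takes `5 * K` ticks of the clock: `2 * K` to the right, reading this block
and the next one into the buffer, `2 * K` back, and `K` to overwrite the block. The operation,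
chosen at the left end, and the old content of the block just overwritten travel in the context,
because the next block needs both. -/
def table (hK : 0 < K) : Table (St K Ω) where
  tr q s :=
    if h : q.2.1.1 < 2 * K then
      (s, 2, .state (mkSt hK q.1 (q.2.1.1 + 1) (Function.update q.2.2 ⟨_, h⟩ s)))
    else if q.2.1.1 < 4 * K then
      (s, 0, .state (mkSt hK q.1 (q.2.1.1 + 1) q.2.2))
    else match M.action q.1 q.2.2 with
      | .halt => (s, 1, .halt)
      | .query => (s, 1, .query)
      | .go o =>
        (M.rule o (prev q.1) (lo q.2.2) (hi q.2.2) ⟨(q.2.1.1 - 4 * K) % K, Nat.mod_lt _ hK⟩, 2,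
          if q.2.1.1 + 1 < 5 * K then .state (mkSt hK q.1 (q.2.1.1 + 1) q.2.2)
          else .state (mkSt hK (.inr (o, lo q.2.2)) 0 fun _ _ => false))
  ini m := mkSt hK (.inl m) 0 fun _ _ => false

variable [Finite Ω]

noncomputable def program (hK : 0 < K) : Program := (M.table hK).program

/-- `τ'` on the first `P` cells and `τ` on the others. -/
def mix (P : ℕ) (τ' τ : Tape → CReal) : Tape → CReal := fun t n =>
  if n < P then τ' t n else τ t n

def context (m : Mode) (o : Ω) (τ : Tape → CReal) (n : ℕ) : Mode ⊕ (Ω × Block K) :=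
  if n = 0 then .inl m else .inr (o, block K τ (n - 1))

def buffer (τ : Tape → CReal) (n j : ℕ) : Fin (2 * K) → Tape → Bool := fun i t =>
  if i < j then τ t (K * n + i) else false

/-- The configuration `j` steps after arriving at block `n`. -/
noncomputable def sweepConfig (hK : 0 < K) (m : Mode) (o : Ω) (τ : Tape → CReal) (n j : ℕ) :
    Config where
  state := Table.stateCode (mkSt hK (context m o τ n) j (buffer τ n j))
  head := K * n + if j ≤ 2 * K then j else if j ≤ 4 * K then 4 * K - j else j - 4 * K
  tape := mix (K * n + (j - 4 * K)) (M.sweep o τ hK) τ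

omit [Finite Ω] in
theorem lo_buffer (τ : Tape → CReal) (n : ℕ) {j : ℕ} (hj : 2 * K ≤ j) :
    lo (buffer τ n j : Fin (2 * K) → Tape → Bool) = block K τ n := by
  funext i t
  have := i.2
  simp only [lo, buffer, block]
  rw [if_pos (by omega)]

omit [Finite Ω] in
theorem hi_buffer (τ : Tape → CReal) (n : ℕ) {j : ℕ} (hj : 2 * K ≤ j) :
    hi (buffer τ n j : Fin (2 * K) → Tape → Bool) = block K τ (n + 1) := by
  funext i t
  have := i.2
  simp only [hi, buffer, block]
  rw [if_pos (by omega), mul_add, mul_one, add_assoc]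

theorem step_read (A : Set CReal) (hK : 0 < K) (m : Mode) (o : Ω) (τ : Tape → CReal) (n : ℕ)
    {j : ℕ} (hj : j < 4 * K) :
    step A (M.program hK) (M.sweepConfig hK m o τ n j) = M.sweepConfig hK m o τ n (j + 1) := by
  have hmod : j % (5 * K) = j := Nat.mod_eq_of_lt (by omega)
  unfold sweepConfig program
  rw [Table.step_stateCode]
  have h1 : j - 4 * K = 0 := by omega
  have h2 : j + 1 - 4 * K = 0 := by omega
  have h3 : j ≤ 4 * K := by omega
  rw [h1, h2]
  simp only [Table.next, table, mkSt, hmod]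
  by_cases hjK : j < 2 * K
  · have h4 : j ≤ 2 * K := by omega
    have h5 : j + 1 ≤ 2 * K := by omega
    simp only [hjK, h4, h5, if_true, dif_pos, Table.enter, Move.apply, Function.update_eq_self]
    simp only [Config.mk.injEq]
    refine ⟨?_, rfl, trivial⟩
    congr 3
    funext i t
    by_cases hi : (i : ℕ) = j
    · have : i = ⟨j, hjK⟩ := Fin.ext hi
      subst this
      simp [buffer, mix]
    · rw [Function.update_of_ne (fun h => hi (by rw [h]))]
      simp only [buffer]
      congr 1
      exact propext ⟨fun h => by omega, fun h => by omega⟩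
  · have h5 : ¬ j + 1 ≤ 2 * K := by omega
    have h6 : j + 1 ≤ 4 * K := by omega
    have hb : (buffer τ n (j + 1) : Fin (2 * K) → Tape → Bool) = buffer τ n j := by
      funext i t
      have := i.2
      simp only [buffer]
      rw [if_pos (by omega), if_pos (by omega)]
    simp only [hjK, h3, h5, h6, hj, if_true, if_false, dif_neg, not_false_eq_true, Table.enter,
      Function.update_eq_self, hb]
    simp only [Config.mk.injEq, true_and, and_true]
    simp only [Move.apply, if_true]
    by_cases h7 : j ≤ 2 * K
    · rw [if_pos h7]; omega
    · rw [if_neg h7]; omega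

omit [Finite Ω] in
theorem action_context {m : Mode} {o : Ω} {τ : Tape → CReal}
    (ho : M.start m (block K τ 0) = .go o) (n : ℕ) {j : ℕ} (hj : 2 * K ≤ j) :
    M.action (context m o τ n) (buffer τ n j) = .go o := by
  unfold context
  split_ifs with h
  · subst h
    simp only [action, lo_buffer τ 0 hj, ho]
  · rfl

/-- The new bits depend only on the buffer and the context, both recorded before the overwriting
began, so cells that have already changed do no harm. -/
theorem step_write (A : Set CReal) (hK : 0 < K) {m : Mode} {o : Ω} {τ : Tape → CReal}
    (ho : M.start m (block K τ 0) = .go o) (n : ℕ) {j : ℕ} (hj : 4 * K ≤ j) (hj' : j < 5 * K) :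
    step A (M.program hK) (M.sweepConfig hK m o τ n j) =
      if j + 1 < 5 * K then M.sweepConfig hK m o τ n (j + 1)
      else M.sweepConfig hK m o τ (n + 1) 0 := by
  have hmod : j % (5 * K) = j := Nat.mod_eq_of_lt (by omega)
  obtain ⟨i, rfl⟩ := Nat.exists_eq_add_of_le hj
  have hi : i < K := by omega
  have hhead : (if 4 * K + i ≤ 2 * K then 4 * K + i else
      if 4 * K + i ≤ 4 * K then 4 * K - (4 * K + i) else i) = i := by
    split_ifs <;> omega
  have hdiv : (K * n + i) / K = n := by
    rw [Nat.mul_add_div hK, Nat.div_eq_of_lt hi, add_zero]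
  have hmod' : (K * n + i) % K = i := by rw [Nat.mul_add_mod, Nat.mod_eq_of_lt hi]
  have htape : ∀ P, P = K * n + i + 1 → (fun t => Function.update
      (mix (K * n + i) (M.sweep o τ hK) τ t) (K * n + i)
      (M.rule o (prev (context m o τ n)) (block K τ n) (block K τ (n + 1)) ⟨i, hi⟩ t)) =
      mix P (M.sweep o τ hK) τ := by
    rintro P rfl
    funext t k
    by_cases hk : k = K * n + i
    · subst hk
      simp only [Function.update_self, mix, lt_add_iff_pos_right, zero_lt_one, if_true, sweep]
      simp only [hdiv, hmod']
      congr 1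
      unfold context prev
      split_ifs <;> rfl
    · rw [Function.update_of_ne hk]
      simp only [mix]
      congr 1
      exact propext ⟨fun h => by omega, fun h => by omega⟩
  have hb : ∀ k, (buffer τ n (4 * K + k) : Fin (2 * K) → Tape → Bool) = buffer τ n (4 * K) := by
    intro k
    funext i t
    have := i.2
    simp only [buffer]
    rw [if_pos (by omega), if_pos (by omega)]
  unfold sweepConfig program
  rw [Table.step_stateCode]
  have h1 : ¬ 4 * K + i < 2 * K := by omega
  have h2 : ¬ 4 * K + i < 4 * K := by omega
  simp only [Table.next, table, mkSt, hmod, h1, h2, dif_neg, not_false_eq_true, if_false, hhead,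
    M.action_context ho n (show 2 * K ≤ 4 * K + i by omega),
    lo_buffer τ n (show 2 * K ≤ 4 * K + i by omega),
    hi_buffer τ n (show 2 * K ≤ 4 * K + i by omega), Nat.add_sub_cancel_left, Nat.mod_eq_of_lt hi,
    Move.apply]
  by_cases hlast : 4 * K + i + 1 < 5 * K
  · simp only [hlast, if_true, Table.enter]
    rw [htape _ (show K * n + (4 * K + i + 1 - 4 * K) = _ by omega)]
    simp only [Config.mk.injEq, and_true]
    refine ⟨?_, ?_⟩
    · rw [add_assoc, hb, hb]
    · rw [if_neg (by decide), if_neg (by decide), if_neg (by omega), if_neg (by omega)]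
      omega
  · have hi' : i + 1 = K := by omega
    simp only [hlast, if_false, Table.enter]
    rw [htape _ (show K * (n + 1) + (0 - 4 * K) = _ by rw [mul_add]; omega)]
    simp only [Config.mk.injEq, and_true]
    refine ⟨?_, ?_⟩
    · congr 3
    · rw [if_neg (by decide), if_neg (by decide), if_pos (by omega), mul_add]
      omega

end BlockMachine
end ITTM

/-! ### Transfinite runs of block machines -/

namespace ITTM
namespace BlockMachine

variable {K : ℕ} {Ω : Type} (M : BlockMachine K Ω) [Finite Ω]

theorem _root_.ITTM.Mode.code_ne_halt (m : Mode) : m.code ≠ haltState := by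
  cases m <;> simp [Mode.code, startState, limitState, yesState, noState, haltState]

theorem sweepConfig_state_ne (hK : 0 < K) (m : Mode) (o : Ω) (τ : Tape → CReal) (n j : ℕ) :
    (M.sweepConfig hK m o τ n j).state ≠ haltState := by
  have := Table.six_le_stateCode (mkSt hK (context m o τ n) j (buffer τ n j))
  simp only [sweepConfig, haltState]
  omega

omit [Finite Ω] in
theorem mix_zero (τ' τ : Tape → CReal) : mix 0 τ' τ = τ := by
  funext t n
  simp [mix]

/-- A mode and its proper copy have different codes but the same instructions, so it is only their
successors that coincide. The operation `o` is a dummy: the context at block `0` does not contain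
it. -/
theorem step_mode (A : Set CReal) (hK : 0 < K) (m : Mode) (o : Ω) (τ : Tape → CReal) :
    step A (M.program hK) ⟨m.code, 0, τ⟩ = step A (M.program hK) (M.sweepConfig hK m o τ 0 0) := by
  have hb : (buffer τ 0 0 : Fin (2 * K) → Tape → Bool) = fun _ _ => false := by
    funext i t
    simp [buffer]
  unfold sweepConfig program
  rw [Table.step_mode, Table.step_stateCode, hb]
  simp only [context, if_true, table, Nat.zero_sub, mul_zero, Nat.zero_le, Nat.zero_add, mix_zero]

theorem iterate_read (A : Set CReal) (hK : 0 < K) (m : Mode) (o : Ω) (τ : Tape → CReal) {k : ℕ}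
    (hk : k < 4 * K) :
    (step A (M.program hK))^[k + 1] ⟨m.code, 0, τ⟩ = M.sweepConfig hK m o τ 0 (k + 1) := by
  induction k with
  | zero => rw [Function.iterate_one, M.step_mode A hK m o, M.step_read A hK m o τ 0 (by omega)]
  | succ k ih => rw [Function.iterate_succ_apply', ih (by omega), M.step_read A hK m o τ 0 hk]

theorem iterate_sweep (A : Set CReal) (hK : 0 < K) {m : Mode} {o : Ω} {τ : Tape → CReal}
    (ho : M.start m (block K τ 0) = .go o) (k : ℕ) :
    (step A (M.program hK))^[k + 1] ⟨m.code, 0, τ⟩ =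
      M.sweepConfig hK m o τ ((k + 1) / (5 * K)) ((k + 1) % (5 * K)) := by
  induction k with
  | zero =>
    rw [M.iterate_read A hK m o τ (by omega), Nat.div_eq_of_lt (by omega),
      Nat.mod_eq_of_lt (by omega)]
  | succ k ih =>
    rw [Function.iterate_succ_apply', ih]
    have h5 : 0 < 5 * K := by omega
    generalize k + 1 = l
    have hl := Nat.div_add_mod l (5 * K)
    have hm := Nat.mod_lt l h5
    generalize l / (5 * K) = n at *
    generalize l % (5 * K) = j at *
    subst hl
    by_cases hlast : j + 1 < 5 * K
    · have e1 : (5 * K * n + j + 1) / (5 * K) = n := by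
        rw [add_assoc, Nat.mul_add_div h5, Nat.div_eq_of_lt hlast, add_zero]
      have e2 : (5 * K * n + j + 1) % (5 * K) = j + 1 := by
        rw [add_assoc, Nat.mul_add_mod, Nat.mod_eq_of_lt hlast]
      rw [e1, e2]
      by_cases hj : j < 4 * K
      · exact M.step_read A hK m o τ n hj
      · rw [M.step_write A hK ho n (by omega) (by omega), if_pos hlast]
    · have e : 5 * K * n + j + 1 = 5 * K * (n + 1) + 0 := by rw [mul_add]; omega
      have e1 : (5 * K * n + j + 1) / (5 * K) = n + 1 := by
        rw [e, add_zero, Nat.mul_div_cancel_left _ h5]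
      have e2 : (5 * K * n + j + 1) % (5 * K) = 0 := by
        rw [e, add_zero, Nat.mul_mod_right]
      rw [e1, e2, M.step_write A hK ho n (by omega) (by omega), if_neg hlast]

variable {A : Set CReal} {x : CReal} {hK : 0 < K} {γ : Ordinal.{0}} {m : Mode} {τ : Tape → CReal}

/-- Every cell is rewritten once and then left alone, so it converges. That it shows only its old or
its new bit in between is what later keeps the intermediate stages out of limits superior. -/
theorem run_sweep (hrun : run A (M.program hK) x γ = ⟨m.code, 0, τ⟩) {o : Ω}
    (ho : M.start m (block K τ 0) = .go o) :
    (∀ k : ℕ, (run A (M.program hK) x (γ + k)).state ≠ haltState ∧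
      ∀ t n, (run A (M.program hK) x (γ + k)).tape t n = τ t n ∨
        (run A (M.program hK) x (γ + k)).tape t n = M.sweep o τ hK t n) ∧
    run A (M.program hK) x (γ + Ordinal.omega0) = ⟨Mode.limit.code, 0, M.sweep o τ hK⟩ := by
  have key : ∀ k : ℕ, run A (M.program hK) x (γ + (k + 1 : ℕ)) =
      M.sweepConfig hK m o τ ((k + 1) / (5 * K)) ((k + 1) % (5 * K)) := fun k => by
    rw [run_add_nat, hrun, M.iterate_sweep A hK ho]
  refine ⟨fun k => ?_, ?_⟩
  · cases k with
    | zero => simp [hrun, m.code_ne_halt]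
    | succ k =>
      rw [key k]
      refine ⟨M.sweepConfig_state_ne hK _ _ _ _ _, fun t n => ?_⟩
      simp only [sweepConfig, mix]
      split_ifs <;> simp
  · refine run_limit_eq A _ x (isSuccLimit_add_omega0 γ) fun t n => ?_
    -- After `5 * K * (n + 1)` steps the first `n + 1` blocks are final, and cell `n` lies in them.
    -- One more step is asked for because `key` speaks of positive numbers of steps.
    refine limsup_add_omega0 (N := 5 * K * (n + 1) + 1)
        (f := fun δ => (run A (M.program hK) x δ).tape t n) fun k hk => ?_
    obtain ⟨k, rfl⟩ : ∃ l, k = l + 1 := ⟨k - 1, by omega⟩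
    simp only [key, sweepConfig, mix]
    rw [if_pos]
    have h5 : 0 < 5 * K := by omega
    have : n + 1 ≤ (k + 1) / (5 * K) := by
      rw [Nat.le_div_iff_mul_le h5, mul_comm]; omega
    calc n < 1 * (n + 1) := by omega
      _ ≤ K * ((k + 1) / (5 * K)) := Nat.mul_le_mul hK this
      _ ≤ _ := Nat.le_add_right _ _

theorem run_start_halt [Nonempty Ω] (hrun : run A (M.program hK) x γ = ⟨m.code, 0, τ⟩) :
    (∀ k : ℕ, k ≤ 4 * K → (run A (M.program hK) x (γ + k)).state ≠ haltState ∧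
      (run A (M.program hK) x (γ + k)).tape = τ) ∧
    (M.start m (block K τ 0) = .halt →
      run A (M.program hK) x (γ + (4 * K + 1 : ℕ)) = ⟨haltState, 0, τ⟩) ∧
    (M.start m (block K τ 0) = .query → τ oracleTape ∈ A →
      run A (M.program hK) x (γ + (4 * K + 1 : ℕ)) = ⟨Mode.yes.code, 0, τ⟩) ∧
    (M.start m (block K τ 0) = .query → τ oracleTape ∉ A →
      run A (M.program hK) x (γ + (4 * K + 1 : ℕ)) = ⟨Mode.no.code, 0, τ⟩) := by
  -- Any operation serves to describe the reading of block `0`, where none has been chosen yet.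
  obtain ⟨o⟩ := ‹Nonempty Ω›
  have key : ∀ k : ℕ, k < 4 * K →
      run A (M.program hK) x (γ + (k + 1 : ℕ)) = M.sweepConfig hK m o τ 0 (k + 1) := fun k hk => by
    rw [run_add_nat, hrun, M.iterate_read A hK m o τ hk]
  refine ⟨fun k hk => ?_, ?_⟩
  · cases k with
    | zero => simp [hrun, m.code_ne_halt]
    | succ k =>
      rw [key k (by omega)]
      refine ⟨M.sweepConfig_state_ne hK _ _ _ _ _, ?_⟩
      simp only [sweepConfig]
      rw [show K * 0 + (k + 1 - 4 * K) = 0 by omega, mix_zero]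
  · rw [Nat.cast_succ, ← add_assoc, run_add_one]
    obtain ⟨k, hk⟩ : ∃ l, 4 * K = l + 1 := ⟨4 * K - 1, by omega⟩
    rw [hk, key k (by omega), ← hk]
    unfold sweepConfig program
    rw [Table.step_stateCode]
    have hmod : (4 * K) % (5 * K) = 4 * K := Nat.mod_eq_of_lt (by omega)
    have h1 : ¬ 4 * K < 2 * K := by omega
    have h2 : ¬ 4 * K ≤ 2 * K := by omega
    have hact : M.action (context m o τ 0) (buffer τ 0 (4 * K)) = M.start m (block K τ 0) := by
      simp [context, action, lo_buffer τ 0 (show 2 * K ≤ 4 * K by omega)]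
    simp only [Table.next, table, mkSt, hmod, h1, h2, lt_irrefl, dif_neg, not_false_eq_true, if_false,
      hact, mul_zero, tsub_self, add_zero, mix_zero, ite_self]
    refine ⟨fun ho => ?_, fun ho hA => ?_, fun ho hA => ?_⟩
    · simp [ho, Table.enter, Move.apply]
    · simp [ho, Table.enter, Move.apply, Mode.code, hA]
    · simp [ho, Table.enter, Move.apply, Mode.code, hA]

/-- A sweep, possibly after a query. -/
theorem run_action [Nonempty Ω] (hrun : run A (M.program hK) x γ = ⟨m.code, 0, τ⟩) {o : Ω}
    (ho : M.start m (block K τ 0) = .go o ∨ (M.start m (block K τ 0) = .query ∧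
      ((τ oracleTape ∈ A ∧ M.start .yes (block K τ 0) = .go o) ∨
        (τ oracleTape ∉ A ∧ M.start .no (block K τ 0) = .go o)))) :
    (∀ k : ℕ, (run A (M.program hK) x (γ + k)).state ≠ haltState ∧
      ∀ t n, (run A (M.program hK) x (γ + k)).tape t n = τ t n ∨
        (run A (M.program hK) x (γ + k)).tape t n = M.sweep o τ hK t n) ∧
    run A (M.program hK) x (γ + Ordinal.omega0) = ⟨Mode.limit.code, 0, M.sweep o τ hK⟩ := by
  rcases ho with ho | ⟨ho, hA⟩
  · exact M.run_sweep hrun ho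
  obtain ⟨h1, -, h2, h3⟩ := M.run_start_halt hrun
  obtain ⟨m', hm', ho'⟩ : ∃ m' : Mode,
      run A (M.program hK) x (γ + (4 * K + 1 : ℕ)) = ⟨m'.code, 0, τ⟩ ∧
      M.start m' (block K τ 0) = .go o := by
    rcases hA with ⟨hA, h⟩ | ⟨hA, h⟩
    exacts [⟨_, h2 ho hA, h⟩, ⟨_, h3 ho hA, h⟩]
  obtain ⟨h4, h5⟩ := M.run_sweep hm' ho'
  refine ⟨fun k => ?_, ?_⟩
  · by_cases hk : k ≤ 4 * K
    · exact ⟨(h1 k hk).1, fun t n => .inl (by rw [(h1 k hk).2])⟩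
    · obtain ⟨l, rfl⟩ := Nat.exists_eq_add_of_le (show 4 * K + 1 ≤ k by omega)
      have := h4 l
      rwa [add_assoc, ← Nat.cast_add] at this
  -- The finite delay caused by the query is absorbed by `ω`.
  · rwa [add_assoc, Ordinal.natCast_add_omega0] at h5

end BlockMachine
end ITTM

namespace ITTM

/-! ### Word machines

A word machine has registers holding reals and a structured program of word operations. The
registers `nat 0`, `nat 1`, `nat 2` are the input, output and oracle tapes; the registers `trk i`
are interleaved on the scratch tape. -/

inductive Reg
  | nat (t : Fin 3)
  | trk (i : ℕ)
  deriving DecidableEq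

abbrev Store : Type := Reg → CReal

/-- A local function of two words. -/
def localOp (f : Option Bool → Bool → Bool → Bool → Bool) (u v : CReal) : CReal := fun n =>
  f (if n = 0 then none else some (u (n - 1))) (u n) (v n) (u (n + 1))

/-- The two kinds of registers are never mixed: bit `n` of a tape register is at cell `n`, bit `n`
of a track is in block `n`, and these drift apart, so no local rule can combine them. -/
inductive Op
  | nat (d a b : Fin 3) (f : Option Bool → Bool → Bool → Bool → Bool)
  | trk (d a b : ℕ) (f : Option Bool → Bool → Bool → Bool → Bool)

def Op.apply : Op → Store → Store
  | nat d a b f, σ => Function.update σ (.nat d) (localOp f (σ (.nat a)) (σ (.nat b)))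
  | trk d a b f, σ => Function.update σ (.trk d) (localOp f (σ (.trk a)) (σ (.trk b)))

inductive Cmd
  | op (o : Op)
  | seq (c d : Cmd)
  | ite (r : Reg) (c d : Cmd)
  | loop (r : Reg) (c : Cmd)
  | query (c d : Cmd)
  | halt

namespace Cmd

def stops : List Cmd → Bool
  | [] => true
  | halt :: _ => true
  | _ => false

def isQuery : List Cmd → Bool
  | query _ _ :: _ => true
  | _ => false

def opOf : List Cmd → Option Op
  | op o :: _ => some o
  | _ => none

def testReg : List Cmd → Reg
  | ite r _ _ :: _ => r
  | loop r _ :: _ => r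
  | _ => .nat 0

def next : List Cmd → (bit ans : Bool) → List Cmd
  | op _ :: k, _, _ => k
  | seq c d :: k, _, _ => c :: d :: k
  | ite _ c d :: k, b, _ => (bif b then c else d) :: k
  | loop r c :: k, b, _ => bif b then c :: loop r c :: k else k
  | query c d :: k, _, a => (bif a then c else d) :: k
  | halt :: k, _, _ => halt :: k
  | [], _, _ => []

end Cmd

def applyOption : Option Op → Store → Store
  | none, σ => σ
  | some o, σ => o.apply σ

open scoped Classical in
noncomputable def wstep (A : Set CReal) (c : List Cmd × Store) : List Cmd × Store :=
  (Cmd.next c.1 (c.2 (Cmd.testReg c.1) 0) (decide (c.2 (.nat 2) ∈ A)),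
    applyOption (Cmd.opOf c.1) c.2)

open scoped Classical in
noncomputable def wrun (A : Set CReal) (entry lim : List Cmd) (σ : Store) (α : Ordinal.{0}) :
    List Cmd × Store :=
  Ordinal.limitRecOn α (entry, σ) (fun _ c => wstep A c) fun l _ c =>
    (lim, fun r n => decide (∀ β < l, ∃ γ, ∃ h : γ < l, β ≤ γ ∧ (c γ h).2 r n = true))

section wrun

variable (A : Set CReal) (entry lim : List Cmd) (σ : Store)

theorem wrun_zero : wrun A entry lim σ 0 = (entry, σ) := Ordinal.limitRecOn_zero ..

theorem wrun_add_one (α : Ordinal.{0}) :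
    wrun A entry lim σ (α + 1) = wstep A (wrun A entry lim σ α) :=
  Ordinal.limitRecOn_add_one ..

theorem wrun_add_nat (α : Ordinal.{0}) (k : ℕ) :
    wrun A entry lim σ (α + k) = (wstep A)^[k] (wrun A entry lim σ α) := by
  induction k with
  | zero => simp
  | succ k ih => rw [Function.iterate_succ_apply', ← ih, ← wrun_add_one, add_assoc]; norm_cast

theorem wrun_limit_fst {l : Ordinal.{0}} (hl : Order.IsSuccLimit l) :
    (wrun A entry lim σ l).1 = lim := by
  unfold wrun
  rw [Ordinal.limitRecOn_limit _ _ _ _ hl]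

theorem wrun_limit_snd {l : Ordinal.{0}} (hl : Order.IsSuccLimit l) (r : Reg) (n : ℕ) :
    (wrun A entry lim σ l).2 r n = true ↔
      ∀ β < l, ∃ γ < l, β ≤ γ ∧ (wrun A entry lim σ γ).2 r n = true := by
  unfold wrun
  rw [Ordinal.limitRecOn_limit _ _ _ _ hl]
  simp only [decide_eq_true_eq, exists_prop, and_left_comm]

end wrun

def Reg.bound (R : ℕ) : Reg → Prop
  | .nat _ => True
  | .trk i => i < R

def Op.bound (R : ℕ) : Op → Prop
  | .nat .. => True
  | .trk d a b _ => d < R ∧ a < R ∧ b < R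

/-- The control part of a word machine: a finite set of continuations containing the initial one
and the one used at limit stages and closed under the steps of computation. -/
structure Control where
  F : Set (List Cmd)
  R : ℕ
  entry : List Cmd
  lim : List Cmd
  finite : F.Finite
  entry_mem : entry ∈ F
  lim_mem : lim ∈ F
  entry_query : Cmd.isQuery entry = false
  next_mem : ∀ l ∈ F, Cmd.stops l = false → ∀ b a, Cmd.next l b a ∈ F
  op_bound : ∀ l ∈ F, ∀ o, Cmd.opOf l = some o → o.bound R
  test_bound : ∀ l ∈ F, (Cmd.testReg l).bound R

namespace Control

variable (W : Control)

/-- Besides the continuation, a label has a bit that is flipped at every word step. It makes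
consecutive labels different, so that a limit of sweeps leaves more than one label in the header,
whereas the end of a single sweep leaves exactly one. -/
abbrev Label : Type := W.F × Bool

instance : Finite W.F := W.finite

noncomputable def labels : ℕ := Nat.card W.Label

/-- The number of tracks: the registers and one for each label. -/
noncomputable def K : ℕ := W.R + W.labels

noncomputable def equiv : W.Label ≃ Fin W.labels := Finite.equivFin _

theorem labels_pos : 0 < W.labels :=
  Nat.card_pos_iff.2 ⟨⟨⟨⟨W.entry, W.entry_mem⟩, false⟩⟩, inferInstance⟩

theorem K_pos : 0 < W.K := Nat.add_pos_right _ W.labels_pos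

def _root_.ITTM.Block.cell {K : ℕ} (b : Block K) (i : ℕ) (t : Tape) : Bool :=
  if h : i < K then b ⟨i, h⟩ t else false

def tapeOf : Fin 3 → Tape := ![inputTape, outputTape, oracleTape]

noncomputable def header (b : Block W.K) (μ : W.Label) : Bool :=
  b.cell (W.R + W.equiv μ) scratchTape

def OneHot (h : W.Label → Bool) (μ : W.Label) : Prop := ∀ ν, h ν = true ↔ ν = μ

-- The machine is in the limit state after every sweep. A header with a single label means that a
-- sweep has just been completed; otherwise the stage is a limit of sweeps, and the computation
-- continues with `lim`.
open scoped Classical in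
noncomputable def current (b : Block W.K) : Mode → W.Label
  | .start => (⟨W.entry, W.entry_mem⟩, false)
  | _ => if h : ∃ μ, W.OneHot (W.header b) μ then h.choose else (⟨W.lim, W.lim_mem⟩, false)

noncomputable def bit (b : Block W.K) : Reg → Bool
  | .nat t => b.cell 0 (tapeOf t)
  | .trk i => b.cell i scratchTape

open scoped Classical in
noncomputable def toF (l : List Cmd) : W.F :=
  if h : l ∈ W.F then ⟨l, h⟩ else ⟨W.entry, W.entry_mem⟩

def isYes : Mode → Bool
  | .yes => true
  | _ => false

def isAnswer : Mode → Bool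
  | .yes => true
  | .no => true
  | _ => false

-- The header is written in block `0` only, which is recognised by its having no left neighbour.
open scoped Classical in
noncomputable def machine : BlockMachine W.K (W.Label × W.Label) where
  start m b :=
    let μ := W.current b m
    if Cmd.stops μ.1 then .halt
    else if Cmd.isQuery μ.1 && !isAnswer m then .query
    else .go (μ, (W.toF (Cmd.next μ.1 (W.bit b (Cmd.testReg μ.1)) (isYes m)), !μ.2))
  rule o prev b c := fun i t =>
    if t = scratchTape ∧ W.R ≤ i then
      match prev with
      | none => decide (W.R + W.equiv o.2 = i)
      | some _ => b i t
    else match Cmd.opOf o.1.1 with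
      | none => b i t
      | some (.nat d u v f) =>
        if t = tapeOf d then
          f (if (i : ℕ) = 0 then prev.map fun p => p.cell (W.K - 1) (tapeOf u)
              else some (b.cell (i - 1) (tapeOf u)))
            (b i (tapeOf u)) (b i (tapeOf v))
            (if (i : ℕ) + 1 < W.K then b.cell (i + 1) (tapeOf u) else c.cell 0 (tapeOf u))
        else b i t
      | some (.trk d u v f) =>
        if t = scratchTape ∧ (i : ℕ) = d then
          f (prev.map fun p => p.cell u scratchTape) (b.cell u scratchTape)
            (b.cell v scratchTape) (c.cell u scratchTape)
        else b i t

/-- The tapes show the contents of the registers. -/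
def Shows (τ : Tape → CReal) (σ : Store) : Prop :=
  (∀ t n, τ (tapeOf t) n = σ (.nat t) n) ∧
    ∀ i < W.R, ∀ n, τ scratchTape (W.K * n + i) = σ (.trk i) n

noncomputable def headerOf (τ : Tape → CReal) : W.Label → Bool := W.header (block W.K τ 0)

theorem cell_block {K : ℕ} (τ : Tape → CReal) (n : ℕ) {i : ℕ} (hi : i < K) (t : Tape) :
    (block K τ n).cell i t = τ t (K * n + i) := by
  simp [Block.cell, block, hi]

theorem tapeOf_injective : Function.Injective tapeOf := by decide

theorem tapeOf_ne_scratch (t : Fin 3) : tapeOf t ≠ scratchTape := by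
  revert t; decide

theorem headerOf_sweep (o : W.Label × W.Label) (τ : Tape → CReal) :
    W.OneHot (W.headerOf (W.machine.sweep o τ W.K_pos)) o.2 := by
  intro ν
  have hK : W.R + W.equiv ν < W.K := Nat.add_lt_add_left (W.equiv ν).2 _
  rw [headerOf, header, cell_block _ _ hK]
  simp only [BlockMachine.sweep, machine, mul_zero, zero_add, Nat.div_eq_of_lt hK,
    Nat.mod_eq_of_lt hK]
  simp only [if_true, true_and, Nat.le_add_right, decide_eq_true_eq]
  constructor
  · intro h
    exact (W.equiv.injective (Fin.ext (by omega))).symm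
  · rintro rfl
    rfl

/-- The neighbours of a bit on a track lie in the adjacent blocks. Those of a tape cell usually lie
in the same block, with exceptions at its two ends. -/
theorem shows_sweep (o : W.Label × W.Label) {τ : Tape → CReal} {σ : Store} (h : W.Shows τ σ) :
    W.Shows (W.machine.sweep o τ W.K_pos) (applyOption (Cmd.opOf o.1.1) σ) := by
  have hK := W.K_pos
  constructor
  · intro t n
    obtain ⟨q, i, hm, hn⟩ : ∃ q i, i < W.K ∧ W.K * q + i = n :=
      ⟨_, _, Nat.mod_lt n hK, Nat.div_add_mod n W.K⟩
    have hdiv : n / W.K = q := by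
      rw [← hn, Nat.mul_add_div hK, Nat.div_eq_of_lt hm, add_zero]
    have hmod : n % W.K = i := by rw [← hn, Nat.mul_add_mod, Nat.mod_eq_of_lt hm]
    simp only [BlockMachine.sweep, machine, tapeOf_ne_scratch, false_and, if_false, hdiv, hmod]
    cases hop : Cmd.opOf o.1.1 with
    | none => simp only [applyOption, block, hn, h.1]
    | some op =>
      cases op with
      | trk d u v f => simp only [applyOption, Op.apply, block, hn]; simp [h.1]
      | nat d u v f =>
        simp only [applyOption, Op.apply, tapeOf_injective.eq_iff]
        by_cases htd : t = d
        · subst htd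
          simp only [if_true, Function.update_self, localOp, block, hn, h.1]
          congr 1
          · by_cases hi : i = 0
            · subst hi
              by_cases hq : q = 0
              · subst hq
                simp at hn
                simp [hn]
              · have hn0 : n ≠ 0 := by
                  rw [← hn]; exact (Nat.add_pos_left (Nat.mul_pos hK (by omega)) _).ne'
                simp only [hq, hn0, if_true, if_false, Option.map_some]
                rw [← h.1]
                change some ((block W.K τ (q - 1)).cell _ _) = _
                rw [cell_block _ _ (by omega)]
                congr 2
                obtain ⟨q, rfl⟩ : ∃ r, q = r + 1 := ⟨q - 1, by omega⟩
                rw [mul_add] at hn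
                simp only [Nat.add_sub_cancel]
                omega
            · have hn0 : n ≠ 0 := by omega
              simp only [hi, hn0, if_false]
              rw [← h.1]
              change some ((block W.K τ q).cell _ _) = _
              rw [cell_block _ _ (by omega)]
              congr 2
              omega
          · rw [← h.1]
            split_ifs with h1
            · rw [cell_block _ _ (by omega)]
              congr 1
              omega
            · rw [cell_block _ _ hK, mul_add]
              congr 1
              omega
        · simp only [htd, if_false, block, hn, h.1]
          rw [Function.update_of_ne (by simpa using htd)]
  · intro i hi n
    have hiK : i < W.K := lt_of_lt_of_le hi (Nat.le_add_right _ _)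
    have hdiv : (W.K * n + i) / W.K = n := by
      rw [Nat.mul_add_div hK, Nat.div_eq_of_lt hiK, add_zero]
    have hmod : (W.K * n + i) % W.K = i := by rw [Nat.mul_add_mod, Nat.mod_eq_of_lt hiK]
    simp only [BlockMachine.sweep, machine, hdiv, hmod]
    rw [if_neg (by simpa using hi)]
    cases hop : Cmd.opOf o.1.1 with
    | none => simp only [applyOption, block, h.2 i hi]
    | some op =>
      cases op with
      | nat d u v f =>
        simp only [applyOption, Op.apply, block]
        rw [if_neg (tapeOf_ne_scratch d).symm, h.2 i hi]
        simp
      | trk d u v f =>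
        obtain ⟨hd, hu, hv⟩ := W.op_bound _ o.1.1.2 _ hop
        have hRK : W.R ≤ W.K := Nat.le_add_right _ _
        simp only [applyOption, Op.apply, true_and]
        by_cases hid : i = d
        · subst hid
          simp only [if_true, Function.update_self, localOp]
          rw [cell_block _ _ (by omega), cell_block _ _ (by omega), cell_block _ _ (by omega),
            h.2 _ hu, h.2 _ hu, h.2 _ hv]
          congr 1
          split_ifs
          · rfl
          · rw [Option.map_some, cell_block _ _ (by omega), h.2 _ hu]
        · simp only [hid, if_false, block]
          rw [h.2 i hi, Function.update_of_ne (by simpa using hid)]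

end Control
end ITTM

/-! ### Correctness of the compilation of word machines -/

namespace ITTM

theorem exists_omega0_mul_add {l δ : Ordinal.{0}} (h : δ < Ordinal.omega0 * l) :
    ∃ γ < l, ∃ k : ℕ, δ = Ordinal.omega0 * γ + k := by
  obtain ⟨k, hk⟩ := Ordinal.lt_omega0.1 (Ordinal.mod_lt δ Ordinal.omega0_ne_zero)
  refine ⟨δ / Ordinal.omega0, (Ordinal.lt_mul_iff_div_lt Ordinal.omega0_ne_zero).1 h, k, ?_⟩
  rw [← hk, Ordinal.div_add_mod]

theorem Cmd.next_of_isQuery {l : List Cmd} (h : Cmd.isQuery l = false) (b a a' : Bool) :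
    Cmd.next l b a = Cmd.next l b a' := by
  rcases l with _ | ⟨c, k⟩
  · rfl
  · cases c <;> first | rfl | simp [isQuery] at h

/-- The initial contents of the registers on input `x`. -/
def initStore (x : CReal) : Store := fun r => if r = .nat 0 then x else fun _ => false

namespace Control

variable (W : Control)

theorem current_of_oneHot {b : Block W.K} {μ : W.Label} (h : W.OneHot (W.header b) μ) :
    W.current b .limit = μ := by
  have hex : ∃ μ, W.OneHot (W.header b) μ := ⟨μ, h⟩
  simp only [current]
  rw [dif_pos hex]
  exact (h _).1 ((hex.choose_spec _).2 rfl)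

theorem bit_eq {τ : Tape → CReal} {σ : Store} (h : W.Shows τ σ) {r : Reg} (hr : r.bound W.R) :
    W.bit (block W.K τ 0) r = σ r 0 := by
  cases r with
  | nat t => simp only [bit, cell_block _ _ W.K_pos, ← h.1]; simp
  | trk i =>
    have hi : i < W.R := hr
    have : i < W.K := lt_of_lt_of_le hi (Nat.le_add_right _ _)
    simp only [bit, cell_block _ _ this, ← h.2 i hi]

noncomputable def program : Program := W.machine.program W.K_pos

variable {A : Set CReal} {x : CReal}

theorem block_step {γ : Ordinal.{0}} {m : Mode} {τ : Tape → CReal} {l : List Cmd} {σ : Store}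
    (hrun : run A W.program x γ = ⟨m.code, 0, τ⟩) (hm : isAnswer m = false) (hτ : W.Shows τ σ)
    (hl : ((W.current (block W.K τ 0) m).1 : List Cmd) = l) (hs : Cmd.stops l = false) :
    ∃ τ', run A W.program x (γ + Ordinal.omega0) = ⟨Mode.limit.code, 0, τ'⟩ ∧
      W.Shows τ' (wstep A (l, σ)).2 ∧
      (∃ μ : W.Label, W.OneHot (W.headerOf τ') μ ∧ (μ.1 : List Cmd) = (wstep A (l, σ)).1 ∧
        μ.2 = !(W.current (block W.K τ 0) m).2) ∧
      ∀ k : ℕ, (run A W.program x (γ + k)).state ≠ haltState ∧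
        ∀ t n, (run A W.program x (γ + k)).tape t n = τ t n ∨
          (run A W.program x (γ + k)).tape t n = τ' t n := by
  classical
  have hF : l ∈ W.F := hl ▸ (W.current (block W.K τ 0) m).1.2
  set μ := W.current (block W.K τ 0) m with hμ
  let o : W.Label × W.Label := (μ, (W.toF (wstep A (l, σ)).1, !μ.2))
  have hbit := W.bit_eq hτ (W.test_bound l hF)
  have htoF : ((W.toF (wstep A (l, σ)).1 : W.F) : List Cmd) = (wstep A (l, σ)).1 := by
    have : (wstep A (l, σ)).1 ∈ W.F := W.next_mem l hF hs _ _
    simp [toF, this]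
  have : Nonempty (W.Label × W.Label) := ⟨o⟩
  have hact : W.machine.start m (block W.K τ 0) = .go o ∨
      (W.machine.start m (block W.K τ 0) = .query ∧
      ((τ oracleTape ∈ A ∧ W.machine.start .yes (block W.K τ 0) = .go o) ∨
        (τ oracleTape ∉ A ∧ W.machine.start .no (block W.K τ 0) = .go o))) := by
    have hor : τ oracleTape = σ (.nat 2) := funext fun n => hτ.1 2 n
    by_cases hq : Cmd.isQuery l = true
    · right
      -- After the answer the mode is yes or no, and the label has to be read off the header once
      -- more. In the start mode there would be no header yet, but `entry` is not a query.
      have hmode : m = .limit := by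
        cases m with
        | limit => rfl
        | start =>
          have hl' : W.entry = l := hl
          have := W.entry_query
          rw [hl', hq] at this
          cases this
        | yes => simp [isAnswer] at hm
        | no => simp [isAnswer] at hm
      have hc : ∀ m', m' = Mode.yes ∨ m' = Mode.no → W.current (block W.K τ 0) m' = μ := by
        rintro m' (rfl | rfl) <;> rw [hμ, hmode] <;> rfl
      refine ⟨?_, ?_⟩
      · simp only [machine, ← hμ, hl, hs, hq, hm]
        simp
      · by_cases hA : σ (.nat 2) ∈ A
        · left
          refine ⟨hor ▸ hA, ?_⟩
          simp only [machine, hc .yes (.inl rfl), hl, hs, hq, hbit, o, wstep, hA]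
          simp [isAnswer, isYes]
        · right
          refine ⟨hor ▸ hA, ?_⟩
          simp only [machine, hc .no (.inr rfl), hl, hs, hq, hbit, o, wstep, hA]
          simp [isAnswer, isYes]
    · left
      simp only [Bool.not_eq_true] at hq
      simp only [machine, ← hμ, hl, hs, hq, hbit, o, wstep, Bool.false_and, Bool.false_eq_true,
        if_false]
      rw [Cmd.next_of_isQuery hq]
  obtain ⟨h1, h2⟩ := W.machine.run_action hrun hact
  refine ⟨_, h2, ?_, ⟨o.2, W.headerOf_sweep o τ, htoF, rfl⟩, h1⟩
  have := W.shows_sweep o hτ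
  simp only [o, hl] at this
  exact this

variable (A x) in
/-- The stages of the word machine. -/
noncomputable abbrev stage (β : Ordinal.{0}) : List Cmd × Store :=
  wrun A W.entry W.lim (initStore x) β

variable (A x) in
noncomputable abbrev config (δ : Ordinal.{0}) : Config := run A W.program x δ

variable (A x) in
/-- At stage `ω * β` the machine shows stage `β` of the word machine. -/
def Inv (β : Ordinal.{0}) : Prop :=
  ∃ m τ, W.config A x (Ordinal.omega0 * β) = ⟨m.code, 0, τ⟩ ∧ isAnswer m = false ∧
    W.Shows τ (W.stage A x β).2 ∧
    ((W.current (block W.K τ 0) m).1 : List Cmd) = (W.stage A x β).1 ∧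
    ((∃ γ, β = γ + 1) → W.OneHot (W.headerOf τ) (W.current (block W.K τ 0) m))

/-- The two additional facts serve the limit case: consecutive headers carry different labels, and
between two word stages every cell shows its bit from one of them. -/
theorem Inv.next {β : Ordinal.{0}} (h : W.Inv A x β) (hs : Cmd.stops (W.stage A x β).1 = false) :
    W.Inv A x (β + 1) ∧
    ((∃ γ, β = γ + 1) → ∃ μ μ', μ ≠ μ' ∧
      W.OneHot (W.headerOf (W.config A x (Ordinal.omega0 * β)).tape) μ ∧
      W.OneHot (W.headerOf (W.config A x (Ordinal.omega0 * (β + 1))).tape) μ') ∧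
    ∀ k : ℕ, (W.config A x (Ordinal.omega0 * β + k)).state ≠ haltState ∧
      ∀ t n, (W.config A x (Ordinal.omega0 * β + k)).tape t n =
          (W.config A x (Ordinal.omega0 * β)).tape t n ∨
        (W.config A x (Ordinal.omega0 * β + k)).tape t n =
          (W.config A x (Ordinal.omega0 * (β + 1))).tape t n := by
  obtain ⟨m, τ, hrun, hm, hτ, hl, hone⟩ := h
  obtain ⟨τ', h1, h2, ⟨μ, h3, h4, h5⟩, h6⟩ := W.block_step hrun hm hτ hl hs
  have hst : W.stage A x (β + 1) = wstep A (W.stage A x β) := wrun_add_one ..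
  rw [← mul_add_one] at h1
  have hcur : W.current (block W.K τ' 0) .limit = μ := W.current_of_oneHot h3
  refine ⟨⟨.limit, τ', h1, rfl, ?_, ?_, fun _ => ?_⟩, fun hβ => ?_, ?_⟩
  · rw [hst]; exact h2
  · rw [hst, hcur]; exact h4
  · rw [hcur]; exact h3
  · refine ⟨W.current (block W.K τ 0) m, μ, fun h => ?_, ?_, ?_⟩
    · rw [← h] at h5
      simp at h5
    · rw [hrun]; exact hone hβ
    · rw [config, h1]; exact h3
  · rw [hrun, config, h1]
    exact h6

theorem inv_zero : W.Inv A x 0 := by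
  refine ⟨.start, (initConfig x).tape, ?_, rfl, ⟨?_, ?_⟩, ?_, ?_⟩
  · rw [mul_zero, config, run_zero]; rfl
  · intro t n
    rw [stage, wrun_zero]
    fin_cases t
    · simp [initConfig, initStore, tapeOf]
    · have : outputTape ≠ inputTape := by decide
      simp [initConfig, initStore, tapeOf, this]
    · have : oracleTape ≠ inputTape := by decide
      simp [initConfig, initStore, tapeOf, this]
  · intro i _ n
    rw [stage, wrun_zero]
    simp [initConfig, initStore]
  · rw [stage, wrun_zero]; rfl
  · rintro ⟨γ, hγ⟩
    exact absurd hγ (zero_lt_one.trans_le le_add_self).ne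

/-- A bit shown at stage `ω * γ + k` is shown at `ω * γ` or at `ω * (γ + 1)`, both below `ω * l`.
Hence the limit superior may be taken over the multiples of `ω` alone. -/
theorem config_limit_tape {l : Ordinal.{0}} (hl : Order.IsSuccLimit l)
    (h : ∀ γ < l, ∀ (k : ℕ) t n, (W.config A x (Ordinal.omega0 * γ + k)).tape t n =
          (W.config A x (Ordinal.omega0 * γ)).tape t n ∨
        (W.config A x (Ordinal.omega0 * γ + k)).tape t n =
          (W.config A x (Ordinal.omega0 * (γ + 1))).tape t n) (t : Tape) (n : ℕ) :
    (W.config A x (Ordinal.omega0 * l)).tape t n = true ↔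
      ∀ β < l, ∃ γ < l, β ≤ γ ∧ (W.config A x (Ordinal.omega0 * γ)).tape t n = true := by
  have hω : (0 : Ordinal) < Ordinal.omega0 := Ordinal.omega0_pos
  rw [config, run_limit_tape _ _ _ (Ordinal.isSuccLimit_mul_right hω hl)]
  constructor
  · intro H β hβ
    obtain ⟨δ, hδ, hle, ht⟩ := H (Ordinal.omega0 * β) ((Ordinal.isNormal_mul_right hω).strictMono hβ)
    obtain ⟨γ, hγ, k, rfl⟩ := exists_omega0_mul_add hδ
    have hβγ : β ≤ γ := by
      by_contra hlt
      rw [not_le] at hlt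
      have h1 : Ordinal.omega0 * γ + k < Ordinal.omega0 * (γ + 1) := by
        rw [mul_add_one]
        exact (add_lt_add_iff_left _).2 (Ordinal.natCast_lt_omega0 k)
      have h2 : Ordinal.omega0 * (γ + 1) ≤ Ordinal.omega0 * β := by
        gcongr
        exact Order.add_one_le_of_lt hlt
      exact absurd (hle.trans_lt (h1.trans_le h2)) (lt_irrefl _)
    rcases h γ hγ k t n with h' | h'
    · exact ⟨γ, hγ, hβγ, by rw [← h']; exact ht⟩
    · exact ⟨γ + 1, hl.add_one_lt hγ, hβγ.trans (le_self_add), by rw [← h']; exact ht⟩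
  · intro H δ hδ
    obtain ⟨β, hβ, hlt⟩ := (Ordinal.lt_mul_iff_of_isSuccLimit hl).1 hδ
    obtain ⟨γ, hγ, hle, ht⟩ := H β hβ
    refine ⟨_, (Ordinal.isNormal_mul_right hω).strictMono hγ, hlt.le.trans ?_, ht⟩
    gcongr

theorem inv_of_not_stops (β : Ordinal.{0})
    (h : ∀ γ < β, Cmd.stops (W.stage A x γ).1 = false) : W.Inv A x β := by
  induction β using WellFoundedLT.induction with
  | ind β ih =>
  have IH : ∀ γ < β, W.Inv A x γ := fun γ hγ => ih γ hγ fun δ hδ => h δ (hδ.trans hγ)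
  rcases Ordinal.zero_or_succ_or_isSuccLimit β with rfl | ⟨γ, rfl⟩ | hβ
  · exact W.inv_zero
  · have hγ : γ < Order.succ γ := Order.lt_succ γ
    exact ((IH γ hγ).next W (h γ hγ)).1
  · have hnext := fun γ (hγ : γ < β) => (IH γ hγ).next W (h γ hγ)
    have htape := W.config_limit_tape (A := A) (x := x) hβ fun γ hγ k =>
      ((hnext γ hγ).2.2 k).2
    have hω : (0 : Ordinal) < Ordinal.omega0 := Ordinal.omega0_pos
    refine ⟨.limit, (W.config A x (Ordinal.omega0 * β)).tape, ?_, rfl, ⟨?_, ?_⟩, ?_, ?_⟩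
    · rw [config, run_limit _ _ _ (Ordinal.isSuccLimit_mul_right hω hβ)]; rfl
    · intro t n
      rw [Bool.eq_iff_iff, htape, wrun_limit_snd _ _ _ _ hβ]
      refine forall₂_congr fun δ _ => exists_congr fun γ => and_congr_right fun hγ => ?_
      obtain ⟨m, τ, hrun, -, hτ, -⟩ := IH γ hγ
      rw [hrun]
      simp only [hτ.1]
    · intro i hi n
      rw [Bool.eq_iff_iff, htape, wrun_limit_snd _ _ _ _ hβ]
      refine forall₂_congr fun δ _ => exists_congr fun γ => and_congr_right fun hγ => ?_
      obtain ⟨m, τ, hrun, -, hτ, -⟩ := IH γ hγ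
      rw [hrun]
      simp only [hτ.2 i hi]
    · rw [stage, wrun_limit_fst _ _ _ _ hβ]
      -- At a limit of word stages the header is not one-hot. Were `μ` the only label left, all
      -- others would vanish from some stage on, there being finitely many, and two consecutive
      -- headers would both show `μ`, against the flipped bit.
      have hno : ¬ ∃ μ, W.OneHot (W.headerOf (W.config A x (Ordinal.omega0 * β)).tape) μ := by
        rintro ⟨μ, hμ⟩
        have hhdr : ∀ γ ν, W.headerOf (W.config A x (Ordinal.omega0 * γ)).tape ν =
            (W.config A x (Ordinal.omega0 * γ)).tape scratchTape (W.K * 0 + (W.R + W.equiv ν)) :=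
          fun γ ν => cell_block _ _ (Nat.add_lt_add_left (W.equiv ν).2 _) _
        have hbd : ∀ ν, ∃ δ : Set.Iio β, ν ≠ μ → ∀ γ < β, δ.1 ≤ γ →
            W.headerOf (W.config A x (Ordinal.omega0 * γ)).tape ν = false := by
          intro ν
          by_cases hν : ν = μ
          · exact ⟨⟨0, hβ.bot_lt⟩, fun h => absurd hν h⟩
          · have := mt (hμ ν).1 hν
            rw [hhdr, htape] at this
            push Not at this
            obtain ⟨δ, hδ, hδ'⟩ := this
            refine ⟨⟨δ, hδ⟩, fun _ γ hγ hle => ?_⟩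
            rw [hhdr]
            simpa using hδ' γ hγ hle
        choose δ hδ using hbd
        have : Nonempty (Set.Iio β) := ⟨⟨0, hβ.bot_lt⟩⟩
        obtain ⟨⟨B, hB⟩, hBδ⟩ := Finite.exists_le δ
        have hB1 : B + 1 < β := hβ.add_one_lt hB
        have hB2 : B + 1 + 1 < β := hβ.add_one_lt hB1
        have huniq : ∀ γ < β, B ≤ γ → ∀ ν,
            W.OneHot (W.headerOf (W.config A x (Ordinal.omega0 * γ)).tape) ν → ν = μ := by
          intro γ hγ hle ν hν
          by_contra hne
          have h1 := hδ ν hne γ hγ (le_trans (hBδ ν) hle)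
          rw [(hν ν).2 rfl] at h1
          cases h1
        obtain ⟨μ₁, μ₂, hne, h1, h2⟩ := (hnext (B + 1) hB1).2.1 ⟨B, rfl⟩
        exact hne ((huniq _ hB1 le_self_add _ h1).trans
          (huniq _ hB2 (le_self_add.trans le_self_add) _ h2).symm)
      unfold headerOf at hno
      simp only [current]
      rw [dif_neg hno]
    · rintro ⟨γ, rfl⟩
      exact absurd hβ (Order.not_isSuccLimit_succ γ)

/-- The output of the word machine is the output of its program. -/
theorem yields {β : Ordinal.{0}} (h : ∀ γ < β, Cmd.stops (W.stage A x γ).1 = false)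
    (hβ : Cmd.stops (W.stage A x β).1 = true) :
    Yields A W.program x ((W.stage A x β).2 (.nat 1)) := by
  obtain ⟨m, τ, hrun, hm, hτ, hl, -⟩ := W.inv_of_not_stops β h
  have : Nonempty (W.Label × W.Label) := ⟨(W.current (block W.K τ 0) m, W.current (block W.K τ 0) m)⟩
  have hstart : W.machine.start m (block W.K τ 0) = .halt := by
    simp only [machine, hl, hβ, if_true]
  obtain ⟨h1, h2, -⟩ := W.machine.run_start_halt hrun
  refine ⟨_, ⟨congrArg Config.state (h2 hstart), fun δ hδ => ?_⟩, ?_⟩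
  · by_cases hlt : δ < Ordinal.omega0 * β
    · obtain ⟨γ, hγ, k, rfl⟩ := exists_omega0_mul_add hlt
      have hinv := W.inv_of_not_stops (A := A) (x := x) γ fun δ hδ => h δ (hδ.trans hγ)
      exact ((hinv.next W (h γ hγ)).2.2 k).1
    · obtain ⟨k, rfl⟩ := exists_add_nat (not_lt.1 hlt)
        (hδ.trans_le (by gcongr; exact (Ordinal.natCast_lt_omega0 _).le))
      refine (h1 k ?_).1
      have : (k : Ordinal.{0}) < (4 * W.K + 1 : ℕ) := by simpa using hδ
      have : k < 4 * W.K + 1 := by exact_mod_cast this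
      omega
  · refine (congrArg (fun c : Config => c.tape outputTape) (h2 hstart)).trans ?_
    funext n
    exact hτ.1 1 n

end Control
end ITTM

/-! ### Terminating execution of commands -/

namespace ITTM
namespace Cmd

/-- All operations satisfy `P`, all tested registers satisfy `T`, and there is no `halt`. -/
def All (P : Op → Prop) (T : Reg → Prop) : Cmd → Prop
  | op o => P o
  | seq c d => All P T c ∧ All P T d
  | ite r c d => T r ∧ All P T c ∧ All P T d
  | loop r c => T r ∧ All P T c
  | query c d => All P T c ∧ All P T d
  | halt => False

theorem All.mono {P P' : Op → Prop} {T T' : Reg → Prop} (hP : ∀ o, P o → P' o)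
    (hT : ∀ r, T r → T' r) : ∀ {c : Cmd}, c.All P T → c.All P' T'
  | op _, h => hP _ h
  | seq _ _, h => ⟨h.1.mono hP hT, h.2.mono hP hT⟩
  | ite _ _ _, h => ⟨hT _ h.1, h.2.1.mono hP hT, h.2.2.mono hP hT⟩
  | loop _ _, h => ⟨hT _ h.1, h.2.mono hP hT⟩
  | query _ _, h => ⟨h.1.mono hP hT, h.2.mono hP hT⟩

/-- One step in a continuation `l ++ k` with `l` not empty. -/
theorem step_append {P : Op → Prop} {T : Reg → Prop} (A : Set CReal) {l : List Cmd} (hl : l ≠ [])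
    (h : ∀ c ∈ l, All P T c) (k : List Cmd) (σ : Store) :
    ∃ l', (wstep A (l ++ k, σ)).1 = l' ++ k ∧ (∀ c ∈ l', All P T c) ∧ stops (l ++ k) = false ∧
      ((wstep A (l ++ k, σ)).2 = σ ∨ ∃ o, P o ∧ (wstep A (l ++ k, σ)).2 = o.apply σ) := by
  obtain ⟨c, t, rfl⟩ := List.exists_cons_of_ne_nil hl
  have hc := h c (by simp)
  have ht : ∀ d ∈ t, All P T d := fun d hd => h d (by simp [hd])
  cases c with
  | op o => exact ⟨t, rfl, ht, rfl, .inr ⟨o, hc, rfl⟩⟩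
  | seq c d =>
    refine ⟨c :: d :: t, rfl, ?_, rfl, .inl rfl⟩
    simp only [List.mem_cons, forall_eq_or_imp]
    exact ⟨hc.1, hc.2, ht⟩
  | ite r c d =>
    refine ⟨(bif σ r 0 then c else d) :: t, rfl, ?_, rfl, .inl rfl⟩
    simp only [List.mem_cons, forall_eq_or_imp]
    refine ⟨?_, ht⟩
    cases σ r 0
    exacts [hc.2.2, hc.2.1]
  | loop r c =>
    refine ⟨bif σ r 0 then c :: loop r c :: t else t, ?_, ?_, rfl, .inl rfl⟩
    · change (bif σ r 0 then _ else _) = _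
      cases σ r 0 <;> rfl
    · cases σ r 0
      · exact ht
      · simp only [cond_true, List.mem_cons, forall_eq_or_imp]
        exact ⟨hc.2, hc, ht⟩
  | query c d =>
    classical
    refine ⟨(bif decide (σ (.nat 2) ∈ A) then c else d) :: t, ?_, ?_, rfl, .inl rfl⟩
    · simp only [wstep, next, List.cons_append]
    · simp only [List.mem_cons, forall_eq_or_imp]
      refine ⟨?_, ht⟩
      cases decide (σ (.nat 2) ∈ A)
      exacts [hc.2, hc.1]
  | halt => exact hc.elim

end Cmd

/-- From store `σ` the command `c` terminates with store `σ'`. -/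
def Ex (A : Set CReal) (c : Cmd) (σ σ' : Store) : Prop :=
  ∀ k, ∃ n, (wstep A)^[n] (c :: k, σ) = (k, σ')

namespace Ex

variable {A : Set CReal} {c d : Cmd} {σ σ₁ σ₂ : Store} {r : Reg}

theorem op (o : Op) : Ex A (.op o) σ (o.apply σ) := fun _ => ⟨1, rfl⟩

theorem seq (h1 : Ex A c σ σ₁) (h2 : Ex A d σ₁ σ₂) : Ex A (.seq c d) σ σ₂ := fun k => by
  obtain ⟨n, hn⟩ := h1 (d :: k)
  obtain ⟨m, hm⟩ := h2 k
  refine ⟨m + (n + 1), ?_⟩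
  rw [Function.iterate_add_apply, Function.iterate_succ_apply]
  change (wstep A)^[m] ((wstep A)^[n] (c :: d :: k, σ)) = _
  rw [hn, hm]

theorem ite_true (hr : σ r 0 = true) (h : Ex A c σ σ₁) : Ex A (.ite r c d) σ σ₁ := fun k => by
  obtain ⟨n, hn⟩ := h k
  refine ⟨n + 1, ?_⟩
  rw [Function.iterate_succ_apply]
  change (wstep A)^[n] ((bif σ r 0 then c else d) :: k, σ) = _
  rw [hr, ← hn]; rfl

theorem ite_false (hr : σ r 0 = false) (h : Ex A d σ σ₁) : Ex A (.ite r c d) σ σ₁ := fun k => by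
  obtain ⟨n, hn⟩ := h k
  refine ⟨n + 1, ?_⟩
  rw [Function.iterate_succ_apply]
  change (wstep A)^[n] ((bif σ r 0 then c else d) :: k, σ) = _
  rw [hr, ← hn]; rfl

theorem loop_exit (hr : σ r 0 = false) : Ex A (.loop r c) σ σ := fun k => by
  refine ⟨1, ?_⟩
  change ((bif σ r 0 then c :: Cmd.loop r c :: k else k), σ) = _
  rw [hr]; rfl

theorem loop_step (hr : σ r 0 = true) (h1 : Ex A c σ σ₁) (h2 : Ex A (.loop r c) σ₁ σ₂) :
    Ex A (.loop r c) σ σ₂ := fun k => by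
  obtain ⟨n, hn⟩ := h1 (.loop r c :: k)
  obtain ⟨m, hm⟩ := h2 k
  refine ⟨m + (n + 1), ?_⟩
  rw [Function.iterate_add_apply, Function.iterate_succ_apply]
  change (wstep A)^[m] ((wstep A)^[n] ((bif σ r 0 then c :: Cmd.loop r c :: k else k), σ)) = _
  rw [hr, cond_true, hn, hm]

theorem query_yes (hr : σ (.nat 2) ∈ A) (h : Ex A c σ σ₁) : Ex A (.query c d) σ σ₁ := fun k => by
  classical
  obtain ⟨n, hn⟩ := h k
  refine ⟨n + 1, ?_⟩
  rw [Function.iterate_succ_apply, ← hn]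
  congr 1
  simp [wstep, Cmd.next, hr, Cmd.opOf, applyOption]

theorem query_no (hr : σ (.nat 2) ∉ A) (h : Ex A d σ σ₁) : Ex A (.query c d) σ σ₁ := fun k => by
  classical
  obtain ⟨n, hn⟩ := h k
  refine ⟨n + 1, ?_⟩
  rw [Function.iterate_succ_apply, ← hn]
  congr 1
  simp [wstep, Cmd.next, hr, Cmd.opOf, applyOption]

/-- A preorder respected by the operations of a command is respected by the command. -/
theorem rel {P : Op → Prop} {T : Reg → Prop} (h : Ex A c σ σ₁) (hc : c.All P T)
    {Rel : Store → Store → Prop} (hrefl : ∀ σ, Rel σ σ)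
    (htrans : ∀ σ σ' σ'', Rel σ σ' → Rel σ' σ'' → Rel σ σ'')
    (hop : ∀ o σ, P o → Rel σ (o.apply σ)) : Rel σ σ₁ := by
  obtain ⟨n, hn⟩ := h []
  have key : ∀ n, (∀ d ∈ ((wstep A)^[n] ([c], σ)).1, Cmd.All P T d) ∧
      Rel σ ((wstep A)^[n] ([c], σ)).2 := by
    intro n
    induction n with
    | zero => exact ⟨by simpa using hc, hrefl σ⟩
    | succ n ih =>
      rw [Function.iterate_succ_apply']
      generalize (wstep A)^[n] ([c], σ) = s at ih ⊢
      obtain ⟨l, τ⟩ := s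
      rcases eq_or_ne l [] with rfl | hl
      · exact ⟨by simp [wstep, Cmd.next], ih.2⟩
      · obtain ⟨l', h1, h2, -, h3⟩ := Cmd.step_append A hl ih.1 [] τ
        rw [List.append_nil] at h1 h3
        refine ⟨by rw [h1]; simpa using h2, ?_⟩
        rcases h3 with h3 | ⟨o, ho, h3⟩
        · rw [h3]; exact ih.2
        · rw [h3]; exact htrans _ _ _ ih.2 (hop o τ ho)
  have := (key n).2
  rwa [hn] at this

end Ex

/-- An operation on one of the tracks in `S`. -/
def Op.WritesIn (S : Set ℕ) (o : Op) : Prop := ∃ d a b f, o = .trk d a b f ∧ d ∈ S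

theorem Op.WritesIn.apply {S : Set ℕ} {o : Op} (h : o.WritesIn S) (σ : Store) {r : Reg}
    (hr : ∀ d ∈ S, r ≠ .trk d) : o.apply σ r = σ r := by
  obtain ⟨d, a, b, f, rfl, hd⟩ := h
  exact Function.update_of_ne (hr d hd) _ _

theorem Ex.frame {A : Set CReal} {c : Cmd} {σ σ₁ : Store} (h : Ex A c σ σ₁) {S : Set ℕ}
    (hc : c.All (Op.WritesIn S) fun _ => True) {r : Reg} (hr : ∀ d ∈ S, r ≠ .trk d) :
    σ₁ r = σ r :=
  h.rel hc (Rel := fun σ σ' => σ' r = σ r) (fun _ => rfl) (fun _ _ _ h h' => h'.trans h)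
    fun _ σ ho => ho.apply σ hr

namespace Op

def clr (d : ℕ) : Op := .trk d d d fun _ _ _ _ => false
def cpy (d a : ℕ) : Op := .trk d a a fun _ x _ _ => x
def push (b : Bool) (d : ℕ) : Op := .trk d d d fun p _ _ _ => p.getD b
def pop (d : ℕ) : Op := .trk d d d fun _ _ _ n => n
def orr (d a : ℕ) : Op := .trk d d a fun _ x y _ => x || y

theorem clr_writes {d : ℕ} {S : Set ℕ} (h : d ∈ S) : (clr d).WritesIn S := ⟨_, _, _, _, rfl, h⟩
theorem cpy_writes {d a : ℕ} {S : Set ℕ} (h : d ∈ S) : (cpy d a).WritesIn S := ⟨_, _, _, _, rfl, h⟩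
theorem push_writes {b : Bool} {d : ℕ} {S : Set ℕ} (h : d ∈ S) : (push b d).WritesIn S :=
  ⟨_, _, _, _, rfl, h⟩
theorem pop_writes {d : ℕ} {S : Set ℕ} (h : d ∈ S) : (pop d).WritesIn S := ⟨_, _, _, _, rfl, h⟩
theorem clr_apply (d : ℕ) (σ : Store) : (clr d).apply σ = Function.update σ (.trk d) (natReal 0) := by
  simp only [clr, apply]
  congr 1

theorem cpy_apply (d a : ℕ) (σ : Store) :
    (cpy d a).apply σ = Function.update σ (.trk d) (σ (.trk a)) := rfl

theorem push_apply (b : Bool) (d : ℕ) (σ : Store) : (push b d).apply σ =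
    Function.update σ (.trk d) fun n => if n = 0 then b else σ (.trk d) (n - 1) := by
  simp only [push, apply]
  congr 1
  funext n
  simp only [localOp]
  split_ifs <;> rfl

theorem pop_apply (d : ℕ) (σ : Store) :
    (pop d).apply σ = Function.update σ (.trk d) fun n => σ (.trk d) (n + 1) := rfl

theorem orr_apply (d a : ℕ) (σ : Store) : (orr d a).apply σ =
    Function.update σ (.trk d) fun n => σ (.trk d) n || σ (.trk a) n := rfl

end Op

/-- Numbers are kept in unary: pushing a one is the successor, popping is the predecessor, and the
first bit, the only one a command can test, tells whether the number is positive. -/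
theorem natReal_push (n : ℕ) :
    (fun k => if k = 0 then true else natReal n (k - 1)) = natReal (n + 1) := by
  funext k
  rcases k with _ | k <;> simp [natReal]

theorem natReal_push' (n : ℕ) :
    (fun k => decide (k = 0) || natReal n (k - 1)) = natReal (n + 1) := by
  funext k
  rcases k with _ | k <;> simp [natReal]

theorem natReal_pop (n : ℕ) : (fun k => natReal (n + 1) (k + 1)) = natReal n := by
  funext k
  simp [natReal]

theorem natReal_succ_bit (n : ℕ) : natReal (n + 1) 0 = true := by simp [natReal]

/-! ### Computing primitive recursive functions -/

/-- `f` can be computed on tracks holding natural numbers, without changing anything except the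
output track and tracks from `base` on. -/
def Computes {n : ℕ} (f : List.Vector ℕ n → ℕ) : Prop :=
  ∀ (args : Fin n → ℕ) (out base : ℕ), (∀ i, args i < base) → out < base →
    ∃ c : Cmd, c.All (Op.WritesIn ({out} ∪ Set.Ici base)) (fun _ => True) ∧
      ∀ (A : Set CReal) (σ : Store) (v : List.Vector ℕ n),
        (∀ i, σ (.trk (args i)) = natReal (v.get i)) →
          ∃ σ', Ex A c σ σ' ∧ σ' (.trk out) = natReal (f v)

theorem Computes.zero : Computes fun _ : List.Vector ℕ 0 => 0 := fun args out base _ _ => by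
  refine ⟨.op (.clr out), Op.clr_writes (by simp), fun A σ v _ => ⟨_, Ex.op _, ?_⟩⟩
  rw [Op.clr_apply, Function.update_self]

theorem Computes.get {n : ℕ} (i : Fin n) : Computes fun v : List.Vector ℕ n => v.get i :=
  fun args out base _ _ => by
    refine ⟨.op (.cpy out (args i)), Op.cpy_writes (by simp), fun A σ v h => ⟨_, Ex.op _, ?_⟩⟩
    rw [Op.cpy_apply, Function.update_self, h]

theorem Computes.succ : Computes fun v : List.Vector ℕ 1 => v.head.succ := fun args out base _ _ => by
  refine ⟨.seq (.op (.cpy out (args 0))) (.op (.push true out)),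
    ⟨Op.cpy_writes (by simp), Op.push_writes (by simp)⟩,
    fun A σ v h => ⟨_, (Ex.op _).seq (Ex.op _), ?_⟩⟩
  rw [Op.cpy_apply, Op.push_apply, Function.update_self, Function.update_self, h, natReal_push,
    List.Vector.get_zero]

theorem trk_ne_of_lt {S : Set ℕ} {r base : ℕ} (hS : ∀ d ∈ S, base ≤ d) (h : r < base) :
    ∀ d ∈ S, Reg.trk r ≠ .trk d := by
  intro d hd h'
  have := hS d hd
  cases h'
  omega

/-- The values of the inner functions are stored on the tracks `base`, ..., `base + n - 1`. All
subcomputations work from `base + n` on and so cannot spoil values already stored or the arguments.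
-/
theorem Computes.comp {m n : ℕ} {f : List.Vector ℕ n → ℕ} (g : Fin n → List.Vector ℕ m → ℕ)
    (hf : Computes f) (hg : ∀ i, Computes (g i)) :
    Computes fun v => f (List.Vector.ofFn fun i => g i v) := fun args out base hargs hout => by
  have key : ∀ j ≤ n, ∃ c : Cmd, c.All (Op.WritesIn (Set.Ici base)) (fun _ => True) ∧
      ∀ (A : Set CReal) (σ : Store) (v : List.Vector ℕ m),
        (∀ i, σ (.trk (args i)) = natReal (v.get i)) →
          ∃ σ', Ex A c σ σ' ∧ ∀ i : Fin n, i.1 < j → σ' (.trk (base + i)) = natReal (g i v) := by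
    intro j hj
    induction j with
    | zero =>
      -- Clearing a scratch track stands in for the missing empty command.
      exact ⟨.op (.clr base), Op.clr_writes (by simp), fun A σ v _ =>
        ⟨_, Ex.op _, fun i hi => absurd hi (Nat.not_lt_zero _)⟩⟩
    | succ j ih =>
      obtain ⟨c, hc, hcs⟩ := ih (by omega)
      obtain ⟨d, hd, hds⟩ := hg ⟨j, hj⟩ args (base + j) (base + n)
        (fun i => (hargs i).trans_le (by omega)) (by omega)
      refine ⟨.seq c d, ⟨hc, hd.mono ?_ fun _ h => h⟩, fun A σ v h => ?_⟩
      · rintro o ⟨d, a, b, f, rfl, hd⟩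
        refine ⟨d, a, b, f, rfl, ?_⟩
        rcases hd with rfl | hd
        · simp
        · exact le_trans (Nat.le_add_right _ _) (Set.mem_Ici.1 hd)
      · obtain ⟨σ₁, h1, h2⟩ := hcs A σ v h
        obtain ⟨σ₂, h3, h4⟩ := hds A σ₁ v fun i => by
          rw [h1.frame hc (trk_ne_of_lt (fun d hd => hd) (hargs i)), h]
        refine ⟨σ₂, h1.seq h3, fun i hi => ?_⟩
        rcases Nat.lt_succ_iff_lt_or_eq.1 hi with hi | hi
        · rw [h3.frame hd, h2 i hi]
          intro d hd heq
          cases heq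
          rcases hd with hd | hd
          · simp only [Set.mem_singleton_iff] at hd; omega
          · have := Set.mem_Ici.1 hd; omega
        · have : i = ⟨j, hj⟩ := Fin.ext hi
          subst this
          exact h4
  obtain ⟨c, hc, hcs⟩ := key n le_rfl
  obtain ⟨d, hd, hds⟩ := hf (fun i => base + i) out (base + n) (fun i => by omega) (by omega)
  refine ⟨.seq c d, ⟨hc.mono ?_ fun _ h => h, hd.mono ?_ fun _ h => h⟩, fun A σ v h => ?_⟩
  · rintro o ⟨d, a, b, f, rfl, hd⟩
    exact ⟨d, a, b, f, rfl, .inr hd⟩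
  · rintro o ⟨d, a, b, f, rfl, hd⟩
    refine ⟨d, a, b, f, rfl, hd.imp_right fun h => ?_⟩
    exact le_trans (Nat.le_add_right _ _) (Set.mem_Ici.1 h)
  · obtain ⟨σ₁, h1, h2⟩ := hcs A σ v h
    obtain ⟨σ₂, h3, h4⟩ := hds A σ₁ (List.Vector.ofFn fun i => g i v) fun i => by
      rw [h2 i i.2, List.Vector.get_ofFn]
    exact ⟨σ₂, h1.seq h3, h4⟩

theorem Computes.prec {n : ℕ} {f : List.Vector ℕ n → ℕ} {g : List.Vector ℕ (n + 2) → ℕ}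
    (hf : Computes f) (hg : Computes g) :
    Computes fun v : List.Vector ℕ (n + 1) =>
      v.head.rec (f v.tail) fun y IH => g (y ::ᵥ IH ::ᵥ v.tail) := fun args out base hargs hout => by
  -- `base` holds the value, `base + 1` the argument, `base + 2` the number of remaining rounds
  obtain ⟨cf, hcf, hcfs⟩ := hf (fun i => args i.succ) base (base + 4)
    (fun i => (hargs _).trans_le (by omega)) (by omega)
  obtain ⟨cg, hcg, hcgs⟩ := hg (Fin.cons (base + 1) (Fin.cons base fun i => args i.succ)) (base + 3)
    (base + 4) (Fin.cases (by simp) (Fin.cases (by simp) fun i => by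
      simpa using (hargs i.succ).trans_le (by omega))) (by omega)
  let body : Cmd := .seq cg (.seq (.op (.cpy base (base + 3)))
    (.seq (.op (.push true (base + 1))) (.op (.pop (base + 2)))))
  have hbody : body.All (Op.WritesIn (Set.Ici base)) fun _ => True := by
    refine ⟨hcg.mono ?_ fun _ h => h, Op.cpy_writes (by simp), Op.push_writes (by simp),
      Op.pop_writes (by simp)⟩
    rintro o ⟨d, a, b, f, rfl, hd⟩
    refine ⟨d, a, b, f, rfl, ?_⟩
    rcases hd with rfl | hd
    · simp
    · exact le_trans (Nat.le_add_right _ _) (Set.mem_Ici.1 hd)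
  refine ⟨.seq cf (.seq (.op (.clr (base + 1))) (.seq (.op (.cpy (base + 2) (args 0)))
    (.seq (.loop (.trk (base + 2)) body) (.op (.cpy out base))))),
    ⟨hcf.mono ?_ fun _ h => h, Op.clr_writes (by simp), Op.cpy_writes (by simp),
      ⟨trivial, hbody.mono ?_ fun _ h => h⟩, Op.cpy_writes (by simp)⟩, fun A σ v h => ?_⟩
  · rintro o ⟨d, a, b, f, rfl, hd⟩
    refine ⟨d, a, b, f, rfl, .inr ?_⟩
    rcases hd with rfl | hd
    · simp
    · exact le_trans (Nat.le_add_right _ _) (Set.mem_Ici.1 hd)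
  · rintro o ⟨d, a, b, f, rfl, hd⟩
    exact ⟨d, a, b, f, rfl, .inr hd⟩
  · let F : ℕ → ℕ := fun k => Nat.rec (f v.tail) (fun y IH => g (y ::ᵥ IH ::ᵥ v.tail)) k
    -- Loop invariant: `j` rounds are done, `k` remain, and track `base` holds the value after `j`
    -- rounds. Track `base + 3` receives the new value before it is copied back.
    have hloop : ∀ (k j : ℕ) (σ : Store), σ (.trk base) = natReal (F j) →
        σ (.trk (base + 1)) = natReal j → σ (.trk (base + 2)) = natReal k →
        (∀ i : Fin n, σ (.trk (args i.succ)) = natReal (v.get i.succ)) →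
        ∃ σ', Ex A (.loop (.trk (base + 2)) body) σ σ' ∧ σ' (.trk base) = natReal (F (j + k)) := by
      intro k
      induction k with
      | zero =>
        intro j σ h0 h1 h2 h3
        exact ⟨σ, Ex.loop_exit (by rw [h2]; rfl), h0⟩
      | succ k ih =>
        intro j σ h0 h1 h2 h3
        obtain ⟨σ₁, h4, h5⟩ := hcgs A σ (j ::ᵥ F j ::ᵥ v.tail)
          (Fin.cases (by simpa using h1) (Fin.cases (by
            rw [List.Vector.get_cons_succ, List.Vector.get_zero, List.Vector.head_cons]
            exact h0) fun i => by
            simpa [List.Vector.get_tail] using h3 i))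
        have hfr : ∀ r, r < base + 3 → σ₁ (.trk r) = σ (.trk r) := fun r hr =>
          h4.frame hcg fun d hd heq => by
            cases heq
            rcases hd with hd | hd
            · simp only [Set.mem_singleton_iff] at hd; omega
            · have := Set.mem_Ici.1 hd; omega
        obtain ⟨σ₂, h6, h7⟩ := ih (j + 1)
          ((Op.pop (base + 2)).apply ((Op.push true (base + 1)).apply
            ((Op.cpy base (base + 3)).apply σ₁)))
          (by simp [Op.pop_apply, Op.push_apply, Op.cpy_apply, h5, F])
          (by simp [Op.pop_apply, Op.push_apply, Op.cpy_apply, h1, hfr (base + 1) (by omega),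
            natReal_push'])
          (by simp [Op.pop_apply, Op.push_apply, Op.cpy_apply, h2, hfr (base + 2) (by omega),
            natReal_pop])
          (fun i => by
            have := hargs i.succ
            rw [← h3, ← hfr _ (by omega)]
            simp only [Op.pop_apply, Op.push_apply, Op.cpy_apply, Function.update_apply,
              Reg.trk.injEq]
            rw [if_neg (by omega), if_neg (by omega), if_neg (by omega)])
        refine ⟨σ₂, Ex.loop_step (by rw [h2]; exact natReal_succ_bit k)
          (h4.seq ((Ex.op _).seq ((Ex.op _).seq (Ex.op _)))) h6, ?_⟩
        rw [h7, show j + 1 + k = j + (k + 1) by omega]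
    obtain ⟨σ₁, h1, h2⟩ := hcfs A σ v.tail fun i => by rw [h, List.Vector.get_tail_succ]
    have hfr : ∀ i, σ₁ (.trk (args i)) = natReal (v.get i) := fun i => by
      rw [← h i]
      refine h1.frame hcf fun d hd heq => ?_
      cases heq
      have := hargs i
      rcases hd with hd | hd
      · simp only [Set.mem_singleton_iff] at hd; omega
      · have := Set.mem_Ici.1 hd; omega
    have hargs' : ∀ i, args i ≠ base + 1 ∧ args i ≠ base + 2 := fun i => by
      have := hargs i; omega
    obtain ⟨σ₂, h3, h4⟩ := hloop v.head 0
      ((Op.cpy (base + 2) (args 0)).apply ((Op.clr (base + 1)).apply σ₁))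
      (by simp [Op.clr_apply, Op.cpy_apply, h2, F])
      (by simp [Op.clr_apply, Op.cpy_apply])
      (by simp [Op.clr_apply, Op.cpy_apply, hfr, hargs'])
      (fun i => by simp [Op.clr_apply, Op.cpy_apply, hfr, hargs'])
    refine ⟨_, h1.seq ((Ex.op _).seq ((Ex.op _).seq (h3.seq (Ex.op _)))), ?_⟩
    rw [Op.cpy_apply, Function.update_self, h4, zero_add]

theorem computes_of_primrec' {n : ℕ} {f : List.Vector ℕ n → ℕ} (h : Nat.Primrec' f) :
    Computes f := by
  induction h with
  | zero => exact .zero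
  | succ => exact .succ
  | get i => exact .get i
  | comp g _ _ hf hg => exact .comp g hf hg
  | prec _ _ hf hg => exact .prec hf hg

/-- Unary primitive recursive functions. -/
theorem exists_cmd_of_primrec {f : ℕ → ℕ} (hf : Primrec f) {a out base : ℕ} (ha : a < base)
    (hout : out < base) :
    ∃ c : Cmd, c.All (Op.WritesIn ({out} ∪ Set.Ici base)) (fun _ => True) ∧
      ∀ (A : Set CReal) (σ : Store) (n : ℕ), σ (.trk a) = natReal n →
        ∃ σ', Ex A c σ σ' ∧ σ' (.trk out) = natReal (f n) := by
  obtain ⟨c, hc, hcs⟩ := computes_of_primrec' (Nat.Primrec'.prim_iff₁.2 hf) (fun _ => a) out base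
    (fun _ => ha) hout
  exact ⟨c, hc, fun A σ n h => hcs A σ (n ::ᵥ .nil) fun i => by
    rw [Subsingleton.elim i 0]; exact h⟩

end ITTM

namespace ITTM

/-! ### Control of a pair of commands -/

namespace Cmd

/-- The continuations that can occur in executing a command with continuation `k`. -/
def conts : Cmd → List Cmd → Set (List Cmd)
  | op o, k => {op o :: k}
  | seq c d, k => insert (seq c d :: k) (conts c (d :: k) ∪ conts d k)
  | ite r c d, k => insert (ite r c d :: k) (conts c k ∪ conts d k)
  | loop r c, k => insert (loop r c :: k) (conts c (loop r c :: k))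
  | query c d, k => insert (query c d :: k) (conts c k ∪ conts d k)
  | halt, k => {halt :: k}

theorem finite_conts (c : Cmd) : ∀ k, (conts c k).Finite := by
  induction c with
  | op o => exact fun k => Set.finite_singleton _
  | seq c d hc hd => exact fun k => ((hc _).union (hd _)).insert _
  | ite r c d hc hd => exact fun k => ((hc _).union (hd _)).insert _
  | loop r c hc => exact fun k => (hc _).insert _
  | query c d hc hd => exact fun k => ((hc _).union (hd _)).insert _
  | halt => exact fun k => Set.finite_singleton _

theorem mem_conts (c : Cmd) (k : List Cmd) : c :: k ∈ conts c k := by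
  cases c <;> simp [conts]

/-- The only exit from the listed continuations is to `k` itself. When a part of a compound command
is finished, it hands over to a continuation that the compound has listed. -/
theorem next_mem_conts (c : Cmd) : ∀ k, ∀ l ∈ conts c k, stops l = false → ∀ b a,
    next l b a ∈ insert k (conts c k) := by
  induction c with
  | op o =>
    rintro k _ rfl _ b a
    exact .inl rfl
  | seq c d hc hd =>
    rintro k l (rfl | hl | hl) hs b a
    · exact .inr (.inr (.inl (mem_conts _ _)))
    · rcases hc _ l hl hs b a with h | h
      · rw [h]; exact .inr (.inr (.inr (mem_conts _ _)))
      · exact .inr (.inr (.inl h))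
    · exact (hd _ l hl hs b a).imp_right fun h => .inr (.inr h)
  | ite r c d hc hd =>
    rintro k l (rfl | hl | hl) hs b a
    · cases b
      exacts [.inr (.inr (.inr (mem_conts _ _))), .inr (.inr (.inl (mem_conts _ _)))]
    · exact (hc _ l hl hs b a).imp_right fun h => .inr (.inl h)
    · exact (hd _ l hl hs b a).imp_right fun h => .inr (.inr h)
  | loop r c hc =>
    rintro k l (rfl | hl) hs b a
    · cases b
      exacts [.inl rfl, .inr (.inr (mem_conts _ _))]
    · rcases hc _ l hl hs b a with h | h
      · rw [h]; exact .inr (.inl rfl)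
      · exact .inr (.inr h)
  | query c d hc hd =>
    rintro k l (rfl | hl | hl) hs b a
    · cases a
      exacts [.inr (.inr (.inr (mem_conts _ _))), .inr (.inr (.inl (mem_conts _ _)))]
    · exact (hc _ l hl hs b a).imp_right fun h => .inr (.inl h)
    · exact (hd _ l hl hs b a).imp_right fun h => .inr (.inr h)
  | halt =>
    rintro k _ rfl hs
    cases hs

end Cmd

theorem Reg.bound.mono {R R' : ℕ} (h : R ≤ R') {r : Reg} (hr : r.bound R) : r.bound R' := by
  cases r with
  | nat t => trivial
  | trk i => exact lt_of_lt_of_le hr h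

theorem Op.bound.mono {R R' : ℕ} (h : R ≤ R') {o : Op} (ho : o.bound R) : o.bound R' := by
  cases o with
  | nat => trivial
  | trk => exact ⟨ho.1.trans_le h, ho.2.1.trans_le h, ho.2.2.trans_le h⟩

theorem exists_bound {F : Set (List Cmd)} (hF : F.Finite) :
    ∃ R, ∀ l ∈ F, (∀ o, Cmd.opOf l = some o → o.bound R) ∧ (Cmd.testReg l).bound R := by
  have h : ∀ l : List Cmd, ∃ R, (∀ o, Cmd.opOf l = some o → o.bound R) ∧
      (Cmd.testReg l).bound R := by
    intro l
    have h1 : ∃ R, ∀ o, Cmd.opOf l = some o → o.bound R := by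
      cases h : Cmd.opOf l with
      | none => exact ⟨0, fun o ho => by cases ho⟩
      | some o =>
        cases o with
        | nat => exact ⟨0, fun o ho => by cases ho; trivial⟩
        | trk d a b f =>
          exact ⟨d + a + b + 1, fun o ho => by
            cases ho
            refine ⟨?_, ?_, ?_⟩ <;> omega⟩
    have h2 : ∃ R, (Cmd.testReg l).bound R := by
      cases h : Cmd.testReg l with
      | nat => exact ⟨0, trivial⟩
      | trk i => exact ⟨i + 1, Nat.lt_succ_self i⟩
    obtain ⟨R₁, h1⟩ := h1
    obtain ⟨R₂, h2⟩ := h2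
    exact ⟨max R₁ R₂, fun o ho => (h1 o ho).mono (le_max_left _ _), h2.mono (le_max_right _ _)⟩
  choose R hR using h
  refine ⟨hF.toFinset.sup R, fun l hl => ?_⟩
  have hle : R l ≤ hF.toFinset.sup R := Finset.le_sup (by simpa using hl)
  exact ⟨fun o ho => ((hR l).1 o ho).mono hle, (hR l).2.mono hle⟩

theorem exists_control (c₀ c₁ : Cmd) (h₀ : Cmd.isQuery [c₀] = false) :
    ∃ W : Control, W.entry = [c₀] ∧ W.lim = [c₁] := by
  let F : Set (List Cmd) := insert [] (Cmd.conts c₀ [] ∪ Cmd.conts c₁ [])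
  have hF : F.Finite := ((Cmd.finite_conts _ _).union (Cmd.finite_conts _ _)).insert _
  obtain ⟨R, hR⟩ := exists_bound hF
  refine ⟨⟨F, R, [c₀], [c₁], hF, .inr (.inl (Cmd.mem_conts _ _)), .inr (.inr (Cmd.mem_conts _ _)),
    h₀, ?_, fun l hl => (hR l hl).1, fun l hl => (hR l hl).2⟩, rfl, rfl⟩
  rintro l (rfl | hl | hl) hs b a
  · cases hs
  · exact (Cmd.next_mem_conts _ _ l hl hs b a).imp_right .inl
  · exact (Cmd.next_mem_conts _ _ l hl hs b a).imp_right .inr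

/-! ### Endless loops -/

/-- `Rel` holds from every step to every later one, and the loop passes through each `σ i` at
arbitrarily late steps. So for a bit that can only be switched on along `Rel`, its value after `ω`
steps is decided by the stores `σ i`. -/
theorem Ex.loop_forever {A : Set CReal} {c : Cmd} {P : Op → Prop} {T : Reg → Prop} {r : Reg}
    (hc : c.All P T) {Rel : Store → Store → Prop} (hrefl : ∀ σ, Rel σ σ)
    (htrans : ∀ σ σ' σ'', Rel σ σ' → Rel σ' σ'' → Rel σ σ'')
    (hop : ∀ o σ, P o → Rel σ (o.apply σ)) (hr : ∀ σ σ', Rel σ σ' → σ' r = σ r)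
    {σ : ℕ → Store} (h0 : σ 0 r 0 = true) (hσ : ∀ i, Ex A c (σ i) (σ (i + 1))) :
    (∀ t, Cmd.stops ((wstep A)^[t] ([.loop r c], σ 0)).1 = false) ∧
    (∀ t t', t ≤ t' → Rel ((wstep A)^[t] ([.loop r c], σ 0)).2
      ((wstep A)^[t'] ([.loop r c], σ 0)).2) ∧
    ∀ i, ∃ t, i ≤ t ∧ (wstep A)^[t] ([.loop r c], σ 0) = ([.loop r c], σ i) := by
  have hσr : ∀ i, σ i r 0 = true := by
    intro i
    induction i with
    | zero => exact h0
    | succ i ih => rw [hr _ _ ((hσ i).rel hc hrefl htrans hop)]; exact ih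
  have key : ∀ t, (∃ l, ((wstep A)^[t] ([.loop r c], σ 0)).1 = l ++ [.loop r c] ∧
      ∀ d ∈ l, Cmd.All P T d) ∧ Rel (σ 0) ((wstep A)^[t] ([.loop r c], σ 0)).2 ∧
      Cmd.stops ((wstep A)^[t] ([.loop r c], σ 0)).1 = false ∧
      Rel ((wstep A)^[t] ([.loop r c], σ 0)).2 ((wstep A)^[t + 1] ([.loop r c], σ 0)).2 := by
    have aux : ∀ (s : List Cmd × Store), (∃ l, s.1 = l ++ [.loop r c] ∧ ∀ d ∈ l, Cmd.All P T d) →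
        s.2 r 0 = true → Cmd.stops s.1 = false ∧ Rel s.2 (wstep A s).2 ∧
        ∃ l, (wstep A s).1 = l ++ [.loop r c] ∧ ∀ d ∈ l, Cmd.All P T d := by
      rintro ⟨l, τ⟩ ⟨l, rfl, hl⟩ hτ
      rcases eq_or_ne l [] with rfl | hne
      · refine ⟨rfl, hrefl _, [c], ?_, by simpa using hc⟩
        change (bif τ r 0 then _ else _) = _
        rw [show τ r 0 = true from hτ]; rfl
      · obtain ⟨l', h1, h2, h3, h4⟩ := Cmd.step_append A hne hl [.loop r c] τ
        refine ⟨h3, ?_, l', h1, h2⟩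
        rcases h4 with h4 | ⟨o, ho, h4⟩
        · simp only [h4, hrefl]
        · simp only [h4]; exact hop o τ ho
    intro t
    induction t with
    | zero =>
      have h1 : ∃ l, ([Cmd.loop r c], σ 0).1 = l ++ [Cmd.loop r c] ∧ ∀ d ∈ l, Cmd.All P T d :=
        ⟨[], rfl, by simp⟩
      obtain ⟨h2, h3, -⟩ := aux _ h1 h0
      exact ⟨h1, hrefl _, h2, h3⟩
    | succ t ih =>
      obtain ⟨h1, h2, h3, h4⟩ := ih
      have h5 := htrans _ _ _ h2 h4
      have h6 := (aux _ h1 (by rw [hr _ _ h2]; exact h0)).2.2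
      rw [← Function.iterate_succ_apply' (wstep A)] at h6
      obtain ⟨h7, h8, -⟩ := aux _ h6 (by rw [hr _ _ h5]; exact h0)
      rw [← Function.iterate_succ_apply' (wstep A)] at h8
      exact ⟨h6, h5, h7, h8⟩
  refine ⟨fun t => (key t).2.2.1, fun t t' h => ?_, fun i => ?_⟩
  · induction h with
    | refl => exact hrefl _
    | step _ ih => exact htrans _ _ _ ih (key _).2.2.2
  · induction i with
    | zero => exact ⟨0, le_rfl, rfl⟩
    | succ i ih =>
      obtain ⟨t, ht, h⟩ := ih
      obtain ⟨n, hn⟩ := hσ i [.loop r c]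
      refine ⟨n + (t + 1), by omega, ?_⟩
      rw [Function.iterate_add_apply, Function.iterate_succ_apply', h]
      change (wstep A)^[n] ((bif σ i r 0 then _ else _), σ i) = _
      rw [hσr i]
      exact hn

end ITTM

/-! ### Switching on a single bit of a register -/

namespace ITTM

def Op.dst : Op → Reg
  | .nat d _ _ _ => .nat d
  | .trk d _ _ _ => .trk d

theorem Op.apply_of_ne {o : Op} {r : Reg} (h : r ≠ o.dst) (σ : Store) : o.apply σ r = σ r := by
  cases o <;> exact Function.update_of_ne h _ _

/-- All operations write to registers in `S`. -/
abbrev Cmd.Writes (S : Set Reg) (c : Cmd) : Prop := c.All (fun o => o.dst ∈ S) fun _ => True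

theorem Ex.eq_of_notMem {A : Set CReal} {c : Cmd} {σ σ₁ : Store} (h : Ex A c σ σ₁) {S : Set Reg}
    (hc : c.Writes S) {r : Reg} (hr : r ∉ S) : σ₁ r = σ r :=
  h.rel hc (Rel := fun σ σ' => σ' r = σ r) (fun _ => rfl) (fun _ _ _ h h' => h'.trans h)
    fun _ σ ho => Op.apply_of_ne (fun h => hr (by rw [h]; exact ho)) σ

/-- The tracks from number `4` on. -/
def work : Set Reg := {r | ∃ i, 4 ≤ i ∧ r = .trk i}

theorem trk_mem_work {i : ℕ} : Reg.trk i ∈ work ↔ 4 ≤ i := by simp [work]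

theorem nat_notMem_work {t : Fin 3} : Reg.nat t ∉ work := by simp [work]

theorem Cmd.All.writes_work {out base : ℕ} {c : Cmd} (hout : 4 ≤ out) (hbase : 4 ≤ base)
    (h : c.All (Op.WritesIn ({out} ∪ Set.Ici base)) fun _ => True) : c.Writes work :=
  h.mono (by
    rintro o ⟨d, a, b, f, rfl, rfl | hd⟩
    · exact trk_mem_work.2 hout
    · exact trk_mem_work.2 (hbase.trans hd)) fun _ h => h

def oneHot (n : ℕ) : CReal := fun k => decide (k = n)

theorem push_natReal_zero : (fun k => if k = 0 then true else natReal 0 (k - 1)) = oneHot 0 := by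
  funext k
  simp [natReal, oneHot]

theorem push_oneHot (n : ℕ) : (fun k => if k = 0 then false else oneHot n (k - 1)) =
    oneHot (n + 1) := by
  funext k
  rcases k with _ | k <;> simp [oneHot]

namespace Op

def clrQ : Op := .nat 2 2 2 fun _ _ _ _ => false
def pushQ (b : Bool) : Op := .nat 2 2 2 fun p _ _ _ => p.getD b
def popI : Op := .nat 0 0 0 fun _ _ _ n => n
def orO : Op := .nat 1 1 2 fun _ x y _ => x || y

theorem clrQ_apply (σ : Store) : clrQ.apply σ = Function.update σ (.nat 2) (natReal 0) := by
  simp only [clrQ, apply]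
  congr 1

theorem pushQ_apply (b : Bool) (σ : Store) : (pushQ b).apply σ =
    Function.update σ (.nat 2) fun n => if n = 0 then b else σ (.nat 2) (n - 1) := by
  simp only [pushQ, apply]
  congr 1
  funext n
  simp only [localOp]
  split_ifs <;> rfl

theorem popI_apply (σ : Store) :
    popI.apply σ = Function.update σ (.nat 0) fun n => σ (.nat 0) (n + 1) := rfl

theorem orO_apply (σ : Store) : orO.apply σ =
    Function.update σ (.nat 1) fun n => σ (.nat 1) n || σ (.nat 2) n := rfl

end Op

/-- Ops that prepare a mask in `M` and add it to `D`. -/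
structure MaskOps where
  M : Reg
  D : Reg
  clr : Op
  one : Op
  push : Op
  add : Op
  clr_dst : clr.dst = M
  one_dst : one.dst = M
  push_dst : push.dst = M
  add_dst : add.dst = D
  M_ne : M ≠ .trk 3 ∧ M ≠ .trk 5
  M_ne_D : M ≠ D
  D_notMem : D ∉ work
  init_apply : ∀ σ, one.apply (clr.apply σ) M = oneHot 0
  push_apply : ∀ σ, push.apply σ M = fun n => if n = 0 then false else σ M (n - 1)
  add_apply : ∀ σ, add.apply σ D = fun n => σ D n || σ M n

def trackMask : MaskOps where
  M := .trk 6
  D := .trk 1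
  clr := .clr 6
  one := .push true 6
  push := .push false 6
  add := .orr 1 6
  clr_dst := rfl
  one_dst := rfl
  push_dst := rfl
  add_dst := rfl
  M_ne := by simp
  M_ne_D := by simp
  D_notMem := by simp [trk_mem_work]
  init_apply σ := by
    rw [Op.push_apply, Op.clr_apply, Function.update_self, Function.update_self, push_natReal_zero]
  push_apply σ := by rw [Op.push_apply, Function.update_self]
  add_apply σ := by rw [Op.orr_apply, Function.update_self]

/-- The output tape can be combined only with another tape, so its mask is built on the oracle tape,
which is free once the oracle has been read into the array. -/
def outputMask : MaskOps where
  M := .nat 2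
  D := .nat 1
  clr := .clrQ
  one := .pushQ true
  push := .pushQ false
  add := .orO
  clr_dst := rfl
  one_dst := rfl
  push_dst := rfl
  add_dst := rfl
  M_ne := by simp
  M_ne_D := by simp
  D_notMem := nat_notMem_work
  init_apply σ := by
    rw [Op.pushQ_apply, Op.clrQ_apply, Function.update_self, Function.update_self,
      push_natReal_zero]
  push_apply σ := by rw [Op.pushQ_apply, Function.update_self]
  add_apply σ := by rw [Op.orO_apply, Function.update_self]

namespace MaskOps

variable (m : MaskOps)

theorem ex_count {A : Set CReal} (n : ℕ) : ∀ (k : ℕ) (σ : Store), σ (.trk 5) = natReal n →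
    σ m.M = oneHot k →
      ∃ σ', Ex A (.loop (.trk 5) (.seq (.op (.pop 5)) (.op m.push))) σ σ' ∧
        σ' m.M = oneHot (k + n) := by
  induction n with
  | zero => exact fun k σ h h' => ⟨σ, Ex.loop_exit (by rw [h]; rfl), h'⟩
  | succ n ih =>
    intro k σ h h'
    have h1 : ((Op.pop 5).apply σ) m.M = oneHot k := by
      rw [Op.pop_apply, Function.update_of_ne m.M_ne.2, h']
    have h2 : ((Op.pop 5).apply σ) (.trk 5) = natReal n := by
      rw [Op.pop_apply, Function.update_self, h, natReal_pop]
    obtain ⟨σ', h3, h4⟩ := ih (k + 1) (m.push.apply ((Op.pop 5).apply σ))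
      (by rw [Op.apply_of_ne (by rw [m.push_dst]; exact m.M_ne.2.symm), h2])
      (by rw [m.push_apply, h1, push_oneHot])
    refine ⟨σ', Ex.loop_step (by rw [h]; exact natReal_succ_bit n) ((Ex.op _).seq (Ex.op _)) h3, ?_⟩
    rw [h4, add_assoc, add_comm 1]

/-- Adding the number `n` to the set `D` if `f s = n + 1`, where `s` is on track `3`. -/
theorem exists_put {f : ℕ → ℕ} (hf : Primrec f) :
    ∃ c : Cmd, c.All (fun o => o.dst ∈ insert m.M work ∨ o = m.add) (fun _ => True) ∧
      ∀ (A : Set CReal) (σ : Store) (s : ℕ), σ (.trk 3) = natReal s →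
        ∃ σ', Ex A c σ σ' ∧ (σ' m.D = fun n => σ m.D n || decide (f s = n + 1)) ∧
          ∀ r, r ∉ insert m.D (insert m.M work) → σ' r = σ r := by
  obtain ⟨c, hc, hcs⟩ := exists_cmd_of_primrec hf (a := 3) (out := 5) (base := 10) (by simp)
    (by simp)
  have hc' : c.Writes work := hc.writes_work (by simp) (by simp)
  have h5 : Reg.trk 5 ∈ work := trk_mem_work.2 (by simp)
  -- A value `n + 1` stands for the element `n`, and `0` for no element. The first pop removes this
  -- offset; then the one at place `0` of the mask is pushed `n` places to the right.
  let d : Cmd := .seq (.op (.pop 5)) (.seq (.op m.clr) (.seq (.op m.one)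
    (.loop (.trk 5) (.seq (.op (.pop 5)) (.op m.push)))))
  have hd : d.Writes (insert m.M work) :=
    ⟨.inr h5, .inl m.clr_dst, .inl m.one_dst, trivial, .inr h5, .inl m.push_dst⟩
  have hall : (Cmd.seq c (.ite (.trk 5) (.seq d (.op m.add)) (.op (.clr 5)))).All
      (fun o => o.dst ∈ insert m.M work ∨ o = m.add) (fun _ => True) :=
    ⟨hc'.mono (fun o h => .inl (.inr h)) fun _ h => h, trivial,
      ⟨hd.mono (fun o h => .inl h) fun _ h => h, .inr rfl⟩, .inl (.inr h5)⟩
  refine ⟨_, hall, fun A σ s hs => ?_⟩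
  have hframe : ∀ σ', Ex A (Cmd.seq c (.ite (.trk 5) (.seq d (.op m.add)) (.op (.clr 5)))) σ σ' →
      ∀ r, r ∉ insert m.D (insert m.M work) → σ' r = σ r := fun σ' h r hr =>
    h.eq_of_notMem (hall.mono (fun o ho => by
      rcases ho with ho | rfl
      · exact Set.mem_insert_of_mem _ ho
      · rw [m.add_dst]; exact Set.mem_insert _ _) fun _ h => h) hr
  obtain ⟨σ₁, h1, h2⟩ := hcs A σ s hs
  have hD : σ₁ m.D = σ m.D := h1.eq_of_notMem hc' m.D_notMem
  have hDM : m.D ∉ insert m.M work := by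
    rintro (h | h)
    exacts [m.M_ne_D h.symm, m.D_notMem h]
  cases hn : f s with
  | zero =>
    rw [hn] at h2
    have hex := h1.seq (Ex.ite_false (r := .trk 5) (c := .seq d (.op m.add)) (by rw [h2]; rfl)
      (Ex.op (A := A) (.clr 5)))
    refine ⟨_, hex, ?_, hframe _ hex⟩
    rw [Op.apply_of_ne (fun h => m.D_notMem (by rw [h]; exact h5)), hD]
    simp
  | succ n =>
    rw [hn] at h2
    have h3 : (m.one.apply (m.clr.apply ((Op.pop 5).apply σ₁))) (.trk 5) = natReal n := by
      rw [Op.apply_of_ne (by rw [m.one_dst]; exact m.M_ne.2.symm),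
        Op.apply_of_ne (by rw [m.clr_dst]; exact m.M_ne.2.symm), Op.pop_apply,
        Function.update_self, h2, natReal_pop]
    obtain ⟨σ₂, h4, h5'⟩ := m.ex_count (A := A) n 0 _ h3 (m.init_apply _)
    have hd' : Ex A d σ₁ σ₂ := (Ex.op _).seq ((Ex.op _).seq ((Ex.op _).seq h4))
    have hex := h1.seq (Ex.ite_true (r := .trk 5) (d := .op (.clr 5))
      (by rw [h2]; exact natReal_succ_bit n) (hd'.seq (Ex.op m.add)))
    refine ⟨_, hex, ?_, hframe _ hex⟩
    rw [m.add_apply, hd'.eq_of_notMem hd hDM, hD, h5']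
    funext k
    simp [oneHot, eq_comm]

end MaskOps

/-! ### The loops -/

/-- What is preserved in the loops. -/
def LoopRel (σ σ' : Store) : Prop :=
  σ' (.trk 0) = σ (.trk 0) ∧ σ' (.trk 2) = σ (.trk 2) ∧
    (∀ n, σ (.trk 1) n = true → σ' (.trk 1) n = true) ∧
    ∀ n, σ (.nat 1) n = true → σ' (.nat 1) n = true

theorem LoopRel.refl (σ : Store) : LoopRel σ σ := ⟨rfl, rfl, fun _ h => h, fun _ h => h⟩

theorem LoopRel.trans (σ σ' σ'' : Store) (h : LoopRel σ σ') (h' : LoopRel σ' σ'') :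
    LoopRel σ σ'' :=
  ⟨h'.1.trans h.1, h'.2.1.trans h.2.1, fun n hn => h'.2.2.1 n (h.2.2.1 n hn),
    fun n hn => h'.2.2.2 n (h.2.2.2 n hn)⟩

def LoopOp (o : Op) : Prop := ∀ σ, LoopRel σ (o.apply σ)

theorem LoopOp.of_dst {o : Op} (h : o.dst ∉ ({.trk 0, .trk 1, .trk 2, .nat 1} : Set Reg)) :
    LoopOp o := by
  simp only [Set.mem_insert_iff, Set.mem_singleton_iff, not_or] at h
  obtain ⟨h0, h1, h2, h3⟩ := h
  intro σ
  refine ⟨?_, ?_, fun n => ?_, fun n => ?_⟩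
  · exact Op.apply_of_ne (Ne.symm h0) σ
  · exact Op.apply_of_ne (Ne.symm h2) σ
  · rw [Op.apply_of_ne (Ne.symm h1) σ]; exact id
  · rw [Op.apply_of_ne (Ne.symm h3) σ]; exact id

theorem LoopOp.orr : LoopOp (.orr 1 6) := by
  intro σ
  refine ⟨Op.apply_of_ne (by simp [Op.orr, Op.dst]) σ, Op.apply_of_ne (by simp [Op.orr, Op.dst]) σ,
    fun n hn => ?_, fun n hn => ?_⟩
  · rw [Op.orr_apply, Function.update_self, hn, Bool.true_or]
  · rw [Op.apply_of_ne (by simp [Op.orr, Op.dst]), hn]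

theorem LoopOp.orO : LoopOp .orO := by
  intro σ
  refine ⟨Op.apply_of_ne (by simp [Op.orO, Op.dst]) σ, Op.apply_of_ne (by simp [Op.orO, Op.dst]) σ,
    fun n hn => ?_, fun n hn => ?_⟩
  · rw [Op.apply_of_ne (by simp [Op.orO, Op.dst]), hn]
  · rw [Op.orO_apply, Function.update_self, hn, Bool.true_or]

theorem LoopOp.of_mem_work {o : Op} (h : o.dst ∈ work) : LoopOp o := by
  refine LoopOp.of_dst ?_
  obtain ⟨i, hi, h⟩ := h
  rw [h]
  simp only [Set.mem_insert_iff, Set.mem_singleton_iff, Reg.trk.injEq, reduceCtorEq, or_false]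
  omega

theorem LoopOp.of_trackMask {o : Op} (h : o.dst ∈ insert trackMask.M work ∨ o = trackMask.add) :
    LoopOp o := by
  rcases h with (h | h) | rfl
  · refine LoopOp.of_mem_work ?_
    rw [h]
    exact trk_mem_work.2 (by simp)
  · exact LoopOp.of_mem_work h
  · exact LoopOp.orr

theorem LoopOp.of_outputMask {o : Op} (h : o.dst ∈ insert outputMask.M work ∨ o = outputMask.add) :
    LoopOp o := by
  rcases h with (h | h) | rfl
  · refine LoopOp.of_dst ?_
    rw [h]
    simp [outputMask]
  · exact LoopOp.of_mem_work h
  · exact LoopOp.orO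

end ITTM

namespace ITTM

/-! ### The main loop -/

theorem Op.apply_trk_of_ne {o : Op} {i : ℕ} (h : o.dst ≠ .trk i) (σ : Store) :
    o.apply σ (.trk i) = σ (.trk i) := Op.apply_of_ne h.symm σ

/-- Only the first bit of a register can be tested, so bit `n` is brought there by `n` pops, counted
down on track `5`. -/
theorem ex_drop {A : Set CReal} (n : ℕ) : ∀ (σ : Store), σ (.trk 5) = natReal n →
    ∃ σ', Ex A (.loop (.trk 5) (.seq (.op (.pop 5)) (.op (.pop 4)))) σ σ' ∧
      σ' (.trk 4) 0 = σ (.trk 4) n := by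
  induction n with
  | zero => exact fun σ h => ⟨σ, Ex.loop_exit (by rw [h]; rfl), rfl⟩
  | succ n ih =>
    intro σ h
    obtain ⟨σ', h1, h2⟩ := ih ((Op.pop 4).apply ((Op.pop 5).apply σ)) (by
      rw [Op.apply_trk_of_ne (by simp [Op.pop, Op.dst]), Op.pop_apply, Function.update_self, h,
        natReal_pop])
    refine ⟨σ', Ex.loop_step (by rw [h]; exact natReal_succ_bit n) ((Ex.op _).seq (Ex.op _)) h1, ?_⟩
    rw [h2, Op.pop_apply, Function.update_self,
      Op.apply_trk_of_ne (by simp [Op.pop, Op.dst])]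

theorem trk_notMem_work {i : ℕ} (h : i < 4) : Reg.trk i ∉ work :=
  fun h' => absurd (trk_mem_work.1 h') (by omega)

/-- Replacing the number `s` on track `3` by `f1 s` or `f0 s`, depending on the bit with number
`addr s` on track `0`. -/
theorem exists_advance {addr f0 f1 : ℕ → ℕ} (ha : Primrec addr) (h0 : Primrec f0)
    (h1 : Primrec f1) :
    ∃ c : Cmd, c.Writes (insert (.trk 3) work) ∧ ∀ (A : Set CReal) (σ : Store) (s : ℕ),
      σ (.trk 3) = natReal s → ∃ σ', Ex A c σ σ' ∧
        σ' (.trk 3) = natReal (bif σ (.trk 0) (addr s) then f1 s else f0 s) := by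
  obtain ⟨ca, hca, hea⟩ := exists_cmd_of_primrec ha (a := 3) (out := 5) (base := 10) (by simp)
    (by simp)
  obtain ⟨c0, hc0, he0⟩ := exists_cmd_of_primrec h0 (a := 3) (out := 7) (base := 10) (by simp)
    (by simp)
  obtain ⟨c1, hc1, he1⟩ := exists_cmd_of_primrec h1 (a := 3) (out := 7) (base := 10) (by simp)
    (by simp)
  have hwa := hca.writes_work (by simp) (by simp)
  have hw0 := hc0.writes_work (by simp) (by simp)
  have hw1 := hc1.writes_work (by simp) (by simp)
  have hmono : ∀ {c : Cmd}, c.Writes work → c.Writes (insert (.trk 3) work) := fun h =>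
    h.mono (fun o h => .inr h) fun _ h => h
  let dr : Cmd := .loop (.trk 5) (.seq (.op (.pop 5)) (.op (.pop 4)))
  have hdr : dr.Writes work :=
    ⟨trivial, trk_mem_work.2 (by simp), trk_mem_work.2 (by simp)⟩
  refine ⟨.seq ca (.seq (.op (.cpy 4 0)) (.seq dr (.seq (.ite (.trk 4) c1 c0) (.op (.cpy 3 7))))),
    ⟨hmono hwa, .inr (trk_mem_work.2 (by simp)), hmono hdr, ⟨trivial, hmono hw1, hmono hw0⟩,
      .inl rfl⟩, fun A σ s hs => ?_⟩
  obtain ⟨σ₁, e1, k1⟩ := hea A σ s hs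
  have k1' : ∀ i < 4, σ₁ (.trk i) = σ (.trk i) := fun i hi =>
    e1.eq_of_notMem hwa (trk_notMem_work hi)
  obtain ⟨σ₂, e2, k2⟩ := ex_drop (A := A) (addr s) ((Op.cpy 4 0).apply σ₁) (by
    rw [Op.apply_trk_of_ne (by simp [Op.cpy, Op.dst]), k1])
  have k2' : ∀ i < 4, σ₂ (.trk i) = σ (.trk i) := fun i hi => by
    rw [e2.eq_of_notMem hdr (trk_notMem_work hi), Op.apply_trk_of_ne, k1' i hi]
    simp only [Op.cpy, Op.dst, ne_eq, Reg.trk.injEq]; omega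
  rw [Op.cpy_apply, Function.update_self, k1' 0 (by simp)] at k2
  cases hb : σ (.trk 0) (addr s) with
  | true =>
    obtain ⟨σ₃, e3, k3⟩ := he1 A σ₂ s (by rw [k2' 3 (by simp), hs])
    refine ⟨_, e1.seq ((Ex.op _).seq (e2.seq ((Ex.ite_true (by rw [k2, hb]) e3).seq (Ex.op _)))), ?_⟩
    rw [Op.cpy_apply, Function.update_self, k3]; rfl
  | false =>
    obtain ⟨σ₃, e3, k3⟩ := he0 A σ₂ s (by rw [k2' 3 (by simp), hs])
    refine ⟨_, e1.seq ((Ex.op _).seq (e2.seq ((Ex.ite_false (by rw [k2, hb]) e3).seq (Ex.op _)))), ?_⟩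
    rw [Op.cpy_apply, Function.update_self, k3]; rfl

theorem LoopOp.of_three {o : Op} (h : o.dst = .trk 3) : LoopOp o :=
  LoopOp.of_dst (by rw [h]; simp)

/-- One round of the main loop. Track `0` holds the present array, track `1` collects the next one,
track `2` is the loop flag and track `3` holds the state `s` of the search through the rules. In
`wr` and `ow` the value `0` means that nothing is added. -/
theorem exists_body {addr f0 f1 wr ow : ℕ → ℕ} (ha : Primrec addr) (h0 : Primrec f0)
    (h1 : Primrec f1) (hw : Primrec wr) (ho : Primrec ow) :
    ∃ c : Cmd, c.All LoopOp (fun _ => True) ∧ ∀ (A : Set CReal) (σ : Store) (s : ℕ),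
      σ (.trk 3) = natReal s → ∃ σ', Ex A c σ σ' ∧
        σ' (.trk 3) = natReal (bif σ (.trk 0) (addr s) then f1 s else f0 s) ∧
        (σ' (.trk 1) = fun n => σ (.trk 1) n || decide (wr s = n + 1)) ∧
        σ' (.nat 1) = fun n => σ (.nat 1) n || decide (ow s = n + 1) := by
  obtain ⟨cw, hcw, hew⟩ := trackMask.exists_put hw
  obtain ⟨co, hco, heo⟩ := outputMask.exists_put ho
  obtain ⟨ca, hca, hea⟩ := exists_advance ha h0 h1
  refine ⟨.seq cw (.seq co ca), ⟨hcw.mono (fun o => LoopOp.of_trackMask) fun _ h => h,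
    hco.mono (fun o => LoopOp.of_outputMask) fun _ h => h, hca.mono ?_ fun _ h => h⟩,
    fun A σ s hs => ?_⟩
  · rintro o (h | h)
    exacts [LoopOp.of_three h, LoopOp.of_mem_work h]
  obtain ⟨σ₁, e1, k1, g1⟩ := hew A σ s hs
  have g1' : ∀ r, r ≠ .trk 1 → r ∉ work → σ₁ r = σ r := fun r h h' => g1 r (by
    rintro (h1 | h1 | h1)
    exacts [h h1, h' (by rw [h1]; exact trk_mem_work.2 (by simp)), h' h1])
  have h3 : σ₁ (.trk 3) = natReal s := by
    rw [g1' _ (by simp) (trk_notMem_work (by simp)), hs]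
  obtain ⟨σ₂, e2, k2, g2⟩ := heo A σ₁ s h3
  have g2' : ∀ i < 4, σ₂ (.trk i) = σ₁ (.trk i) := fun i hi => g2 _ (by
    rintro (h1 | h1 | h1)
    exacts [(nomatch h1), (nomatch h1), trk_notMem_work hi h1])
  obtain ⟨σ₃, e3, k3⟩ := hea A σ₂ s (by rw [g2' 3 (by simp), h3])
  refine ⟨σ₃, e1.seq (e2.seq e3), ?_, ?_, ?_⟩
  · rw [k3, g2' 0 (by simp), g1' _ (by simp) (trk_notMem_work (by simp))]
  · rw [e3.eq_of_notMem hca (by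
      rintro (h | h)
      exacts [by simp at h, trk_notMem_work (by simp) h]), g2' 1 (by simp)]
    exact k1
  · rw [e3.eq_of_notMem hca (by
      rintro (h | h)
      exacts [by simp at h, nat_notMem_work h])]
    refine k2.trans ?_
    simp only [outputMask]
    rw [g1' _ (by simp) nat_notMem_work]

-- One round of loading: bit `i` of the input and the answer of the oracle to the number `i` are
-- stored in the array. The oracle is consulted nowhere else; its members other than natural numbers
-- are ignored, and the oracles needed, `∅` and `realSet z`, have none.
open scoped Classical in
theorem exists_load {posx posa : ℕ → ℕ} (hx : Primrec posx) (ha : Primrec posa) :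
    ∃ c : Cmd, c.All LoopOp (fun _ => True) ∧ ∀ (A : Set CReal) (σ : Store) (i : ℕ),
      σ (.trk 3) = natReal i → σ (.nat 2) = natReal i → ∃ σ', Ex A c σ σ' ∧
        σ' (.trk 3) = natReal (i + 1) ∧ σ' (.nat 2) = natReal (i + 1) ∧
        (σ' (.nat 0) = fun n => σ (.nat 0) (n + 1)) ∧ σ' (.nat 1) = σ (.nat 1) ∧
        σ' (.trk 1) = fun n => σ (.trk 1) n || (σ (.nat 0) 0 && decide (posx i = n)) ||
          (decide (natReal i ∈ A) && decide (posa i = n)) := by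
  obtain ⟨cx, hcx, hex⟩ := trackMask.exists_put (Primrec.succ.comp hx)
  obtain ⟨ca, hca, hea⟩ := trackMask.exists_put (Primrec.succ.comp ha)
  have hnop : LoopOp (.clr 5) := LoopOp.of_mem_work (trk_mem_work.2 (by simp))
  refine ⟨.seq (.ite (.nat 0) cx (.op (.clr 5))) (.seq (.op .popI) (.seq (.query ca (.op (.clr 5)))
    (.seq (.op (.pushQ true)) (.op (.push true 3))))),
    ⟨⟨trivial, hcx.mono (fun o => LoopOp.of_trackMask) fun _ h => h, hnop⟩,
      LoopOp.of_dst (by simp [Op.popI, Op.dst]),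
      ⟨hca.mono (fun o => LoopOp.of_trackMask) fun _ h => h, hnop⟩,
      LoopOp.of_dst (by simp [Op.pushQ, Op.dst]), LoopOp.of_three rfl⟩, fun A σ i h3 hQ => ?_⟩
  have hframe : ∀ {σ σ' : Store},
      (∀ r, r ∉ insert trackMask.D (insert trackMask.M work) → σ' r = σ r) →
      ∀ r, r ≠ .trk 1 → r ∉ work → σ' r = σ r := fun g1 r h h' => g1 r (by
    rintro (h1 | h1 | h1)
    exacts [h h1, h' (by rw [h1]; exact trk_mem_work.2 (by simp)), h' h1])
  have clr5 : ∀ (σ : Store) (r : Reg), r ∉ work → (Op.clr 5).apply σ r = σ r := fun σ r hr =>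
    Op.apply_of_ne (by rintro rfl; exact hr (trk_mem_work.2 (by simp))) σ
  obtain ⟨σ₁, e1, k1, g1⟩ : ∃ σ₁, Ex A (.ite (.nat 0) cx (.op (.clr 5))) σ σ₁ ∧
      (σ₁ (.trk 1) = fun n => σ (.trk 1) n || (σ (.nat 0) 0 && decide (posx i = n))) ∧
      ∀ r, r ≠ .trk 1 → r ∉ work → σ₁ r = σ r := by
    cases hb : σ (.nat 0) 0 with
    | true =>
      obtain ⟨σ₁, e1, k1, g1⟩ := hex A σ i h3
      refine ⟨σ₁, Ex.ite_true hb e1, k1.trans ?_, hframe g1⟩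
      simp [trackMask]
    | false =>
      refine ⟨_, Ex.ite_false hb (Ex.op _), ?_, fun r _ hr => clr5 _ _ hr⟩
      rw [clr5 _ _ (trk_notMem_work (by simp))]
      simp
  have p1 : Op.popI.apply σ₁ (.nat 2) = natReal i := by
    rw [Op.apply_of_ne (by simp [Op.popI, Op.dst]), g1 _ (by simp) nat_notMem_work, hQ]
  have p2 : ∀ j, Op.popI.apply σ₁ (.trk j) = σ₁ (.trk j) := fun j =>
    Op.apply_of_ne (by simp [Op.popI, Op.dst]) _
  have p3 : Op.popI.apply σ₁ (.nat 1) = σ (.nat 1) := by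
    rw [Op.apply_of_ne (by simp [Op.popI, Op.dst]), g1 _ (by simp) nat_notMem_work]
  have p4 : Op.popI.apply σ₁ (.trk 3) = natReal i := by
    rw [p2, g1 _ (by simp) (trk_notMem_work (by simp)), h3]
  have p5 : Op.popI.apply σ₁ (.nat 0) = fun n => σ (.nat 0) (n + 1) := by
    rw [Op.popI_apply, Function.update_self, g1 _ (by simp) nat_notMem_work]
  obtain ⟨σ₂, e2, k2, g2⟩ : ∃ σ₂, Ex A (.query ca (.op (.clr 5))) (Op.popI.apply σ₁) σ₂ ∧
      (σ₂ (.trk 1) = fun n => σ₁ (.trk 1) n ||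
        (decide (natReal i ∈ A) && decide (posa i = n))) ∧
      ∀ r, r ≠ .trk 1 → r ∉ work → σ₂ r = Op.popI.apply σ₁ r := by
    by_cases hb : natReal i ∈ A
    · obtain ⟨σ₂, e2, k2, g2⟩ := hea A (Op.popI.apply σ₁) i p4
      refine ⟨σ₂, Ex.query_yes (by rw [p1]; exact hb) e2, k2.trans ?_, hframe g2⟩
      simp only [trackMask, p2]
      simp [hb]
    · refine ⟨_, Ex.query_no (by rw [p1]; exact hb) (Ex.op _), ?_, fun r _ hr => clr5 _ _ hr⟩
      rw [clr5 _ _ (trk_notMem_work (by simp)), p2]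
      simp [hb]
  refine ⟨_, e1.seq ((Ex.op _).seq (e2.seq ((Ex.op _).seq (Ex.op _)))), ?_, ?_, ?_, ?_, ?_⟩
  · rw [Op.push_apply, Function.update_self, Op.apply_of_ne (by simp [Op.pushQ, Op.dst]),
      g2 _ (by simp) (trk_notMem_work (by simp)), p4]
    exact natReal_push i
  · rw [Op.apply_of_ne (by simp [Op.push, Op.dst]), Op.pushQ_apply, Function.update_self,
      g2 _ (by simp) nat_notMem_work, p1]
    exact natReal_push i
  · rw [Op.apply_of_ne (by simp [Op.push, Op.dst]), Op.apply_of_ne (by simp [Op.pushQ, Op.dst]),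
      g2 _ (by simp) nat_notMem_work, p5]
  · rw [Op.apply_of_ne (by simp [Op.push, Op.dst]), Op.apply_of_ne (by simp [Op.pushQ, Op.dst]),
      g2 _ (by simp) nat_notMem_work, p3]
  · rw [Op.apply_of_ne (by simp [Op.push, Op.dst]), Op.apply_of_ne (by simp [Op.pushQ, Op.dst]),
      k2, k1]

end ITTM

/-! ### Endless loops between limit stages -/

namespace ITTM

/-- The states of a computation that in state `s` inspects the bit of `X` with number `addr s`. -/
def loopState (addr f0 f1 : ℕ → ℕ) (X : CReal) : ℕ → ℕ
  | 0 => 0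
  | i + 1 => bif X (addr (loopState addr f0 f1 X i)) then f1 (loopState addr f0 f1 X i)
      else f0 (loopState addr f0 f1 X i)

section limit

variable {A : Set CReal} {W : Control} {x : CReal} {a : Ordinal.{0}}

theorem stage_add_nat (k : ℕ) :
    W.stage A x (a + k) = (wstep A)^[k] (W.stage A x a) := wrun_add_nat ..

/-- Running an endless loop for `ω` steps. -/
theorem stage_loop {c : Cmd} (hc : c.All LoopOp fun _ => True) {σ : ℕ → Store} (N : ℕ)
    (ha : (wstep A)^[N] (W.stage A x a) = ([.loop (.trk 2) c], σ 0))
    (h0 : σ 0 (.trk 2) 0 = true) (hσ : ∀ i, Ex A c (σ i) (σ (i + 1))) :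
    (∀ k, N ≤ k → Cmd.stops (W.stage A x (a + k)).1 = false) ∧
    (∀ k n, N ≤ k → (W.stage A x (a + k)).2 (.trk 1) n = true → ∃ i, σ i (.trk 1) n = true) ∧
    (∀ k n, N ≤ k → (W.stage A x (a + k)).2 (.nat 1) n = true → ∃ i, σ i (.nat 1) n = true) ∧
    (∀ k n, N ≤ k → σ 0 (.nat 1) n = true → (W.stage A x (a + k)).2 (.nat 1) n = true) ∧
    (∀ n, (W.stage A x (a + Ordinal.omega0)).2 (.trk 1) n = true ↔
      ∃ i, σ i (.trk 1) n = true) ∧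
    (∀ n, (W.stage A x (a + Ordinal.omega0)).2 (.nat 1) n = true ↔
      ∃ i, σ i (.nat 1) n = true) := by
  obtain ⟨h1, h2, h3⟩ := Ex.loop_forever hc LoopRel.refl LoopRel.trans (fun o σ ho => ho σ)
    (fun _ _ h => h.2.1) h0 hσ
  have hs : ∀ t : ℕ, W.stage A x (a + (N + t : ℕ)) = (wstep A)^[t] ([.loop (.trk 2) c], σ 0) := by
    intro t
    rw [stage_add_nat, add_comm, Function.iterate_add_apply, ha]
  have key : ∀ r : Reg, (∀ σ σ', LoopRel σ σ' → ∀ n, σ r n = true → σ' r n = true) →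
      (∀ k n, N ≤ k → (W.stage A x (a + k)).2 r n = true → ∃ i, σ i r n = true) ∧
      (∀ k n, N ≤ k → σ 0 r n = true → (W.stage A x (a + k)).2 r n = true) ∧
      (∀ n, (W.stage A x (a + Ordinal.omega0)).2 r n = true ↔ ∃ i, σ i r n = true) := by
    intro r hr
    have g1 : ∀ k n, N ≤ k → (W.stage A x (a + k)).2 r n = true → ∃ i, σ i r n = true := by
      intro k n hk h
      obtain ⟨t, rfl⟩ := Nat.exists_eq_add_of_le hk
      rw [hs] at h
      obtain ⟨t', ht, h'⟩ := h3 t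
      have h4 := hr _ _ (h2 t t' ht) n h
      rw [h'] at h4
      exact ⟨t, h4⟩
    refine ⟨g1, fun k n hk h => ?_, fun n => ?_⟩
    · obtain ⟨t, rfl⟩ := Nat.exists_eq_add_of_le hk
      rw [hs]
      exact hr _ _ (h2 0 t t.zero_le) n h
    · rw [Control.stage, wrun_limit_snd _ _ _ _ (isSuccLimit_add_omega0 a)]
      constructor
      · intro H
        obtain ⟨γ, hγ, hle, h⟩ := H (a + N) (lt_add_omega0_iff.2 ⟨N, le_rfl⟩)
        obtain ⟨k, rfl⟩ := exists_add_nat (le_trans (by simp) hle) hγ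
        exact g1 k n (by simpa using hle) h
      · rintro ⟨i, hi⟩
        -- Once on, a bit stays on for the rest of the loop, so it is on at the limit.
        obtain ⟨t', -, h'⟩ := h3 i
        refine (limsup_add_omega0 (f := fun γ => (W.stage A x γ).2 r n) (b := true) (N := N + t')
          fun k hk => ?_).2 rfl
        obtain ⟨t, rfl⟩ := Nat.exists_eq_add_of_le (show N ≤ k by omega)
        simp only [hs]
        refine hr _ _ (h2 t' t (by omega)) n ?_
        rw [h']
        exact hi
  obtain ⟨k1, -, k3⟩ := key (.trk 1) fun _ _ h => h.2.2.1
  obtain ⟨l1, l2, l3⟩ := key (.nat 1) fun _ _ h => h.2.2.2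
  refine ⟨fun k hk => ?_, k1, l1, l2, k3, l3⟩
  obtain ⟨t, rfl⟩ := Nat.exists_eq_add_of_le hk
  rw [hs]
  exact h1 t

end limit

def loopPrelude (c : Cmd) : Cmd :=
  .seq (.op (.clr 1)) (.seq (.op (.clr 3)) (.seq (.op (.clr 2)) (.seq (.op (.push true 2))
    (.loop (.trk 2) c))))

def loopStore (τ : Store) : Store :=
  (Op.push true 2).apply ((Op.clr 2).apply ((Op.clr 3).apply ((Op.clr 1).apply
    ((Op.cpy 0 1).apply τ))))

/-- At every limit stage the collected array becomes the present one, and bit `0` of it decides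
about halting. Track `1` is cleared only afterwards; hence at a limit of such stages it shows the
limit superior of the arrays and not a mere union. -/
def limitCmd (c : Cmd) : Cmd :=
  .seq (.op (.cpy 0 1)) (.ite (.trk 0) .halt (loopPrelude c))

theorem limitCmd_stops {A : Set CReal} {c : Cmd} {τ : Store} (h : τ (.trk 1) 0 = true) :
    (∀ k < 3, Cmd.stops ((wstep A)^[k] ([limitCmd c], τ)).1 = false) ∧
      Cmd.stops ((wstep A)^[3] ([limitCmd c], τ)).1 = true ∧
      ((wstep A)^[3] ([limitCmd c], τ)).2 (.nat 1) = τ (.nat 1) := by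
  refine ⟨fun k hk => ?_, ?_, rfl⟩
  · interval_cases k <;> rfl
  · change Cmd.stops ((bif τ (.trk 1) 0 then Cmd.halt else _) :: []) = true
    rw [h]; rfl

/-- Three steps lead to the prelude (`seq`, copy, `ite`), and its four sequencings and four
operations take one step each. During all of them track `1` shows no bits beyond those of the array
just completed. -/
theorem limitCmd_steps {A : Set CReal} {c : Cmd} {τ : Store} (h : τ (.trk 1) 0 = false) :
    (∀ k < 11, Cmd.stops ((wstep A)^[k] ([limitCmd c], τ)).1 = false ∧
      (∀ n, ((wstep A)^[k] ([limitCmd c], τ)).2 (.trk 1) n = true → τ (.trk 1) n = true) ∧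
      ((wstep A)^[k] ([limitCmd c], τ)).2 (.nat 1) = τ (.nat 1)) ∧
      (wstep A)^[11] ([limitCmd c], τ) = ([.loop (.trk 2) c], loopStore τ) := by
  have h3 : (wstep A)^[3] ([limitCmd c], τ) = ([loopPrelude c], (Op.cpy 0 1).apply τ) := by
    change (((bif τ (.trk 1) 0 then Cmd.halt else _) :: [], _) : List Cmd × Store) = _
    rw [h]; rfl
  have hk : ∀ k, (wstep A)^[k + 3] ([limitCmd c], τ) =
      (wstep A)^[k] ([loopPrelude c], (Op.cpy 0 1).apply τ) := fun k => by
    rw [Function.iterate_add_apply, h3]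
  have hclr : ∀ n : ℕ, (false = true) → τ (.trk 1) n = true := by simp
  refine ⟨fun k hk' => ?_, hk 8⟩
  rcases lt_or_ge k 3 with hlt | hge
  · interval_cases k
    exacts [⟨rfl, fun n h => h, rfl⟩, ⟨rfl, fun n h => h, rfl⟩, ⟨rfl, fun n h => h, rfl⟩]
  · obtain ⟨k, rfl⟩ := Nat.exists_eq_add_of_le' hge
    rw [hk]
    have hk8 : k < 8 := by omega
    clear hk hge hk'
    interval_cases k
    exacts [⟨rfl, fun n h => h, rfl⟩, ⟨rfl, fun n h => h, rfl⟩, ⟨rfl, hclr, rfl⟩,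
      ⟨rfl, hclr, rfl⟩, ⟨rfl, hclr, rfl⟩, ⟨rfl, hclr, rfl⟩, ⟨rfl, hclr, rfl⟩, ⟨rfl, hclr, rfl⟩]

theorem loopStore_spec (τ : Store) : loopStore τ (.trk 0) = τ (.trk 1) ∧
    loopStore τ (.trk 1) = natReal 0 ∧ loopStore τ (.trk 2) = natReal 1 ∧
    loopStore τ (.trk 3) = natReal 0 ∧ loopStore τ (.nat 1) = τ (.nat 1) := by
  refine ⟨rfl, rfl, ?_, rfl, rfl⟩
  rw [← natReal_push 0]
  simp only [loopStore]
  rw [Op.push_apply, Function.update_self, Op.clr_apply, Function.update_self]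

end ITTM

/-! ### Iterating a transformation through the ordinals -/

namespace ITTM

theorem exists_store_seq {A : Set CReal} {c : Cmd} {I : ℕ → Store → Prop} {σ₀ : Store}
    (h0 : I 0 σ₀) (hs : ∀ i σ, I i σ → ∃ σ', Ex A c σ σ' ∧ I (i + 1) σ') :
    ∃ σ : ℕ → Store, σ 0 = σ₀ ∧ ∀ i, Ex A c (σ i) (σ (i + 1)) ∧ I i (σ i) := by
  choose! g hg1 hg2 using hs
  let σ : ℕ → Store := fun i => Nat.rec σ₀ (fun i τ => g i τ) i
  have hσ : ∀ i, I i (σ i) := by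
    intro i
    induction i with
    | zero => exact h0
    | succ i ih => exact hg2 _ _ ih
  exact ⟨σ, rfl, fun i => ⟨hg1 _ _ (hσ i), hσ i⟩⟩

theorem exists_lt_succ_or {p : ℕ → Prop} {i : ℕ} : (∃ j < i + 1, p j) ↔ (∃ j < i, p j) ∨ p i := by
  simp only [Nat.lt_succ_iff_lt_or_eq, or_and_right, exists_or, exists_eq_left]

/-- Each application of the transformation is one endless loop, completed at the next limit stage.
Elements printed by the loops accumulate on the output tape, which is why `y` collects all stages
before `β`. -/
theorem exists_loop_program {addr f0 f1 wr ow posx posa : ℕ → ℕ} (hadr : Primrec addr)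
    (hf0 : Primrec f0) (hf1 : Primrec f1) (hwr : Primrec wr) (how : Primrec ow)
    (hposx : Primrec posx) (hposa : Primrec posa) :
    ∃ P : Program, ∀ (A : Set CReal) (x : CReal) (Z : Ordinal.{0} → CReal),
      (∀ n, Z 0 n = true ↔ ∃ j, (x j = true ∧ posx j = n) ∨ (natReal j ∈ A ∧ posa j = n)) →
      (∀ β n, Z (β + 1) n = true ↔ ∃ i, wr (loopState addr f0 f1 (Z β) i) = n + 1) →
      (∀ l, Order.IsSuccLimit l → ∀ n,
        (Z l n = true ↔ ∀ β < l, ∃ γ < l, β ≤ γ ∧ Z γ n = true)) →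
      ∀ β (y : CReal), (∀ γ < β, Z γ 0 = false) → Z β 0 = true →
        (∀ n, y n = true ↔ ∃ γ < β, ∃ i, ow (loopState addr f0 f1 (Z γ) i) = n + 1) →
        Yields A P x y := by
  obtain ⟨cb, hcb, heb⟩ := exists_body hadr hf0 hf1 hwr how
  obtain ⟨cl, hcl, hel⟩ := exists_load hposx hposa
  obtain ⟨W, hW0, hW1⟩ := exists_control (.seq (.op (.push true 2)) (.loop (.trk 2) cl))
    (limitCmd cb) rfl
  refine ⟨W.program, fun A x Z hZ0 hZs hZl β y hβ0 hβ1 hy => ?_⟩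
  have hω : (0 : Ordinal) < Ordinal.omega0 := Ordinal.omega0_pos
  let Out : Ordinal.{0} → ℕ → Prop := fun β n =>
    ∃ γ < β, ∃ i, ow (loopState addr f0 f1 (Z γ) i) = n + 1
  have Out_mono : ∀ {β γ n}, β ≤ γ → Out β n → Out γ n := fun h ⟨δ, hδ, h'⟩ =>
    ⟨δ, hδ.trans_le h, h'⟩
  have Out_succ : ∀ β n, Out (β + 1) n ↔
      Out β n ∨ ∃ i, ow (loopState addr f0 f1 (Z β) i) = n + 1 := by
    intro β n
    constructor
    · rintro ⟨γ, hγ, h⟩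
      rcases (Order.lt_add_one_iff.1 hγ).lt_or_eq with h' | rfl
      exacts [.inl ⟨γ, h', h⟩, .inr h]
    · rintro (h | h)
      exacts [Out_mono le_self_add h, ⟨β, Order.lt_add_one_iff.2 le_rfl, h⟩]
  -- The first `ω` word stages load the array; afterwards each step of `Z` takes `ω` of them.
  let θ : Ordinal.{0} → Ordinal.{0} := fun β => Ordinal.omega0 * (1 + β)
  have θs : ∀ β, θ (β + 1) = θ β + Ordinal.omega0 := fun β => by
    simp only [θ, ← add_assoc, mul_add_one]
  have θlim : ∀ β, (W.stage A x (θ β)).1 = [limitCmd cb] := fun β => by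
    rw [Control.stage, wrun_limit_fst _ _ _ _, hW1]
    rcases Ordinal.zero_or_succ_or_isSuccLimit β with rfl | ⟨γ, rfl⟩ | hβ
    · simp [θ]
    · rw [Order.succ_eq_add_one, θs]; exact isSuccLimit_add_omega0 _
    · exact Ordinal.isSuccLimit_mul_right hω (Ordinal.isSuccLimit_add _ hβ)
  let Good : Ordinal.{0} → Prop := fun β => (W.stage A x (θ β)).2 (.trk 1) = Z β ∧
    ∀ n, (W.stage A x (θ β)).2 (.nat 1) n = true ↔ Out β n
  have load : (∀ k : ℕ, Cmd.stops (W.stage A x k).1 = false) ∧ Good 0 := by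
    have hst0 : W.stage A x 0 = ([.seq (.op (.push true 2)) (.loop (.trk 2) cl)], initStore x) := by
      rw [Control.stage, wrun_zero, hW0]
    obtain ⟨σ, hσ0, hσ⟩ := exists_store_seq (A := A) (c := cl)
      (σ₀ := (Op.push true 2).apply (initStore x))
      (I := fun i σ => σ (.trk 3) = natReal i ∧ σ (.nat 2) = natReal i ∧
        (σ (.nat 0) = fun n => x (n + i)) ∧ (σ (.nat 1) = fun _ => false) ∧
        ∀ n, σ (.trk 1) n = true ↔
          ∃ j < i, (x j = true ∧ posx j = n) ∨ (natReal j ∈ A ∧ posa j = n))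
      ⟨by simp [Op.push_apply, initStore]; rfl, by simp [Op.push_apply, initStore]; rfl,
        by simp [Op.push_apply, initStore], by simp [Op.push_apply, initStore],
        by simp [Op.push_apply, initStore]⟩ (by
        rintro i σ ⟨h1, h2, h3, h4, h5⟩
        obtain ⟨σ', e, k1, k2, k3, k4, k5⟩ := hel A σ i h1 h2
        refine ⟨σ', e, k1, k2, ?_, by rw [k4, h4], fun n => ?_⟩
        · rw [k3, h3]; funext n; exact congrArg x (by omega)
        · rw [k5, exists_lt_succ_or, ← h5, h3]
          simp [or_assoc])
    -- Two steps, the sequencing and the push that sets the flag, precede the loading loop.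
    obtain ⟨g1, -, -, -, g5, g6⟩ := stage_loop (W := W) (x := x) (A := A) (a := 0) hcl 2
      (by rw [hst0, hσ0]; rfl) (by
        rw [hσ0, Op.push_apply, Function.update_self]; rfl) fun i => (hσ i).1
    have hθ0 : θ 0 = 0 + Ordinal.omega0 := by simp [θ]
    refine ⟨fun k => ?_, ⟨?_, fun n => ?_⟩⟩
    · rcases lt_or_ge k 2 with h | h
      · have : W.stage A x k = (wstep A)^[k] (W.stage A x 0) := by
          rw [← stage_add_nat, zero_add]
        rw [this, hst0]
        interval_cases k <;> rfl
      · simpa using g1 k h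
    · funext n
      rw [Bool.eq_iff_iff, hθ0, g5, hZ0]
      simp only [(hσ _).2.2.2.2.2]
      exact ⟨fun ⟨i, j, _, h⟩ => ⟨j, h⟩, fun ⟨j, h⟩ => ⟨j + 1, j, j.lt_succ_self, h⟩⟩
    · rw [hθ0, g6]
      simp only [(hσ _).2.2.2.2.1]
      simp [Out]
  obtain ⟨load1, load2⟩ := load
  -- Within the block from `θ γ` to `θ (γ + 1)`, track `1` shows only bits of `Z γ` or `Z (γ + 1)`,
  -- and the output lies between its values at the two ends. So a limit of blocks shows the limit
  -- superior of the arrays and the union of the outputs.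
  have block : ∀ γ, Good γ → Z γ 0 = false →
      (∀ k : ℕ, Cmd.stops (W.stage A x (θ γ + k)).1 = false ∧
        (∀ n, (W.stage A x (θ γ + k)).2 (.trk 1) n = true → Z γ n = true ∨ Z (γ + 1) n = true) ∧
        (∀ n, (W.stage A x (θ γ + k)).2 (.nat 1) n = true → Out (γ + 1) n) ∧
        (∀ n, Out γ n → (W.stage A x (θ γ + k)).2 (.nat 1) n = true)) ∧ Good (γ + 1) := by
    rintro γ ⟨h1, h2⟩ hz
    obtain ⟨τ, hτ⟩ : ∃ τ, W.stage A x (θ γ) = ([limitCmd cb], τ) := ⟨_, Prod.ext (θlim γ) rfl⟩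
    rw [hτ] at h1 h2
    simp only at h1 h2
    obtain ⟨s1, s2⟩ := limitCmd_steps (A := A) (c := cb) (τ := τ) (by rw [h1, hz])
    obtain ⟨l0, l1, l2, l3, l4⟩ := loopStore_spec τ
    obtain ⟨σ, hσ0, hσ⟩ := exists_store_seq (A := A) (c := cb) (σ₀ := loopStore τ)
      (I := fun i σ => σ (.trk 3) = natReal (loopState addr f0 f1 (Z γ) i) ∧
        σ (.trk 0) = Z γ ∧
        (∀ n, σ (.trk 1) n = true ↔ ∃ j < i, wr (loopState addr f0 f1 (Z γ) j) = n + 1) ∧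
        ∀ n, σ (.nat 1) n = true ↔
          Out γ n ∨ ∃ j < i, ow (loopState addr f0 f1 (Z γ) j) = n + 1)
      ⟨l3, by rw [l0, h1], fun n => by rw [l1]; simp [natReal], fun n => by rw [l4, h2]; simp⟩ (by
        rintro i σ ⟨k3, k0, k1, kn⟩
        obtain ⟨σ', e, j3, j1, jn⟩ := heb A σ _ k3
        refine ⟨σ', e, by rw [j3, k0]; rfl, ?_, fun n => ?_, fun n => ?_⟩
        · rw [← k0]
          exact (e.rel hcb LoopRel.refl LoopRel.trans fun o σ ho => ho σ).1
        · rw [j1, exists_lt_succ_or, ← k1]; simp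
        · rw [jn, exists_lt_succ_or, ← or_assoc, ← kn]; simp)
    obtain ⟨g1, g2, g3, g4, g5, g6⟩ := stage_loop (W := W) (x := x) (A := A) (a := θ γ) hcb 11
      (by rw [hτ, s2, hσ0]) (by rw [hσ0, l2]; rfl) fun i => (hσ i).1
    have u1 : ∀ n, (∃ i, σ i (.trk 1) n = true) ↔ Z (γ + 1) n = true := by
      intro n
      simp only [(hσ _).2.2.2.1, hZs]
      exact ⟨fun ⟨i, j, _, h⟩ => ⟨j, h⟩, fun ⟨j, h⟩ => ⟨j + 1, j, j.lt_succ_self, h⟩⟩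
    have u2 : ∀ n, (∃ i, σ i (.nat 1) n = true) ↔ Out (γ + 1) n := by
      intro n
      simp only [(hσ _).2.2.2.2, Out_succ]
      constructor
      · rintro ⟨i, h | ⟨j, _, h⟩⟩
        exacts [.inl h, .inr ⟨j, h⟩]
      · rintro (h | ⟨j, h⟩)
        exacts [⟨0, .inl h⟩, ⟨j + 1, .inr ⟨j, j.lt_succ_self, h⟩⟩]
    refine ⟨fun k => ?_, ?_, fun n => ?_⟩
    · rcases lt_or_ge k 11 with hk | hk
      · rw [stage_add_nat, hτ]
        obtain ⟨q1, q2, q3⟩ := s1 k hk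
        refine ⟨q1, fun n hn => .inl (by rw [← h1]; exact q2 n hn), fun n hn => ?_, fun n hn => ?_⟩
        · rw [q3, h2] at hn
          exact Out_mono le_self_add hn
        · rw [q3, h2]; exact hn
      · refine ⟨g1 k hk, fun n hn => .inr ((u1 n).1 (g2 k n hk hn)),
          fun n hn => (u2 n).1 (g3 k n hk hn), fun n hn => g4 k n hk ?_⟩
        rw [hσ0, l4, h2]; exact hn
    · funext n
      rw [Bool.eq_iff_iff, θs, g5, u1]
    · rw [θs, g6, u2]
  have split : ∀ {l t : Ordinal.{0}}, t < θ l →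
      (∃ k : ℕ, t = k) ∨ ∃ γ < l, ∃ k : ℕ, t = θ γ + k := by
    intro l t ht
    obtain ⟨δ, hδ, k, rfl⟩ := exists_omega0_mul_add ht
    rcases lt_or_ge δ 1 with h | h
    · rw [Order.lt_one_iff] at h
      subst h
      exact .inl ⟨k, by simp⟩
    · refine .inr ⟨δ - 1, ?_, k, ?_⟩
      · rwa [← add_lt_add_iff_left 1, Ordinal.add_sub_cancel_of_le h]
      · simp only [θ, Ordinal.add_sub_cancel_of_le h]
  have θmono : StrictMono θ := fun a b h =>
    (Ordinal.isNormal_mul_right hω).strictMono ((add_lt_add_iff_left 1).2 h)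
  have θnat : ∀ β (k : ℕ), (k : Ordinal) < θ β := fun β k =>
    (Ordinal.natCast_lt_omega0 k).trans_le (by simp [θ, mul_add])
  have θadd : ∀ {γ l : Ordinal.{0}} (k : ℕ), γ < l → θ γ + k < θ l := fun {γ l} k h => by
    refine lt_of_lt_of_le ?_ (θmono.monotone (Order.add_one_le_of_lt h))
    rw [θs]
    exact (add_lt_add_iff_left _).2 (Ordinal.natCast_lt_omega0 k)
  have good : ∀ l ≤ β, Good l := by
    intro l
    induction l using WellFoundedLT.induction with
    | ind l ih =>
    intro hl
    rcases Ordinal.zero_or_succ_or_isSuccLimit l with rfl | ⟨γ, rfl⟩ | hlim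
    · exact load2
    · have hγ := Order.lt_succ γ
      rw [Order.succ_eq_add_one]
      exact (block γ (ih γ hγ (hγ.le.trans hl)) (hβ0 γ (hγ.trans_le hl))).2
    · have B := fun γ (hγ : γ < l) => block γ (ih γ hγ (hγ.le.trans hl)) (hβ0 γ (hγ.trans_le hl))
      have hθl : Order.IsSuccLimit (θ l) :=
        Ordinal.isSuccLimit_mul_right hω (Ordinal.isSuccLimit_add _ hlim)
      have hcof : ∀ t < θ l, ∃ γ < l, t ≤ θ γ := by
        intro t ht
        rcases split ht with ⟨k, rfl⟩ | ⟨γ, hγ, k, rfl⟩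
        · exact ⟨0, hlim.bot_lt, (θnat 0 k).le⟩
        · exact ⟨γ + 1, hlim.add_one_lt hγ, (θadd k (lt_add_one γ)).le⟩
      have hsplit : ∀ {γ t}, t < θ l → θ γ ≤ t → ∃ δ < l, γ ≤ δ ∧ ∃ k : ℕ, t = θ δ + k := by
        intro γ t ht hle
        rcases split ht with ⟨k, rfl⟩ | ⟨δ, hδ, k, rfl⟩
        · exact absurd (θnat γ k) (not_lt.2 hle)
        · refine ⟨δ, hδ, ?_, k, rfl⟩
          by_contra hlt
          exact absurd (θadd k (not_le.1 hlt)) (not_lt.2 hle)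
      constructor
      · funext n
        rw [Bool.eq_iff_iff, Control.stage, wrun_limit_snd _ _ _ _ hθl, hZl l hlim]
        constructor
        · intro H γ hγ
          obtain ⟨t, ht, hle, h⟩ := H (θ γ) (θmono hγ)
          obtain ⟨δ, hδ, hγδ, k, rfl⟩ := hsplit ht hle
          rcases ((B δ hδ).1 k).2.1 n h with h | h
          exacts [⟨δ, hδ, hγδ, h⟩, ⟨δ + 1, hlim.add_one_lt hδ, hγδ.trans le_self_add, h⟩]
        · intro H t ht
          obtain ⟨γ, hγ, hle⟩ := hcof t ht
          obtain ⟨δ, hδ, hγδ, h⟩ := H γ hγ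
          refine ⟨θ δ, θmono hδ, hle.trans (θmono.monotone hγδ), ?_⟩
          have := (ih δ hδ (hδ.le.trans hl)).1
          rw [Control.stage] at this
          rw [this, h]
      · intro n
        rw [Control.stage, wrun_limit_snd _ _ _ _ hθl]
        constructor
        · intro H
          obtain ⟨t, ht, hle, h⟩ := H (θ 0) (θmono hlim.bot_lt)
          obtain ⟨δ, hδ, -, k, rfl⟩ := hsplit ht hle
          exact Out_mono (Order.add_one_le_of_lt hδ) (((B δ hδ).1 k).2.2.1 n h)
        · rintro ⟨ε, hε, hout⟩ t ht
          obtain ⟨γ, hγ, hle⟩ := hcof t ht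
          have hm : max γ (ε + 1) < l := max_lt hγ (hlim.add_one_lt hε)
          refine ⟨θ (max γ (ε + 1)), θmono hm, hle.trans (θmono.monotone (le_max_left _ _)), ?_⟩
          exact ((ih _ hm (hm.le.trans hl)).2 n).2
            ⟨ε, (lt_add_one ε).trans_le (le_max_right _ _), hout⟩
  obtain ⟨hg1, hg2⟩ := good β le_rfl
  obtain ⟨τ, hτ⟩ : ∃ τ, W.stage A x (θ β) = ([limitCmd cb], τ) := ⟨_, Prod.ext (θlim β) rfl⟩
  rw [hτ] at hg1 hg2
  simp only at hg1 hg2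
  obtain ⟨s1, s2, s3⟩ := limitCmd_stops (A := A) (c := cb) (τ := τ) (by rw [hg1, hβ1])
  have hy' : y = (W.stage A x (θ β + (3 : ℕ))).2 (.nat 1) := by
    rw [stage_add_nat, hτ, s3]
    funext n
    rw [Bool.eq_iff_iff, hy, hg2]
  rw [hy']
  refine W.yields (fun t ht => ?_) (by rw [stage_add_nat, hτ, s2])
  rcases lt_or_ge t (θ β) with h | h
  · rcases split h with ⟨k, rfl⟩ | ⟨γ, hγ, k, rfl⟩
    · exact load1 k
    · exact ((block γ (good γ hγ.le) (hβ0 γ hγ)).1 k).1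
  · obtain ⟨k, rfl⟩ := exists_add_nat h (ht.trans_le (by gcongr; exact (Ordinal.natCast_lt_omega0 _).le))
    rw [stage_add_nat, hτ]
    exact s1 k (by exact_mod_cast (add_lt_add_iff_left _).1 ht)

end ITTM

namespace ITTM

/-! ### Rules

A transformation of arrays of bits that is given by a recursively enumerable list of rules, each of
which inspects finitely many cells. -/

abbrev Cell : Type := ℕ × ℕ × ℕ × ℕ

/-- `φ Z a` is witnessed by finitely many bits of `Z`, effectively in `a`. -/
def Sig {γ α : Type} [Primcodable γ] [Primcodable α] (φ : (γ → Bool) → α → Prop) : Prop :=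
  ∃ ρ : α → ℕ → Option (List (γ × Bool)), Primrec₂ ρ ∧
    ∀ Z a, φ Z a ↔ ∃ i L, ρ a i = some L ∧ ∀ l ∈ L, Z l.1 = l.2

namespace Sig

variable {γ δ α β : Type} [Primcodable γ] [Primcodable δ] [Primcodable α] [Primcodable β]
  {φ ψ : (γ → Bool) → α → Prop}

theorem congr (h : Sig φ) (h' : ∀ Z a, ψ Z a ↔ φ Z a) : Sig ψ := by
  obtain ⟨ρ, hρ, H⟩ := h
  exact ⟨ρ, hρ, fun Z a => (h' Z a).trans (H Z a)⟩

theorem comp (h : Sig φ) {f : β → α} (hf : Primrec f) : Sig fun Z b => φ Z (f b) := by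
  obtain ⟨ρ, hρ, H⟩ := h
  exact ⟨fun b i => ρ (f b) i, hρ.comp (hf.comp .fst) .snd, fun Z b => H Z (f b)⟩

theorem lit {c : α → γ} (hc : Primrec c) (b : Bool) : Sig fun (Z : γ → Bool) a => Z (c a) = b :=
  ⟨fun a _ => some [(c a, b)], Primrec.option_some.comp
    (Primrec.list_cons.comp ((hc.comp .fst).pair (.const b)) (.const [])), fun Z a => by
      simp only [Option.some.injEq, exists_eq_left', List.forall_mem_singleton, exists_const]⟩

theorem of_primrecPred {p : α → Prop} (hp : PrimrecPred p) : Sig fun (_ : γ → Bool) a => p a := by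
  obtain ⟨hd, hp⟩ := hp
  refine ⟨fun a _ => if p a then some [] else none,
    Primrec.ite (c := fun x : α × ℕ => p x.1) ⟨fun x => hd x.1, hp.comp .fst⟩ (.const _) (.const _),
    fun Z a => ?_⟩
  by_cases h : p a <;> simp [h]

theorem and (h : Sig φ) (h' : Sig ψ) : Sig fun Z a => φ Z a ∧ ψ Z a := by
  obtain ⟨ρ, hρ, H⟩ := h
  obtain ⟨ρ', hρ', H'⟩ := h'
  refine ⟨fun a i => (ρ a i.unpair.1).bind fun L => (ρ' a i.unpair.2).map fun L' => L ++ L', ?_,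
    fun Z a => ?_⟩
  · have h1 : Primrec fun x : α × ℕ => ρ x.1 x.2.unpair.1 :=
      hρ.comp .fst ((Primrec.fst.comp .unpair).comp .snd)
    have h2 : Primrec fun x : α × ℕ => ρ' x.1 x.2.unpair.2 :=
      hρ'.comp .fst ((Primrec.snd.comp .unpair).comp .snd)
    exact Primrec.option_bind h1 (Primrec.option_map (h2.comp .fst)
      (Primrec.list_append.comp (.comp .snd .fst) .snd))
  · simp only [H, H']
    constructor
    · rintro ⟨⟨i, L, h1, h2⟩, j, L', h3, h4⟩
      refine ⟨Nat.pair i j, L ++ L', by simp [h1, h3], fun l hl => ?_⟩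
      exact (List.mem_append.1 hl).elim (h2 l) (h4 l)
    · rintro ⟨i, L, h1, h2⟩
      simp only [Option.bind_eq_some_iff, Option.map_eq_some_iff] at h1
      obtain ⟨L₁, h3, L₂, h4, rfl⟩ := h1
      exact ⟨⟨_, _, h3, fun l hl => h2 l (List.mem_append_left _ hl)⟩,
        _, _, h4, fun l hl => h2 l (List.mem_append_right _ hl)⟩

theorem or (h : Sig φ) (h' : Sig ψ) : Sig fun Z a => φ Z a ∨ ψ Z a := by
  obtain ⟨ρ, hρ, H⟩ := h
  obtain ⟨ρ', hρ', H'⟩ := h'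
  refine ⟨fun a i => if i.unpair.1 = 0 then ρ a i.unpair.2 else ρ' a i.unpair.2, ?_, fun Z a => ?_⟩
  · have h1 : Primrec fun x : α × ℕ => x.2.unpair.1 := (Primrec.fst.comp .unpair).comp .snd
    have h2 : Primrec fun x : α × ℕ => x.2.unpair.2 := (Primrec.snd.comp .unpair).comp .snd
    exact Primrec.ite (Primrec.eq.comp h1 (.const 0)) (hρ.comp .fst h2) (hρ'.comp .fst h2)
  · simp only [H, H']
    constructor
    · rintro (⟨i, L, h1, h2⟩ | ⟨i, L, h1, h2⟩)
      exacts [⟨Nat.pair 0 i, L, by simp [h1], h2⟩, ⟨Nat.pair 1 i, L, by simp [h1], h2⟩]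
    · rintro ⟨i, L, h1, h2⟩
      split_ifs at h1
      exacts [.inl ⟨_, _, h1, h2⟩, .inr ⟨_, _, h1, h2⟩]

/-- The witness becomes part of the index `i` of the rule. A negated existential statement cannot be
treated in this way; the two phases below are there for it. -/
theorem ex {φ : (γ → Bool) → α × β → Prop} (h : Sig φ) : Sig fun Z a => ∃ b, φ Z (a, b) := by
  obtain ⟨ρ, hρ, H⟩ := h
  refine ⟨fun a i => (Encodable.decode (α := β) i.unpair.1).bind fun b => ρ (a, b) i.unpair.2, ?_,
    fun Z a => ?_⟩
  · have h1 : Primrec fun x : α × ℕ => Encodable.decode (α := β) x.2.unpair.1 :=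
      Primrec.decode.comp ((Primrec.fst.comp .unpair).comp .snd)
    exact Primrec.option_bind h1 (hρ.comp (.pair (.comp .fst .fst) .snd)
      ((Primrec.snd.comp .unpair).comp (.comp .snd .fst)))
  · simp only [H]
    constructor
    · rintro ⟨b, i, L, h1, h2⟩
      exact ⟨Nat.pair (Encodable.encode b) i, L, by simp [h1], h2⟩
    · rintro ⟨i, L, h1, h2⟩
      simp only [Option.bind_eq_some_iff] at h1
      obtain ⟨b, -, h3⟩ := h1
      exact ⟨b, _, L, h3, h2⟩

theorem sum {ψ : (γ → Bool) → β → Prop} (h : Sig φ) (h' : Sig ψ) :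
    Sig fun Z (x : α ⊕ β) => Sum.elim (φ Z) (ψ Z) x := by
  obtain ⟨ρ, hρ, H⟩ := h
  obtain ⟨ρ', hρ', H'⟩ := h'
  refine ⟨fun x i => Sum.casesOn (motive := fun _ => Option (List (γ × Bool))) x
    (fun a => ρ a i) fun b => ρ' b i, ?_, fun Z x => ?_⟩
  · exact Primrec.sumCasesOn Primrec.fst (hρ.comp .snd (Primrec.snd.comp .fst))
      (hρ'.comp .snd (Primrec.snd.comp .fst))
  · cases x
    exacts [H _ _, H' _ _]

/-- Arrays contained in larger arrays. -/
theorem pull (h : Sig φ) {e : γ → δ} (he : Primrec e) :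
    Sig fun (Z : δ → Bool) a => φ (Z ∘ e) a := by
  obtain ⟨ρ, hρ, H⟩ := h
  refine ⟨fun a i => (ρ a i).map fun L => L.map fun l => (e l.1, l.2), ?_, fun Z a => ?_⟩
  · exact Primrec.option_map hρ (Primrec.list_map .snd
      (Primrec.pair (he.comp (Primrec.fst.comp .snd)) (Primrec.snd.comp .snd)))
  · simp only [H, Option.map_eq_some_iff]
    refine exists_congr fun i => ⟨?_, ?_⟩
    · rintro ⟨L, h1, h2⟩
      refine ⟨_, ⟨L, h1, rfl⟩, fun l hl => ?_⟩
      obtain ⟨l', h3, rfl⟩ := List.mem_map.1 hl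
      exact h2 l' h3
    · rintro ⟨_, ⟨L, h1, rfl⟩, h2⟩
      exact ⟨L, h1, fun l hl => h2 _ (List.mem_map_of_mem hl)⟩

end Sig

/-! ### The machine that applies rules -/

open scoped Classical in
/-- Iterating a transformation; at limit stages the limit superior is taken. -/
noncomputable def cellRun (T : (Cell → Bool) → Cell → Prop) (Z : Cell → Bool) (β : Ordinal.{0}) :
    Cell → Bool :=
  Ordinal.limitRecOn β Z (fun _ Z c => decide (T Z c)) fun l _ Z c =>
    decide (∀ β < l, ∃ γ, ∃ h : γ < l, β ≤ γ ∧ Z γ h c = true)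

section cellRun

variable (T : (Cell → Bool) → Cell → Prop) (Z : Cell → Bool)

theorem cellRun_zero : cellRun T Z 0 = Z := Ordinal.limitRecOn_zero ..

theorem cellRun_add_one (β : Ordinal.{0}) (c : Cell) :
    cellRun T Z (β + 1) c = true ↔ T (cellRun T Z β) c := by
  classical
  unfold cellRun
  rw [Ordinal.limitRecOn_add_one]
  exact decide_eq_true_iff

theorem cellRun_limit {l : Ordinal.{0}} (hl : Order.IsSuccLimit l) (c : Cell) :
    cellRun T Z l c = true ↔ ∀ β < l, ∃ γ < l, β ≤ γ ∧ cellRun T Z γ c = true := by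
  unfold cellRun
  rw [Ordinal.limitRecOn_limit _ _ _ _ hl]
  simp only [decide_eq_true_eq, exists_prop, and_left_comm]

end cellRun

namespace RuleMachine

variable (ρ : Cell → ℕ → Option (List (Cell × Bool)))

/-- A number codes a cell together with an index into the rules for that cell. -/
def rule (i : ℕ) : Option (List (Cell × Bool)) :=
  ρ (Denumerable.ofNat (Cell × ℕ) i).1 (Denumerable.ofNat (Cell × ℕ) i).2

def target (i : ℕ) : Cell := (Denumerable.ofNat (Cell × ℕ) i).1

def literal (s : ℕ) : Option (Cell × Bool) := (rule ρ s.unpair.1).bind fun L => L[s.unpair.2]?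

def addr (s : ℕ) : ℕ := ((literal ρ s).map fun l => Encodable.encode l.1).getD 0

/-- In state `Nat.pair i j` the literal `j` of rule `i` is inspected. If the bit `b` found agrees
with it, the next literal follows; otherwise, and also when there is no literal `j`, the search
passes to the next rule. -/
def go (b : Bool) (s : ℕ) : ℕ :=
  if (literal ρ s).map Prod.snd = some b then Nat.pair s.unpair.1 (s.unpair.2 + 1)
  else Nat.pair (s.unpair.1 + 1) 0

def fires (s : ℕ) : Prop := (rule ρ s.unpair.1).map List.length = some s.unpair.2

instance : DecidablePred (fires ρ) := fun s => by unfold fires; infer_instance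

def wr (s : ℕ) : ℕ := if fires ρ s then Encodable.encode (target s.unpair.1) + 1 else 0

def ow (s : ℕ) : ℕ :=
  if fires ρ s ∧ target s.unpair.1 = (1, (target s.unpair.1).2.1, 0, 0) then
    (target s.unpair.1).2.1 + 1 else 0

variable {ρ} (hρ : Primrec₂ ρ)

include hρ in
theorem primrec_rule : Primrec (rule ρ) :=
  hρ.comp (.comp .fst (.ofNat _)) (.comp .snd (.ofNat _))

theorem primrec_target : Primrec target := Primrec.fst.comp (.ofNat _)

theorem primrec_fst : Primrec fun s : ℕ => s.unpair.1 := .comp .fst .unpair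

theorem primrec_snd : Primrec fun s : ℕ => s.unpair.2 := .comp .snd .unpair

include hρ in
theorem primrec_literal : Primrec (literal ρ) :=
  Primrec.option_bind ((primrec_rule hρ).comp primrec_fst)
    (Primrec.list_getElem?.comp .snd (primrec_snd.comp .fst))

include hρ in
theorem primrec_addr : Primrec (addr ρ) :=
  Primrec.option_getD.comp (Primrec.option_map (primrec_literal hρ)
    (Primrec.encode.comp (.comp .fst .snd))) (.const 0)

include hρ in
theorem primrec_go (b : Bool) : Primrec (go ρ b) :=
  Primrec.ite (Primrec.eq.comp (Primrec.option_map (primrec_literal hρ) (Primrec.snd.comp .snd))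
    (.const _)) (Primrec₂.natPair.comp primrec_fst (Primrec.succ.comp primrec_snd))
    (Primrec₂.natPair.comp (Primrec.succ.comp primrec_fst) (.const 0))

include hρ in
theorem primrecPred_fires : PrimrecPred (fires ρ) :=
  Primrec.eq.comp (Primrec.option_map ((primrec_rule hρ).comp primrec_fst)
    (Primrec.list_length.comp .snd)) (Primrec.option_some.comp primrec_snd)

include hρ in
theorem primrec_wr : Primrec (wr ρ) :=
  Primrec.ite (primrecPred_fires hρ)
    (Primrec.succ.comp (Primrec.encode.comp (primrec_target.comp primrec_fst))) (.const 0)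

include hρ in
theorem primrec_ow : Primrec (ow ρ) := by
  have h : Primrec fun s : ℕ => (target s.unpair.1).2.1 :=
    .comp .fst (.comp .snd (primrec_target.comp primrec_fst))
  exact Primrec.ite ((primrecPred_fires hρ).and (Primrec.eq.comp (primrec_target.comp primrec_fst)
    (.pair (.const 1) (.pair h (.const (0, 0)))))) (Primrec.succ.comp h) (.const 0)

-- All lists are finite, so the search leaves each rule and reaches every other. It arrives at the
-- end of the list of rule `i`, where the rule fires, exactly if no literal has failed.
variable (ρ) in
theorem exists_fires_iff {X : CReal} {Z : Cell → Bool} (hX : ∀ c, X (Encodable.encode c) = Z c)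
    (i : ℕ) : (∃ t, (loopState (addr ρ) (go ρ false) (go ρ true) X t).unpair.1 = i ∧
      fires ρ (loopState (addr ρ) (go ρ false) (go ρ true) X t)) ↔
      ∃ L, rule ρ i = some L ∧ ∀ l ∈ L, Z l.1 = l.2 := by
  set st := loopState (addr ρ) (go ρ false) (go ρ true) X
  have hlit : ∀ i j L, rule ρ i = some L → ∀ h : j < L.length,
      literal ρ (Nat.pair i j) = some L[j] := by
    intro i j L hL h
    simp [literal, hL, h]
  have hnext : ∀ t i j, st t = Nat.pair i j →
      st (t + 1) = Nat.pair (i + 1) 0 ∨ st (t + 1) = Nat.pair i (j + 1) ∧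
        ∃ L, rule ρ i = some L ∧ ∃ h : j < L.length, Z L[j].1 = L[j].2 := by
    intro t i j ht
    change (bif X (addr ρ (st t)) then go ρ true (st t) else go ρ false (st t)) = _ ∨
      (bif X (addr ρ (st t)) then go ρ true (st t) else go ρ false (st t)) = _ ∧ _
    rw [ht]
    have hgo : ∀ b, go ρ b (Nat.pair i j) = if (literal ρ (Nat.pair i j)).map Prod.snd = some b
        then Nat.pair i (j + 1) else Nat.pair (i + 1) 0 := fun b => by simp [go]
    have hbif : ∀ b, (bif b then go ρ true (Nat.pair i j) else go ρ false (Nat.pair i j)) =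
        go ρ b (Nat.pair i j) := fun b => by cases b <;> rfl
    rw [hbif, hgo]
    split_ifs with h
    · right
      refine ⟨rfl, ?_⟩
      cases hL : rule ρ i with
      | none => simp [literal, hL] at h
      | some L =>
        have hj : j < L.length := by
          by_contra hj
          simp [literal, hL, List.getElem?_eq_none (not_lt.1 hj)] at h
        refine ⟨L, rfl, hj, ?_⟩
        rw [hlit i j L hL hj] at h
        simp only [Option.map_some, Option.some.injEq, addr, hlit i j L hL hj, Option.getD_some,
          hX] at h
        exact h.symm
    · exact .inl rfl
  have inv : ∀ t i j, st t = Nat.pair i j → ∀ L, rule ρ i = some L →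
      ∀ k < j, ∃ h : k < L.length, Z L[k].1 = L[k].2 := by
    intro t
    induction t with
    | zero =>
      intro i j h L _ k hk
      have : Nat.pair 0 0 = Nat.pair i j := h
      rw [Nat.pair_eq_pair] at this
      omega
    | succ t ih =>
      intro i j h L hL k hk
      obtain ⟨i', j', h'⟩ : ∃ i' j', st t = Nat.pair i' j' := ⟨_, _, (Nat.pair_unpair _).symm⟩
      rcases hnext t i' j' h' with h1 | ⟨h1, L', hL', hj, hz⟩
      · rw [h, Nat.pair_eq_pair] at h1
        omega
      · rw [h, Nat.pair_eq_pair] at h1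
        obtain ⟨rfl, rfl⟩ := h1
        rw [hL] at hL'
        cases hL'
        rcases Nat.lt_succ_iff_lt_or_eq.1 hk with hk | rfl
        exacts [ih _ _ h' L hL k hk, ⟨hj, hz⟩]
  -- Here `n` bounds the number of literals of rule `i` still to be inspected.
  have hrow : ∀ n t i j, st t = Nat.pair i j → ((rule ρ i).getD []).length ≤ j + n →
      ∃ t', st t' = Nat.pair (i + 1) 0 := by
    intro n
    induction n with
    | zero =>
      intro t i j h hn
      rcases hnext t i j h with h1 | ⟨h1, L, hL, hj, hz⟩
      · exact ⟨_, h1⟩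
      · rw [hL, Option.getD_some] at hn
        omega
    | succ n ih =>
      intro t i j h hn
      rcases hnext t i j h with h1 | ⟨h1, -⟩
      · exact ⟨_, h1⟩
      · exact ih _ _ _ h1 (by omega)
  have hreach : ∀ i, ∃ t, st t = Nat.pair i 0 := by
    intro i
    induction i with
    | zero => exact ⟨0, rfl⟩
    | succ i ih =>
      obtain ⟨t, ht⟩ := ih
      exact hrow _ t i 0 ht (by rw [zero_add])
  constructor
  · rintro ⟨t, rfl, ht⟩
    unfold fires at ht
    rw [Option.map_eq_some_iff] at ht
    obtain ⟨L, hL, hlen⟩ := ht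
    refine ⟨L, hL, fun l hl => ?_⟩
    obtain ⟨k, hk, rfl⟩ := List.mem_iff_getElem.1 hl
    exact (inv t _ _ (Nat.pair_unpair _).symm L hL k (hlen ▸ hk)).2
  · rintro ⟨L, hL, hz⟩
    have : ∀ j ≤ L.length, ∃ t, st t = Nat.pair i j := by
      intro j
      induction j with
      | zero => exact fun _ => hreach i
      | succ j ih =>
        intro hj
        obtain ⟨t, ht⟩ := ih (by omega)
        refine ⟨t + 1, ?_⟩
        change (bif X (addr ρ (st t)) then go ρ true (st t) else go ρ false (st t)) = _
        have hl := hlit i j L hL hj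
        have hx : X (addr ρ (st t)) = L[j].2 := by
          rw [ht, addr, hl, Option.map_some, Option.getD_some, hX, hz _ (List.getElem_mem hj)]
        rw [hx, ht]
        cases hb : L[j].2 <;> simp [go, hl, hb]
    obtain ⟨t, ht⟩ := this _ le_rfl
    exact ⟨t, by rw [ht]; simp, by rw [ht]; simp [fires, hL]⟩

end RuleMachine

/-- The contents of the array at the beginning of the computation on input `x` with oracle `A`. -/
def Loaded (A : Set CReal) (x : CReal) (Z : Cell → Bool) : Prop :=
  ∀ c, Z c = true ↔ ∃ j, (c = (2, j, 0, 0) ∧ x j = true) ∨ (c = (3, j, 0, 0) ∧ natReal j ∈ A)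

/-- The cells `(0, 0, 0, 0)` and `(1, n, 0, 0)` are reserved for halting and for printing `n`.
Printing happens when a cell is written, hence the successor stages in the description of `y`. -/
theorem exists_rule_program {T : (Cell → Bool) → Cell → Prop} (hT : Sig T) :
    ∃ P : Program, ∀ (A : Set CReal) (x : CReal) (Z : Cell → Bool), Loaded A x Z →
      ∀ β (y : CReal), (∀ γ < β, cellRun T Z γ (0, 0, 0, 0) = false) →
        cellRun T Z β (0, 0, 0, 0) = true →
        (∀ n, y n = true ↔ ∃ γ < β, cellRun T Z (γ + 1) (1, n, 0, 0) = true) →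
        Yields A P x y := by
  obtain ⟨ρ, hρ, H⟩ := hT
  have hpos : ∀ k, Primrec fun j : ℕ => Encodable.encode ((k, j, 0, 0) : Cell) := fun k =>
    Primrec.encode.comp (.pair (.const k) (.pair .id (.const (0, 0))))
  obtain ⟨P, hP⟩ := exists_loop_program (RuleMachine.primrec_addr hρ)
    (RuleMachine.primrec_go hρ false) (RuleMachine.primrec_go hρ true) (RuleMachine.primrec_wr hρ)
    (RuleMachine.primrec_ow hρ) (hpos 2) (hpos 3)
  refine ⟨P, fun A x Z hZ β y h1 h2 hy => ?_⟩
  let X : Ordinal.{0} → CReal := fun β n => cellRun T Z β (Denumerable.ofNat Cell n)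
  have hX : ∀ β c, X β (Encodable.encode c) = cellRun T Z β c := fun β c => by
    simp only [X, Denumerable.ofNat_encode]
  have hX' : ∀ β n, X β n = cellRun T Z β (Denumerable.ofNat Cell n) := fun β c => rfl
  have hstep : ∀ β (c : Cell), cellRun T Z (β + 1) c = true ↔
      ∃ t, RuleMachine.target (loopState (RuleMachine.addr ρ) (RuleMachine.go ρ false)
        (RuleMachine.go ρ true) (X β) t).unpair.1 = c ∧
        RuleMachine.fires ρ (loopState (RuleMachine.addr ρ) (RuleMachine.go ρ false)
        (RuleMachine.go ρ true) (X β) t) := by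
    intro β c
    have hiff := fun i => RuleMachine.exists_fires_iff ρ (hX β) i
    rw [cellRun_add_one, H]
    constructor
    · rintro ⟨k, L, h3, h4⟩
      obtain ⟨t, ht, hf⟩ := (hiff (Encodable.encode (c, k))).2 ⟨L, by
        rw [RuleMachine.rule, Denumerable.ofNat_encode]; exact h3, h4⟩
      exact ⟨t, by rw [ht, RuleMachine.target, Denumerable.ofNat_encode], hf⟩
    · rintro ⟨t, rfl, hf⟩
      obtain ⟨L, h3, h4⟩ := (hiff _).1 ⟨t, rfl, hf⟩
      exact ⟨_, L, h3, h4⟩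
  have henc : ∀ n (c : Cell), Denumerable.ofNat Cell n = c ↔ Encodable.encode c = n := fun n c =>
    ⟨fun h => by rw [← h, Denumerable.encode_ofNat], fun h => by rw [← h, Denumerable.ofNat_encode]⟩
  -- The loop program tests bit `0` of the array for halting; it must be the code of the halting
  -- cell.
  have henc0 : Encodable.encode ((0, 0, 0, 0) : Cell) = 0 := rfl
  refine hP A x X (fun n => ?_) (fun β n => ?_) (fun l hl n => ?_) β y (fun γ hγ => ?_) ?_
    fun n => ?_
  · rw [hX', cellRun_zero, hZ]
    refine exists_congr fun j => ?_
    rw [henc, henc]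
    exact or_congr and_comm and_comm
  · rw [hX', hstep]
    refine exists_congr fun t => ?_
    unfold RuleMachine.wr
    split_ifs with hf
    · simp only [hf, and_true, Nat.add_right_cancel_iff]
      exact eq_comm.trans (henc _ _)
    · simp [hf]
  · simp only [hX']
    exact cellRun_limit T Z hl _
  · rw [← henc0, hX, h1 γ hγ]
  · rw [← henc0, hX, h2]
  · rw [hy]
    refine exists_congr fun γ => and_congr_right fun hγ => ?_
    rw [hstep]
    refine exists_congr fun t => ?_
    unfold RuleMachine.ow
    split_ifs with hf
    · simp only [hf.1, and_true, Nat.add_right_cancel_iff]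
      constructor
      · intro h; rw [h]
      · intro h; rw [← h]; exact hf.2
    · rw [not_and] at hf
      simp only [iff_false, not_and]
      exact fun h1 h2 => hf h2 (by rw [h1])

end ITTM

/-! ### Conditions decided by finitely many bits, and two-phase transformations -/

namespace ITTM

/-- Both `φ` and its negation are witnessed by finitely many bits. -/
def SigDec {γ α : Type} [Primcodable γ] [Primcodable α] (φ : (γ → Bool) → α → Prop) : Prop :=
  Sig φ ∧ Sig fun Z a => ¬ φ Z a

namespace SigDec

variable {γ δ α β : Type} [Primcodable γ] [Primcodable δ] [Primcodable α] [Primcodable β]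
  {φ ψ : (γ → Bool) → α → Prop}

theorem lit {c : α → γ} (hc : Primrec c) : SigDec fun (Z : γ → Bool) a => Z (c a) = true :=
  ⟨.lit hc true, (Sig.lit hc false).congr fun Z a => by simp⟩

theorem of_primrecPred {p : α → Prop} (hp : PrimrecPred p) : SigDec fun (_ : γ → Bool) a => p a :=
  ⟨.of_primrecPred hp, .of_primrecPred hp.not⟩

theorem not (h : SigDec φ) : SigDec fun Z a => ¬ φ Z a :=
  ⟨h.2, h.1.congr fun _ _ => not_not⟩

theorem and (h : SigDec φ) (h' : SigDec ψ) : SigDec fun Z a => φ Z a ∧ ψ Z a :=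
  ⟨h.1.and h'.1, (h.2.or h'.2).congr fun _ _ => not_and_or⟩

theorem or (h : SigDec φ) (h' : SigDec ψ) : SigDec fun Z a => φ Z a ∨ ψ Z a :=
  ⟨h.1.or h'.1, (h.2.and h'.2).congr fun _ _ => not_or⟩

theorem pull (h : SigDec φ) {e : γ → δ} (he : Primrec e) :
    SigDec fun (Z : δ → Bool) a => φ (Z ∘ e) a := ⟨h.1.pull he, h.2.pull he⟩

end SigDec

/-! ### Transformations in two phases -/

section phase

variable {δ : Type} [Primcodable δ]

open scoped Classical in
/-- The transformation that first determines the truth values of `ψ`. -/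
noncomputable def phaseStep (ψ : (Cell → Bool) → δ → Prop)
    (φ : (Cell ⊕ δ → Bool) → Cell → Prop) (Z : Cell → Bool) (c : Cell) : Prop :=
  φ (Sum.elim Z fun w => decide (ψ Z w)) c

namespace Phase

def main (c : Cell) : Cell := (c.1, c.2.1, c.2.2.1, 2 * c.2.2.2)

abbrev flag : Cell := (0, 0, 0, 1)

abbrev started : Cell := (0, 0, 1, 1)

def aux (w : δ) : Cell := (1, Encodable.encode w, 0, 1)

def comb : Cell ⊕ δ → Cell := Sum.elim main aux

/-- The given array occupies the cells with even last coordinate. While `flag` is on, the bits of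
`ψ` are computed and the array is kept; while it is off, `φ` is applied. The cell `started` is off
only at stage `0`, where `flag` is off although the bits of `ψ` have not been computed. -/
def U (ψ : (Cell → Bool) → δ → Prop) (φ : (Cell ⊕ δ → Bool) → Cell → Prop) (X : Cell → Bool)
    (c : Cell) : Prop :=
  (c = flag ∧ X flag = false) ∨ c = started ∨
  (∃ w, c = aux w ∧ X flag = true ∧ ψ (X ∘ main) w) ∨
  ∃ c', c = main c' ∧ (((X flag = true ∨ X started = false) ∧ X (main c') = true) ∨
    X flag = false ∧ X started = true ∧ φ (X ∘ comb) c')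

theorem primrec_main : Primrec main :=
  .pair .fst (.pair (Primrec.fst.comp .snd) (.pair (Primrec.fst.comp (Primrec.snd.comp .snd))
    (Primrec.nat_mul.comp (.const 2) (Primrec.snd.comp (Primrec.snd.comp .snd)))))

theorem primrec_aux : Primrec (aux (δ := δ)) := .pair (.const 1) (.pair .encode (.const (0, 1)))

theorem primrec_comb : Primrec (comb (δ := δ)) :=
  (Primrec.sumCasesOn .id (primrec_main.comp .snd).to₂ (primrec_aux.comp .snd).to₂).of_eq
    fun x => by cases x <;> rfl

variable {ψ : (Cell → Bool) → δ → Prop} {φ : (Cell ⊕ δ → Bool) → Cell → Prop}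

theorem sig_U (hψ : Sig ψ) (hφ : Sig φ) : Sig (U ψ φ) := by
  have hf : SigDec fun (X : Cell → Bool) (_ : Cell × δ) => X flag = true := .lit (.const _)
  have hf' : SigDec fun (X : Cell → Bool) (_ : Cell × Cell) => X flag = true := .lit (.const _)
  have h1 : Sig fun (X : Cell → Bool) (x : Cell × δ) =>
      x.1 = aux x.2 ∧ X flag = true ∧ ψ (X ∘ main) x.2 :=
    .and (.of_primrecPred (p := fun x : Cell × δ => x.1 = aux x.2)
      (Primrec.eq.comp .fst (primrec_aux.comp .snd)))
      (.and hf.1 ((hψ.pull primrec_main).comp .snd))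
  have h2 : Sig fun (X : Cell → Bool) (x : Cell × Cell) =>
      x.1 = main x.2 ∧ (((X flag = true ∨ X started = false) ∧ X (main x.2) = true) ∨
        X flag = false ∧ X started = true ∧ φ (X ∘ comb) x.2) :=
    .and (.of_primrecPred (p := fun x : Cell × Cell => x.1 = main x.2)
      (Primrec.eq.comp .fst (primrec_main.comp .snd)))
      (.or (.and (.or hf'.1 (.lit (.const _) false)) (.lit (primrec_main.comp .snd) true))
        (.and (.lit (.const _) false) (.and (.lit (.const _) true)
          ((hφ.pull primrec_comb).comp .snd))))
  exact .or (.and (.of_primrecPred (Primrec.eq.comp .id (.const _))) (.lit (.const _) false))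
    (.or (.of_primrecPred (Primrec.eq.comp .id (.const _))) (.or h1.ex h2.ex))

theorem main_injective : Function.Injective main := by
  rintro ⟨a, b, c, d⟩ ⟨a', b', c', d'⟩ h
  simp only [main, Prod.mk.injEq] at h ⊢
  omega

theorem aux_injective : Function.Injective (aux (δ := δ)) := by
  intro w w' h
  simp only [aux, Prod.mk.injEq] at h
  exact Encodable.encode_injective h.2.1

theorem main_ne {a b c k : ℕ} (c' : Cell) : ((a, b, c, 2 * k + 1) : Cell) ≠ main c' := by
  intro h
  simp only [main, Prod.mk.injEq] at h
  omega

theorem U_flag (X : Cell → Bool) : U ψ φ X flag ↔ X flag = false := by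
  have h1 : ∀ w : δ, flag ≠ aux w := fun w h => by simp [aux] at h
  have h2 : ∀ c, flag ≠ main c := fun c => main_ne (k := 0) c
  simp [U, h1, h2]

theorem U_started (X : Cell → Bool) : U ψ φ X started := .inr (.inl rfl)

theorem U_aux (X : Cell → Bool) (w : δ) : U ψ φ X (aux w) ↔ X flag = true ∧ ψ (X ∘ main) w := by
  have h1 : aux w ≠ flag := fun h => by simp [aux] at h
  have h2 : aux w ≠ started := fun h => by simp [aux] at h
  have h3 : ∀ c, aux w ≠ main c := fun c => main_ne (k := 0) c
  simp [U, h1, h2, h3, aux_injective.eq_iff]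

theorem U_main (X : Cell → Bool) (c : Cell) : U ψ φ X (main c) ↔
    (((X flag = true ∨ X started = false) ∧ X (main c) = true) ∨
      X flag = false ∧ X started = true ∧ φ (X ∘ comb) c) := by
  have h1 : main c ≠ flag := (main_ne (k := 0) c).symm
  have h2 : main c ≠ started := (main_ne (k := 0) c).symm
  have h3 : ∀ w : δ, main c ≠ aux w := fun w => (main_ne (k := 0) c).symm
  simp [U, h1, h2, h3, main_injective.eq_iff]

end Phase

-- The gain over `exists_rule_program` is that `φ` may use the truth values of the existential
-- condition `ψ` both positively and negatively.
open Phase in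
theorem exists_phase_program {ψ : (Cell → Bool) → δ → Prop}
    {φ : (Cell ⊕ δ → Bool) → Cell → Prop} (hψ : Sig ψ) (hφ : Sig φ) :
    ∃ P : Program, ∀ (A : Set CReal) (x : CReal) (Z : Cell → Bool), Loaded A x Z →
      ∀ β (y : CReal), (∀ γ < β, cellRun (phaseStep ψ φ) Z γ (0, 0, 0, 0) = false) →
        cellRun (phaseStep ψ φ) Z β (0, 0, 0, 0) = true →
        (∀ n, y n = true ↔ ∃ γ ≤ β, cellRun (phaseStep ψ φ) Z γ (1, n, 0, 0) = true) →
        Yields A P x y := by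
  obtain ⟨P, hP⟩ := exists_rule_program (sig_U hψ hφ)
  refine ⟨P, fun A x Z hZ β y h1 h2 hy => ?_⟩
  set X := cellRun (U ψ φ) Z with hX
  set Y := cellRun (phaseStep ψ φ) Z with hY
  have hZ0 : ∀ c : Cell, c.1 < 2 → Z c = false := fun c hc => by
    rw [← Bool.not_eq_true, hZ]
    rintro ⟨j, ⟨rfl, -⟩ | ⟨rfl, -⟩⟩ <;> simp at hc
  have hX0 : X 0 = Z := cellRun_zero _ _
  -- The loaded cells have last coordinate `0` and are fixed by `main`.
  have hZm : Z ∘ main = Z := by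
    funext ⟨a, b, c, d⟩
    rw [Bool.eq_iff_iff, Function.comp_apply, hZ, hZ]
    simp [main]
  have first : X 1 flag = true ∧ X 1 started = true ∧ X 1 ∘ main = Z := by
    have h01 : (1 : Ordinal.{0}) = 0 + 1 := (zero_add 1).symm
    refine ⟨?_, ?_, ?_⟩
    · rw [h01, hX, cellRun_add_one, U_flag, ← hX, hX0, hZ0 _ (by simp)]
    · rw [h01, hX, cellRun_add_one]; exact U_started _
    · funext c
      rw [Bool.eq_iff_iff, Function.comp_apply, h01, hX, cellRun_add_one, U_main, ← hX, hX0,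
        hZ0 started (by simp), hZ0 flag (by simp)]
      simp [← congrFun hZm c]
  -- One preliminary stage, then two stages for each step. At limits the alternating `flag` has
  -- limit superior `1`, so every limit begins with the computation of the auxiliary bits.
  let κ : Ordinal.{0} → Ordinal.{0} := fun α => 1 + 2 * α
  have κs : ∀ α, κ (α + 1) = κ α + 1 + 1 := fun α => by
    simp only [κ, mul_add_one, add_assoc, one_add_one_eq_two]
  have κ0 : κ 0 = 0 + 1 := by simp [κ]
  have κmono : StrictMono κ := fun a b h =>
    (add_lt_add_iff_left 1).2 ((Ordinal.isNormal_mul_right two_pos).strictMono h)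
  have κadd : ∀ {a b}, a < b → κ a + 1 < κ b := fun {a b} h => by
    refine lt_of_lt_of_le ?_ (κmono.monotone (Order.add_one_le_of_lt h))
    rw [κs]; exact lt_add_one _
  have split : ∀ {l t}, t < κ l → t = 0 ∨ ∃ γ < l, t = κ γ ∨ t = κ γ + 1 := by
    intro l t ht
    rcases eq_or_ne t 0 with h | h
    · exact .inl h
    · right
      have h1 : 1 ≤ t := Order.one_le_iff_ne_zero.2 h
      obtain ⟨s, rfl⟩ : ∃ s, t = 1 + s := ⟨t - 1, (Ordinal.add_sub_cancel_of_le h1).symm⟩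
      have hs : s < 2 * l := (add_lt_add_iff_left 1).1 ht
      have hd : s / 2 < l := (Ordinal.lt_mul_iff_div_lt two_ne_zero).1 hs
      have hm : s % 2 < 2 := Ordinal.mod_lt s two_ne_zero
      refine ⟨s / 2, hd, ?_⟩
      have he := Ordinal.div_add_mod s 2
      rw [← one_add_one_eq_two, Order.lt_add_one_iff, Order.le_one_iff] at hm
      rw [← one_add_one_eq_two] at he
      rcases hm with hm | hm
      · left
        rw [hm, add_zero, one_add_one_eq_two] at he
        rw [show κ (s / 2) = 1 + 2 * (s / 2) from rfl, he]
      · right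
        rw [hm, one_add_one_eq_two] at he
        rw [show κ (s / 2) = 1 + 2 * (s / 2) from rfl, add_assoc, he]
  have second : ∀ {t}, X t flag = true → X t started = true →
      (X (t + 1) flag = false ∧ X (t + 1) started = true ∧ X (t + 1) ∘ main = X t ∘ main) ∧
      (X (t + 1 + 1) flag = true ∧ X (t + 1 + 1) started = true ∧
        ∀ c, (X (t + 1 + 1) ∘ main) c = true ↔ phaseStep ψ φ (X t ∘ main) c) := by
    intro t hf hs
    have g1 : X (t + 1) flag = false := by
      rw [← Bool.not_eq_true, hX, cellRun_add_one, U_flag, ← hX, hf]; simp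
    have g2 : ∀ t, X (t + 1) started = true := fun t => by
      rw [hX, cellRun_add_one]; exact U_started _
    have g3 : X (t + 1) ∘ main = X t ∘ main := by
      funext c
      rw [Bool.eq_iff_iff, Function.comp_apply, hX, cellRun_add_one, U_main, ← hX, hf]
      simp
    refine ⟨⟨g1, g2 t, g3⟩, ?_, g2 _, fun c => ?_⟩
    · rw [hX, cellRun_add_one, U_flag, ← hX, g1]
    · rw [Function.comp_apply, hX, cellRun_add_one, U_main, ← hX, g1, g2]
      have : X (t + 1) ∘ comb = Sum.elim (X t ∘ main) fun w => open scoped Classical in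
          decide (ψ (X t ∘ main) w) := by
        funext w
        rcases w with c | w
        · exact congrFun g3 c
        · rw [Bool.eq_iff_iff, Function.comp_apply]
          change X (t + 1) (aux w) = true ↔ _
          rw [hX, cellRun_add_one, U_aux, ← hX, hf]
          simp
      rw [this]
      simp [phaseStep]
  have good : ∀ α, X (κ α) flag = true ∧ X (κ α) started = true ∧ X (κ α) ∘ main = Y α := by
    intro α
    induction α using WellFoundedLT.induction with
    | ind α ih =>
    rcases Ordinal.zero_or_succ_or_isSuccLimit α with rfl | ⟨γ, rfl⟩ | hα
    · rw [κ0, zero_add, hY, cellRun_zero]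
      exact first
    · obtain ⟨i1, i2, i3⟩ := ih γ (Order.lt_succ γ)
      rw [Order.succ_eq_add_one, κs]
      obtain ⟨-, j1, j2, j3⟩ := second i1 i2
      refine ⟨j1, j2, ?_⟩
      funext c
      rw [Bool.eq_iff_iff, j3, i3, hY, cellRun_add_one]
    · have hl : Order.IsSuccLimit (κ α) :=
        Ordinal.isSuccLimit_add _ (Ordinal.isSuccLimit_mul_right two_pos hα)
      have hcof : ∀ t < κ α, ∃ γ < α, t ≤ κ γ := by
        intro t ht
        rcases split ht with rfl | ⟨γ, hγ, rfl | rfl⟩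
        · exact ⟨0, hα.bot_lt, zero_le⟩
        · exact ⟨γ, hγ, le_rfl⟩
        · exact ⟨γ + 1, hα.add_one_lt hγ, (κadd (lt_add_one γ)).le⟩
      have htrue : ∀ c, (∀ γ < α, X (κ γ) c = true) → X (κ α) c = true := by
        intro c hc
        rw [hX, cellRun_limit _ _ hl]
        intro t ht
        obtain ⟨γ, hγ, hle⟩ := hcof t ht
        exact ⟨_, κmono hγ, hle, hc γ hγ⟩
      refine ⟨htrue _ fun γ hγ => (ih γ hγ).1, htrue _ fun γ hγ => (ih γ hγ).2.1, ?_⟩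
      funext c
      rw [Bool.eq_iff_iff, Function.comp_apply, hX, cellRun_limit _ _ hl, ← hX, hY,
        cellRun_limit _ _ hα, ← hY]
      constructor
      · intro H γ hγ
        obtain ⟨t, ht, hle, h⟩ := H (κ γ) (κmono hγ)
        rcases split ht with rfl | ⟨ε, hε, rfl | rfl⟩
        · exact absurd hle (not_le.2 (lt_of_lt_of_le one_pos (by simp [κ])))
        · refine ⟨ε, hε, κmono.le_iff_le.1 hle, ?_⟩
          rw [← (ih ε hε).2.2]; exact h
        · refine ⟨ε, hε, ?_, ?_⟩
          · by_contra hlt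
            exact absurd (κadd (not_le.1 hlt)) (not_lt.2 hle)
          · obtain ⟨i1, i2, i3⟩ := ih ε hε
            rw [← i3, ← (second i1 i2).1.2.2]; exact h
      · intro H t ht
        obtain ⟨γ, hγ, hle⟩ := hcof t ht
        obtain ⟨ε, hε, hγε, h⟩ := H γ hγ
        refine ⟨_, κmono hε, hle.trans (κmono.monotone hγε), ?_⟩
        rw [← (ih ε hε).2.2] at h; exact h
  have hval : ∀ α c, X (κ α) (main c) = Y α c := fun α c => congrFun (good α).2.2 c
  have hval' : ∀ α c, X (κ α + 1) (main c) = Y α c := fun α c => by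
    rw [← hval]; exact congrFun (second (good α).1 (good α).2.1).1.2.2 c
  refine hP A x Z hZ (κ β) y (fun t ht => ?_) ?_ fun n => ?_
  · rcases split ht with rfl | ⟨γ, hγ, rfl | rfl⟩
    · rw [← hX, hX0, hZ0 _ (by simp)]
    · exact (hval γ (0, 0, 0, 0)).trans (h1 γ hγ)
    · exact (hval' γ (0, 0, 0, 0)).trans (h1 γ hγ)
  · exact (hval β (0, 0, 0, 0)).trans h2
  · rw [hy, ← hX]
    have hlt : ∀ {γ}, γ < β → Y γ (1, n, 0, 0) = true →
        ∃ t < κ β, X (t + 1) (1, n, 0, 0) = true := fun {γ} hγ h =>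
      ⟨κ γ, κmono hγ, (hval' γ (1, n, 0, 0)).trans h⟩
    constructor
    · rintro ⟨γ, hγ, h⟩
      rcases hγ.lt_or_eq with hγ | rfl
      · exact hlt hγ h
      -- `hP` counts only bits written at successor stages up to `κ β`. A bit that is on at a limit
      -- was on before.
      · rcases Ordinal.zero_or_succ_or_isSuccLimit γ with rfl | ⟨ε, rfl⟩ | hlim
        · exact ⟨0, by rw [κ0, zero_add]; exact one_pos,
            by rw [← κ0]; exact (hval 0 (1, n, 0, 0)).trans h⟩
        · refine ⟨κ ε + 1, κadd (Order.lt_succ ε), ?_⟩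
          rw [← κs, ← Order.succ_eq_add_one]
          exact (hval _ (1, n, 0, 0)).trans h
        · rw [hY, cellRun_limit _ _ hlim] at h
          obtain ⟨ε, hε, -, h⟩ := h 0 hlim.bot_lt
          exact hlt hε h
    · rintro ⟨t, ht, h⟩
      rcases split ht with rfl | ⟨γ, hγ, rfl | rfl⟩
      · rw [← κ0] at h
        exact ⟨0, zero_le, (hval 0 (1, n, 0, 0)).symm.trans h⟩
      · exact ⟨γ, hγ.le, (hval' γ (1, n, 0, 0)).symm.trans h⟩
      · rw [← κs] at h
        exact ⟨γ + 1, Order.add_one_le_of_lt hγ, (hval (γ + 1) (1, n, 0, 0)).symm.trans h⟩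

end phase

end ITTM

namespace ITTM

/-! ### Observing a transformation -/

section observer

variable {δ : Type} [Primcodable δ]

abbrev Observed : Type := Cell ⊕ (ℕ ⊕ ℕ)

open scoped Classical in
/-- The observed array together with auxiliary bits. -/
noncomputable def view (ψ : (Observed → Bool) → ℕ → Prop) (o : Observed → Bool) :
    Observed ⊕ ℕ → Bool := Sum.elim o fun i => decide (ψ o i)

open scoped Classical in
/-- An array, together with the input and the natural numbers in the oracle. -/
noncomputable def observe (A : Set CReal) (x : CReal) (B : Cell → Bool) : Observed → Bool :=
  Sum.elim B (Sum.elim x fun j => decide (natReal j ∈ A))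

namespace Observer

def base (c : Cell) : Cell := (c.1 + 4, c.2)

def obs : Observed → Cell := Sum.elim base (Sum.elim (fun j => (2, j, 0, 0)) fun j => (3, j, 0, 0))

theorem primrec_base : Primrec base :=
  .pair (Primrec.nat_add.comp .fst (.const 4)) .snd

theorem primrec_obs : Primrec obs := by
  have h : ∀ k, Primrec fun j : ℕ => ((k, j, 0, 0) : Cell) := fun k =>
    .pair (.const k) (.pair .id (.const (0, 0)))
  have h' : Primrec (Sum.elim (fun j => ((2, j, 0, 0) : Cell)) fun j => (3, j, 0, 0)) :=
    (Primrec.sumCasesOn .id ((h 2).comp .snd).to₂ ((h 3).comp .snd).to₂).of_eq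
      fun x => by cases x <;> rfl
  exact (Primrec.sumCasesOn .id (primrec_base.comp .snd).to₂ (h'.comp .snd).to₂).of_eq
    fun x => by cases x <;> rfl

theorem primrec_map {α β α' β' : Type} [Primcodable α] [Primcodable β] [Primcodable α']
    [Primcodable β'] {f : α → α'} {g : β → β'} (hf : Primrec f) (hg : Primrec g) :
    Primrec (Sum.map f g) :=
  (Primrec.sumCasesOn .id (Primrec.sumInl.comp (hf.comp .snd)).to₂
    (Primrec.sumInr.comp (hg.comp .snd)).to₂).of_eq fun x => by cases x <;> rfl

def auxBit (ψb : (Cell → Bool) → δ → Prop) (ψ : (Observed → Bool) → ℕ → Prop) (Z : Cell → Bool)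
    (w : δ ⊕ ℕ) : Prop := Sum.elim (ψb (Z ∘ base)) (ψ (Z ∘ obs)) w

/-- The observed array is shifted by `4` in the first coordinate, to make room for the cells for
halting, output, input and oracle. The latter two kinds are simply kept. -/
def next (φb : (Cell ⊕ δ → Bool) → Cell → Prop) (halt : (Observed ⊕ ℕ → Bool) → Unit → Prop)
    (out : (Observed ⊕ ℕ → Bool) → ℕ → Prop) (Y : Cell ⊕ (δ ⊕ ℕ) → Bool) (c : Cell) : Prop :=
  (4 ≤ c.1 ∧ φb (Y ∘ Sum.map base Sum.inl) (c.1 - 4, c.2)) ∨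
  ((c.1 = 2 ∨ c.1 = 3) ∧ Y (.inl c) = true) ∨
  (c = (0, 0, 0, 0) ∧ halt (Y ∘ Sum.map obs Sum.inr) ()) ∨
  (c = (1, c.2.1, 0, 0) ∧ halt (Y ∘ Sum.map obs Sum.inr) () ∧
    out (Y ∘ Sum.map obs Sum.inr) c.2.1)

variable {ψb : (Cell → Bool) → δ → Prop} {φb : (Cell ⊕ δ → Bool) → Cell → Prop}
  {ψ : (Observed → Bool) → ℕ → Prop} {halt : (Observed ⊕ ℕ → Bool) → Unit → Prop}
  {out : (Observed ⊕ ℕ → Bool) → ℕ → Prop}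

theorem sig_step (hφb : Sig φb) (hhalt : Sig halt) (hout : Sig out) :
    Sig (next (δ := δ) φb halt out) := by
  have h1 : Primrec fun c : Cell => (c.1 - 4, c.2) :=
    .pair (Primrec.nat_sub.comp .fst (.const 4)) .snd
  have h2 : Primrec (Sum.map base (Sum.inl (α := δ) (β := ℕ))) := primrec_map primrec_base .sumInl
  have h3 : Primrec (Sum.map obs (Sum.inr (α := δ) (β := ℕ))) := primrec_map primrec_obs .sumInr
  have h4 := (hhalt.pull h3).comp (β := Cell) (f := fun _ => ()) (.const ())
  refine .or (.and (.of_primrecPred (Primrec.nat_le.comp (.const 4) .fst)) ((hφb.pull h2).comp h1))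
    (.or (.and (.or (.of_primrecPred (Primrec.eq.comp .fst (.const 2)))
      (.of_primrecPred (Primrec.eq.comp .fst (.const 3)))) (.lit .sumInl true))
    (.or (.and (.of_primrecPred (Primrec.eq.comp .id (.const _))) h4)
    (.and (.of_primrecPred (p := fun c : Cell => c = (1, c.2.1, 0, 0)) (Primrec.eq.comp .id
      (.pair (.const 1) (.pair (Primrec.fst.comp .snd) (.const (0, 0)))))) (.and h4 ?_))))
  exact (hout.pull h3).comp (Primrec.fst.comp .snd)

end Observer

-- The observed array starts blank and evolves independently of input and oracle, which only the
-- observer can see. So one and the same simulation can be watched with different oracles. Output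
-- bits are written together with the halting bit, since bits written earlier would accumulate.
open Observer in
theorem exists_observer_program {ψb : (Cell → Bool) → δ → Prop}
    {φb : (Cell ⊕ δ → Bool) → Cell → Prop} {ψ : (Observed → Bool) → ℕ → Prop}
    {halt : (Observed ⊕ ℕ → Bool) → Unit → Prop} {out : (Observed ⊕ ℕ → Bool) → ℕ → Prop}
    (hψb : Sig ψb) (hφb : Sig φb) (hψ : Sig ψ) (hhalt : Sig halt) (hout : Sig out) :
    ∃ P : Program, ∀ (A : Set CReal) (x y : CReal) (β : Ordinal.{0}),
      (∀ γ < β, ¬ halt (view ψ (observe A x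
        (cellRun (phaseStep ψb φb) (fun _ => false) γ))) ()) →
      halt (view ψ (observe A x (cellRun (phaseStep ψb φb) (fun _ => false) β))) () →
      (∀ n, y n = true ↔
        out (view ψ (observe A x (cellRun (phaseStep ψb φb) (fun _ => false) β))) n) →
      Yields A P x y := by
  classical
  have hψ' : Sig (auxBit ψb ψ) := (hψb.pull primrec_base).sum (hψ.pull primrec_obs)
  obtain ⟨P, hP⟩ := exists_phase_program hψ' (sig_step (δ := δ) hφb hhalt hout)
  refine ⟨P, fun A x y β h1 h2 hy => ?_⟩
  set B := cellRun (phaseStep ψb φb) (fun _ => false) with hB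
  let Z₀ : Cell → Bool := fun c =>
    decide (∃ j, (c = (2, j, 0, 0) ∧ x j = true) ∨ (c = (3, j, 0, 0) ∧ natReal j ∈ A))
  have hZ₀ : Loaded A x Z₀ := fun c => by simp [Z₀]
  set Z := cellRun (phaseStep (auxBit ψb ψ) (next φb halt out)) Z₀ with hZ
  have hcell : ∀ c, (c.1 = 2 ∨ c.1 = 3) → ∀ α, Z α c = Z₀ c := by
    intro c hc α
    induction α using WellFoundedLT.induction with
    | ind α ih =>
    rcases Ordinal.zero_or_succ_or_isSuccLimit α with rfl | ⟨γ, rfl⟩ | hα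
    · rw [hZ, cellRun_zero]
    · rw [← ih γ (Order.lt_succ γ), Order.succ_eq_add_one, Bool.eq_iff_iff, hZ, cellRun_add_one,
        phaseStep, next]
      obtain ⟨t, r⟩ := c
      have h0 : t ≠ 0 := by rintro rfl; simp at hc
      have h1 : t ≠ 1 := by rintro rfl; simp at hc
      have h4 : ¬ 4 ≤ t := by simp only at hc; omega
      simp only at hc
      simp [h0, h1, h4, hc]
    · rw [Bool.eq_iff_iff, hZ, cellRun_limit _ _ hα, ← hZ]
      constructor
      · intro H
        obtain ⟨γ, hγ, -, h⟩ := H 0 hα.bot_lt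
        rwa [ih γ hγ] at h
      · exact fun h γ hγ => ⟨γ, hγ, le_rfl, by rwa [ih γ hγ]⟩
  have hbase : ∀ α, Z α ∘ base = B α := by
    intro α
    induction α using WellFoundedLT.induction with
    | ind α ih =>
    rcases Ordinal.zero_or_succ_or_isSuccLimit α with rfl | ⟨γ, rfl⟩ | hα
    · rw [hZ, cellRun_zero, hB, cellRun_zero]
      funext c
      simp [Z₀, base]
    · funext c
      rw [Order.succ_eq_add_one, Bool.eq_iff_iff, Function.comp_apply, hZ, cellRun_add_one, hB,
        cellRun_add_one, ← hZ, ← hB, phaseStep, next, phaseStep]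
      have : Sum.elim (Z γ) (fun w => decide (auxBit ψb ψ (Z γ) w)) ∘ Sum.map base Sum.inl =
          Sum.elim (B γ) fun w => decide (ψb (B γ) w) := by
        rw [← ih γ (Order.lt_succ γ)]
        funext w
        rcases w with w | w <;> rfl
      rw [this]
      simp [base]
    · funext c
      rw [Bool.eq_iff_iff, Function.comp_apply, hZ, cellRun_limit _ _ hα, hB,
        cellRun_limit _ _ hα, ← hZ, ← hB]
      refine forall₂_congr fun γ _ => exists_congr fun ε => and_congr_right fun hε => ?_
      rw [← ih ε hε]
      rfl
  have hview : ∀ γ, Sum.elim (Z γ) (fun w => decide (auxBit ψb ψ (Z γ) w)) ∘ Sum.map obs Sum.inr =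
      view ψ (observe A x (B γ)) := by
    intro γ
    have ho : Z γ ∘ obs = observe A x (B γ) := by
      funext w
      rcases w with c | j | j
      · exact congrFun (hbase γ) c
      · rw [Function.comp_apply, hcell _ (.inl rfl)]
        simp [Z₀, obs, observe]
      · rw [Function.comp_apply, hcell _ (.inr rfl)]
        simp [Z₀, obs, observe]
    rw [← ho]
    funext w
    rcases w with w | i <;> rfl
  have hhalt0 : ∀ γ, Z (γ + 1) (0, 0, 0, 0) = true ↔ halt (view ψ (observe A x (B γ))) () := by
    intro γ
    rw [hZ, cellRun_add_one, ← hZ, phaseStep, next, hview]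
    simp
  have hout0 : ∀ γ n, Z (γ + 1) (1, n, 0, 0) = true ↔
      halt (view ψ (observe A x (B γ))) () ∧ out (view ψ (observe A x (B γ))) n := by
    intro γ n
    rw [hZ, cellRun_add_one, ← hZ, phaseStep, next, hview]
    simp
  have hfalse : ∀ γ ≤ β, Z γ (0, 0, 0, 0) = false ∧ ∀ n, Z γ (1, n, 0, 0) = false := by
    intro γ
    induction γ using WellFoundedLT.induction with
    | ind γ ih =>
    intro hγ
    rcases Ordinal.zero_or_succ_or_isSuccLimit γ with rfl | ⟨ε, rfl⟩ | hlim
    · rw [hZ, cellRun_zero]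
      simp [Z₀]
    · have hn := h1 ε ((Order.lt_succ ε).trans_le hγ)
      rw [Order.succ_eq_add_one, ← Bool.not_eq_true, hhalt0]
      refine ⟨hn, fun n => ?_⟩
      rw [← Bool.not_eq_true, hout0]
      exact fun h => hn h.1
    · have key : ∀ c, (∀ ε < γ, Z ε c = false) → Z γ c = false := by
        intro c hc
        rw [← Bool.not_eq_true, hZ, cellRun_limit _ _ hlim, ← hZ]
        intro H
        obtain ⟨ε, hε, -, h⟩ := H 0 hlim.bot_lt
        rw [hc ε hε] at h
        cases h
      exact ⟨key _ fun ε hε => (ih ε hε (hε.le.trans hγ)).1,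
        fun n => key _ fun ε hε => (ih ε hε (hε.le.trans hγ)).2 n⟩
  refine hP A x Z₀ hZ₀ (β + 1) y (fun γ hγ => ?_) ?_ fun n => ?_
  · exact (hfalse γ (Order.lt_add_one_iff.1 hγ)).1
  · rw [← hZ, hhalt0]; exact h2
  · rw [hy, ← hZ]
    constructor
    · exact fun h => ⟨β + 1, le_rfl, (hout0 β n).2 ⟨h2, h⟩⟩
    · rintro ⟨γ, hγ, h⟩
      rcases hγ.lt_or_eq with hγ | rfl
      · rw [(hfalse γ (Order.lt_add_one_iff.1 hγ)).2] at h
        cases h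
      · exact ((hout0 β n).1 h).2

end observer

end ITTM

/-! ### Looking up instructions is primitive recursive -/

namespace ITTM

theorem Program.primrec_lookup :
    Primrec fun a : Program × ℕ × (Tape → Bool) => a.1.lookup a.2.1 a.2.2 := by
  have hequiv : Primrec fun i : Instruction => Instruction.equivProd i := Primrec.of_equiv
  have h1 : PrimrecRel fun (a : Program × ℕ × (Tape → Bool)) (i : Instruction) =>
      i.state = a.2.1 ∧ i.read = a.2.2 := by
    refine PrimrecPred.and (Primrec.eq.comp ?_ ?_) (Primrec.eq.comp ?_ ?_)
    · exact (Primrec.fst.comp (Primrec.fst.comp hequiv)).comp Primrec.snd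
    · exact Primrec.fst.comp (Primrec.snd.comp .fst)
    · exact (Primrec.snd.comp (Primrec.fst.comp hequiv)).comp Primrec.snd
    · exact Primrec.snd.comp (Primrec.snd.comp .fst)
  have h2 : Primrec fun a : Program × ℕ × (Tape → Bool) =>
      a.1.findIdx fun i => decide (i.state = a.2.1 ∧ i.read = a.2.2) :=
    Primrec.list_findIdx .fst h1.decide
  refine (Primrec.list_getElem?.comp .fst h2).of_eq fun a => ?_
  unfold Program.lookup
  exact List.find?_eq_getElem?_findIdx.symm

namespace Sim

/-! ### The simulated machines

Machine `2n` is the program with code `n` on input `0` without oracle, and machine `2n+1` is the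
program `p` on input `n`. -/

section program

variable (p : Program) (m q k : ℕ) (s : Tape → Bool) (t : Tape)

def prog (n : ℕ) : Program := (Encodable.decode (α := Program) n).getD []

/-- Numbers that code no program are decoded to the empty program; they are excluded here. -/
def IsCode (n : ℕ) : Prop := (prog n).code = n

def prg : Program := if m % 2 = 1 then p else prog (m / 2)

def info : Option Instruction := (prg p m).lookup q s

/-- The defaults in this definition and the next two reproduce the case of `step` in which no
instruction applies. -/
def nx : ℕ := ((info p m q s).map Instruction.next).getD haltState

def wr : Bool := ((info p m q s).map fun i => i.write t).getD (s t)

def mv : ℕ := ((info p m q s).map fun i => i.move.apply k).getD k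

variable {α : Type} [Primcodable α] {fm fq fk : α → ℕ} {fs : α → Tape → Bool} {ft : α → Tape}
  (hm : Primrec fm) (hq : Primrec fq) (hk : Primrec fk) (hs : Primrec fs) (ht : Primrec ft)

theorem primrec_prog : Primrec prog := Primrec.option_getD.comp .decode (.const [])

theorem primrecPred_isCode : PrimrecPred IsCode :=
  Primrec.eq.comp (Primrec.encode.comp primrec_prog) .id

theorem primrec_prg : Primrec (prg p) :=
  Primrec.ite (Primrec.eq.comp (Primrec.nat_mod.comp .id (.const 2)) (.const 1)) (.const p)
    (primrec_prog.comp (Primrec.nat_div.comp .id (.const 2)))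

include hm hq hs in
theorem primrec_info : Primrec fun a => info p (fm a) (fq a) (fs a) :=
  Program.primrec_lookup.comp (.pair ((primrec_prg p).comp hm) (.pair hq hs))

theorem primrec_equivProd : Primrec fun i : Instruction => Instruction.equivProd i :=
  Primrec.of_equiv

theorem primrec_next : Primrec Instruction.next :=
  Primrec.snd.comp (Primrec.snd.comp (Primrec.snd.comp primrec_equivProd))

theorem primrec_move : Primrec Instruction.move :=
  Primrec.fst.comp (Primrec.snd.comp (Primrec.snd.comp primrec_equivProd))

theorem primrec_write : Primrec Instruction.write :=
  Primrec.fst.comp (Primrec.snd.comp primrec_equivProd)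

include hm hq hs in
theorem primrec_nx : Primrec fun a => nx p (fm a) (fq a) (fs a) :=
  Primrec.option_getD.comp (Primrec.option_map (primrec_info p hm hq hs)
    (primrec_next.comp .snd).to₂) (.const _)

include hm hq hs ht in
theorem primrec_wr : Primrec fun a => wr p (fm a) (fq a) (fs a) (ft a) :=
  Primrec.option_getD.comp (Primrec.option_map (primrec_info p hm hq hs)
    (Primrec.fin_app.comp (primrec_write.comp .snd) (ht.comp .fst)).to₂) (Primrec.fin_app.comp hs ht)

theorem primrec_moveApply : Primrec₂ Move.apply :=
  Primrec.ite (Primrec.eq.comp .fst (.const 0)) (Primrec.nat_sub.comp .snd (.const 1))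
    (Primrec.ite (Primrec.eq.comp .fst (.const 1)) .snd (Primrec.succ.comp .snd))

include hm hq hk hs in
theorem primrec_mv : Primrec fun a => mv p (fm a) (fq a) (fk a) (fs a) :=
  Primrec.option_getD.comp (Primrec.option_map (primrec_info p hm hq hs)
    (primrec_moveApply.comp (primrec_move.comp .snd) (hk.comp .fst)).to₂) hk

end program

/-! ### Reading the array -/

section read

variable (E : Cell → Bool) (m q k j : ℕ) (t : Tape)

def Lm : Prop := E (0, 0, 0, 0) = true ∧ E (0, 1, 0, 0) = true

def St : Prop := ¬ E (0, 0, 0, 0) = true ∧ ¬ E (0, 1, 0, 0) = true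

/-- Machine `m` is to be started. -/
def Ini : Prop := St E ∨ (m % 2 = 1 ∧ E (5, 0, 0, 0) = true)

/-- At a start and at a limit stage the cells for state and head hold nothing meaningful. There the
prescribed values are read instead, as is the initial tape at a start. No stage is spent on
initialisation, so the simulation runs in step with the machines, stage by stage. -/
def StateAt : Prop :=
  (Ini E m ∧ q = 0) ∨ (¬ Ini E m ∧ ((Lm E ∧ q = 1) ∨ (¬ Lm E ∧ E (2, m, q, 0) = true)))

def HeadAt : Prop := ((Ini E m ∨ Lm E) ∧ k = 0) ∨ (¬ (Ini E m ∨ Lm E) ∧ E (3, m, k, 0) = true)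

def TapeAt : Prop :=
  (Ini E m ∧ (t = 0 ∧ m % 2 = 1 ∧ k < m / 2)) ∨ (¬ Ini E m ∧ E (1, m, t, k) = true)

/-- Machine `m` has halted. -/
def Done : Prop := ¬ Ini E m ∧ E (4, m, 0, 0) = true

/-- The part of a configuration that determines the next instruction. The rules quantify over it
existentially; when the array shows a configuration, exactly one guess is right. -/
abbrev Guess : Type := ℕ × ℕ × (Tape → Bool)

/-- State, head position and scanned bits are as guessed. -/
def Guessed (g : Guess) : Prop :=
  StateAt E m g.1 ∧ HeadAt E m g.2.1 ∧ ∀ t, TapeAt E m g.2.1 t ↔ g.2.2 t = true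

/-- The bit `j` on tape `t` after the next step. -/
def Written (p : Program) (g : Guess) : Prop :=
  (j = g.2.1 ∧ wr p m g.1 g.2.2 t = true) ∨ (¬ j = g.2.1 ∧ TapeAt E m j t)

/-- The real queried is in the approximated jump if it is `1` followed by the unary code of a halted
program: a one at `j` and a zero at `j + 1`, for the code `j` of a halted program, while `VioBit`
fails, i.e. no zero is directly followed by a one. The machines with even number have the empty
oracle, hence the condition that `m` is odd. -/
def MemBit (p : Program) : Prop :=
  ∃ g, Guessed E m g ∧ m % 2 = 1 ∧ ∃ j, Written E m j 3 p g ∧ ¬ Written E m (j + 1) 3 p g ∧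
    IsCode j ∧ Done E (2 * j)

def VioBit (p : Program) : Prop :=
  ∃ g, Guessed E m g ∧ ∃ j, ¬ Written E m j 3 p g ∧ Written E m (j + 1) 3 p g

def NextTape (p : Program) : Prop :=
  ((Done E m ∨ StateAt E m 2) ∧ TapeAt E m j t) ∨
  (¬ (Done E m ∨ StateAt E m 2) ∧ ∃ g, Guessed E m g ∧ Written E m j t p g)

def NextHead (p : Program) : Prop := ∃ g, Guessed E m g ∧ k = mv p m g.1 g.2.1 g.2.2

def NextState (yes : Prop) (p : Program) : Prop :=
  ∃ g, Guessed E m g ∧ ((¬ nx p m g.1 g.2.2 = 3 ∧ q = nx p m g.1 g.2.2) ∨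
    (nx p m g.1 g.2.2 = 3 ∧ ((yes ∧ q = 4) ∨ (¬ yes ∧ q = 5))))

/-- A program is just halting. At the next stage it counts as done and the machines with oracle are
started, so they see it in their oracle. -/
def Change : Prop := ∃ n, IsCode n ∧ ¬ Done E (2 * n) ∧ StateAt E (2 * n) 2

end read

section sig

variable {α : Type} [Primcodable α] {fm fq fk fj : α → ℕ} {ft : α → Tape} {fg : α → Guess}
  {p : Program}

theorem eq_pred {β : Type} [Primcodable β] {f g : α → β} (hf : Primrec f) (hg : Primrec g) :
    SigDec fun (_ : Cell → Bool) a => f a = g a := .of_primrecPred (Primrec.eq.comp hf hg)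

theorem sigDec_Lm : SigDec fun E (_ : α) => Lm E := .and (.lit (.const _)) (.lit (.const _))

theorem sigDec_Ini (hm : Primrec fm) : SigDec fun E (a : α) => Ini E (fm a) :=
  .or (.and (.not (.lit (.const _))) (.not (.lit (.const _))))
    (.and (eq_pred (Primrec.nat_mod.comp hm (.const 2)) (.const 1)) (.lit (.const _)))

theorem primrec_cell {f1 f2 f3 f4 : α → ℕ} (h1 : Primrec f1) (h2 : Primrec f2) (h3 : Primrec f3)
    (h4 : Primrec f4) : Primrec fun a => ((f1 a, f2 a, f3 a, f4 a) : Cell) :=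
  .pair h1 (.pair h2 (.pair h3 h4))

theorem sigDec_StateAt (hm : Primrec fm) (hq : Primrec fq) :
    SigDec fun E (a : α) => StateAt E (fm a) (fq a) :=
  .or (.and (sigDec_Ini hm) (eq_pred hq (.const 0))) (.and (sigDec_Ini hm).not
    (.or (.and sigDec_Lm (eq_pred hq (.const 1)))
      (.and sigDec_Lm.not (.lit (primrec_cell (.const 2) hm hq (.const 0))))))

theorem sigDec_HeadAt (hm : Primrec fm) (hk : Primrec fk) :
    SigDec fun E (a : α) => HeadAt E (fm a) (fk a) :=
  .or (.and (.or (sigDec_Ini hm) sigDec_Lm) (eq_pred hk (.const 0)))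
    (.and (SigDec.or (sigDec_Ini hm) sigDec_Lm).not
      (.lit (primrec_cell (.const 3) hm hk (.const 0))))

theorem sigDec_TapeAt (hm : Primrec fm) (ht : Primrec ft) (hk : Primrec fk) :
    SigDec fun E (a : α) => TapeAt E (fm a) (fk a) (ft a) :=
  .or (.and (sigDec_Ini hm) (.and (eq_pred ht (.const 0))
    (.and (eq_pred (Primrec.nat_mod.comp hm (.const 2)) (.const 1))
      (.of_primrecPred (Primrec.nat_lt.comp hk (Primrec.nat_div.comp hm (.const 2)))))))
    (.and (sigDec_Ini hm).not (.lit (primrec_cell (.const 1) hm (Primrec.fin_val.comp ht) hk)))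

theorem sigDec_Done (hm : Primrec fm) : SigDec fun E (a : α) => Done E (fm a) :=
  .and (sigDec_Ini hm).not (.lit (primrec_cell (.const 4) hm (.const 0) (.const 0)))

theorem sig_Guessed (hm : Primrec fm) (hg : Primrec fg) :
    Sig fun E (a : α) => Guessed E (fm a) (fg a) := by
  have hk : Primrec fun a => (fg a).2.1 := Primrec.fst.comp (Primrec.snd.comp hg)
  have ht : ∀ t, Sig fun E (a : α) => TapeAt E (fm a) (fg a).2.1 t ↔ (fg a).2.2 t = true := by
    intro t
    have h1 : SigDec fun E (a : α) => TapeAt E (fm a) (fg a).2.1 t :=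
      sigDec_TapeAt hm (.const t) hk
    have h2 : SigDec fun (_ : Cell → Bool) (a : α) => (fg a).2.2 t = true :=
      eq_pred (Primrec.fin_app.comp (Primrec.snd.comp (Primrec.snd.comp hg)) (.const t)) (.const _)
    exact ((h1.and h2).or (h1.not.and h2.not)).1.congr fun _ _ => iff_iff_and_or_not_and_not
  refine ((sigDec_StateAt hm (Primrec.fst.comp hg)).1.and ((sigDec_HeadAt hm hk).1.and
    ((ht 0).and ((ht 1).and ((ht 2).and (ht 3)))))).congr fun E a => ?_
  unfold Guessed
  refine and_congr_right fun _ => and_congr_right fun _ => ⟨fun h => ⟨h 0, h 1, h 2, h 3⟩, ?_⟩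
  rintro ⟨h0, h1, h2, h3⟩ t
  fin_cases t <;> assumption

theorem sigDec_Written (hm : Primrec fm) (hj : Primrec fj) (ht : Primrec ft) (hg : Primrec fg) :
    SigDec fun E (a : α) => Written E (fm a) (fj a) (ft a) p (fg a) := by
  have hk : Primrec fun a => (fg a).2.1 := Primrec.fst.comp (Primrec.snd.comp hg)
  exact .or (.and (eq_pred hj hk) (eq_pred (primrec_wr p hm (Primrec.fst.comp hg)
    (Primrec.snd.comp (Primrec.snd.comp hg)) ht) (.const true)))
    (.and (eq_pred hj hk).not (sigDec_TapeAt hm ht hj))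

theorem sig_MemBit : Sig fun E (m : ℕ) => MemBit E m p := by
  have h1 : Sig fun E (x : (ℕ × Guess) × ℕ) => Written E x.1.1 x.2 3 p x.1.2 ∧
      ¬ Written E x.1.1 (x.2 + 1) 3 p x.1.2 ∧ IsCode x.2 ∧ Done E (2 * x.2) :=
    .and (sigDec_Written (.comp .fst .fst) .snd (.const _) (.comp .snd .fst)).1
      (.and (sigDec_Written (.comp .fst .fst) (.comp .succ .snd) (.const _) (.comp .snd .fst)).2
        (.and (.of_primrecPred (primrecPred_isCode.comp .snd))
          (sigDec_Done (Primrec.nat_mul.comp (.const 2) .snd)).1))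
  have h2 : Sig fun E (x : ℕ × Guess) => Guessed E x.1 x.2 ∧ x.1 % 2 = 1 ∧
      ∃ j, Written E x.1 j 3 p x.2 ∧ ¬ Written E x.1 (j + 1) 3 p x.2 ∧ IsCode j ∧ Done E (2 * j) :=
    .and (sig_Guessed .fst .snd)
      (.and (eq_pred (Primrec.nat_mod.comp .fst (.const 2)) (.const 1)).1 h1.ex)
  exact h2.ex

theorem sig_VioBit : Sig fun E (m : ℕ) => VioBit E m p := by
  have h1 : Sig fun E (x : (ℕ × Guess) × ℕ) => ¬ Written E x.1.1 x.2 3 p x.1.2 ∧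
      Written E x.1.1 (x.2 + 1) 3 p x.1.2 :=
    .and (sigDec_Written (.comp .fst .fst) .snd (.const _) (.comp .snd .fst)).2
      (sigDec_Written (.comp .fst .fst) (.comp .succ .snd) (.const _) (.comp .snd .fst)).1
  have h2 : Sig fun E (x : ℕ × Guess) => Guessed E x.1 x.2 ∧
      ∃ j, ¬ Written E x.1 j 3 p x.2 ∧ Written E x.1 (j + 1) 3 p x.2 :=
    .and (sig_Guessed .fst .snd) h1.ex
  exact h2.ex

theorem sig_NextTape : Sig fun E (a : ℕ × Tape × ℕ) => NextTape E a.1 a.2.2 a.2.1 p := by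
  have hm : Primrec fun a : ℕ × Tape × ℕ => a.1 := .fst
  have ht : Primrec fun a : ℕ × Tape × ℕ => a.2.1 := .comp .fst .snd
  have hj : Primrec fun a : ℕ × Tape × ℕ => a.2.2 := .comp .snd .snd
  have h1 : Sig fun E (x : (ℕ × Tape × ℕ) × Guess) =>
      Guessed E x.1.1 x.2 ∧ Written E x.1.1 x.1.2.2 x.1.2.1 p x.2 :=
    .and (sig_Guessed (hm.comp .fst) .snd)
      (sigDec_Written (hm.comp .fst) (hj.comp .fst) (ht.comp .fst) .snd).1
  have h2 := (sigDec_Done hm).or (sigDec_StateAt hm (.const 2))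
  exact (h2.1.and (sigDec_TapeAt hm ht hj).1).or (h2.2.and h1.ex)

theorem sig_NextHead : Sig fun E (a : ℕ × ℕ) => NextHead E a.1 a.2 p := by
  have h1 : Sig fun E (x : (ℕ × ℕ) × Guess) =>
      Guessed E x.1.1 x.2 ∧ x.1.2 = mv p x.1.1 x.2.1 x.2.2.1 x.2.2.2 :=
    .and (sig_Guessed (.comp .fst .fst) .snd) (eq_pred (.comp .snd .fst) (primrec_mv p
      (.comp .fst .fst) (.comp .fst .snd) (Primrec.fst.comp (.comp .snd .snd))
      (Primrec.snd.comp (.comp .snd .snd)))).1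
  exact h1.ex

theorem sig_Change : Sig fun E (_ : α) => Change E := by
  have h2 : Primrec fun x : α × ℕ => 2 * x.2 := Primrec.nat_mul.comp (.const 2) .snd
  have h1 : Sig fun E (x : α × ℕ) => IsCode x.2 ∧ ¬ Done E (2 * x.2) ∧ StateAt E (2 * x.2) 2 :=
    .and (.of_primrecPred (primrecPred_isCode.comp .snd)) (.and (sigDec_Done h2).2
      (sigDec_StateAt h2 (.const 2)).1)
  exact h1.ex

end sig

end Sim
end ITTM

namespace ITTM
namespace Sim

/-! ### The rules of the simulation -/

section rules

variable (p : Program)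

/-- Both bits are existential, but the answer to a query needs them with opposite signs, and the no
state needs the negation of the answer. This is why the simulation has two phases. -/
def auxBit (E : Cell → Bool) (w : ℕ ⊕ ℕ) : Prop :=
  Sum.elim (fun m => MemBit E m p) (fun m => VioBit E m p) w

theorem sig_auxBit : Sig (auxBit p) := sig_MemBit.sum sig_VioBit

def rule (Y : Cell ⊕ (ℕ ⊕ ℕ) → Bool) (c : Cell) : Prop :=
  (c = (0, 0, 0, 0) ∧ Y (.inl (0, 1, 0, 0)) = true) ∨
  (c = (0, 1, 0, 0) ∧ ¬ Y (.inl (0, 1, 0, 0)) = true) ∨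
  (∃ a : ℕ × Tape × ℕ, c = (1, a.1, (a.2.1 : ℕ), a.2.2) ∧ NextTape (Y ∘ Sum.inl) a.1 a.2.2 a.2.1 p) ∨
  (∃ a : ℕ × ℕ, c = (2, a.1, a.2, 0) ∧ NextState (Y ∘ Sum.inl) a.1 a.2
    (Y (.inr (.inl a.1)) = true ∧ ¬ Y (.inr (.inr a.1)) = true) p) ∨
  (∃ a : ℕ × ℕ, c = (3, a.1, a.2, 0) ∧ NextHead (Y ∘ Sum.inl) a.1 a.2 p) ∨
  (∃ m, c = (4, m, 0, 0) ∧ (Done (Y ∘ Sum.inl) m ∨ StateAt (Y ∘ Sum.inl) m 2)) ∨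
  (c = (5, 0, 0, 0) ∧ Change (Y ∘ Sum.inl))

theorem sig_NextState : Sig fun (Y : Cell ⊕ (ℕ ⊕ ℕ) → Bool) (a : ℕ × ℕ) =>
    NextState (Y ∘ Sum.inl) a.1 a.2
      (Y (.inr (.inl a.1)) = true ∧ ¬ Y (.inr (.inr a.1)) = true) p := by
  have hm : Primrec fun x : (ℕ × ℕ) × Guess => x.1.1 := .comp .fst .fst
  have hq : Primrec fun x : (ℕ × ℕ) × Guess => x.1.2 := .comp .snd .fst
  have hn : Primrec fun x : (ℕ × ℕ) × Guess => nx p x.1.1 x.2.1 x.2.2.2 :=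
    primrec_nx p hm (.comp .fst .snd) (Primrec.snd.comp (.comp .snd .snd))
  have hy : SigDec fun (Y : Cell ⊕ (ℕ ⊕ ℕ) → Bool) (x : (ℕ × ℕ) × Guess) =>
      Y (.inr (.inl x.1.1)) = true ∧ ¬ Y (.inr (.inr x.1.1)) = true :=
    .and (.lit (Primrec.sumInr.comp (Primrec.sumInl.comp hm)))
      (.not (.lit (Primrec.sumInr.comp (Primrec.sumInr.comp hm))))
  have he : ∀ {f g : (ℕ × ℕ) × Guess → ℕ}, Primrec f → Primrec g →
      SigDec fun (_ : Cell ⊕ (ℕ ⊕ ℕ) → Bool) x => f x = g x := fun hf hg =>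
    .of_primrecPred (Primrec.eq.comp hf hg)
  have h1 : Sig fun (Y : Cell ⊕ (ℕ ⊕ ℕ) → Bool) (x : (ℕ × ℕ) × Guess) =>
      Guessed (Y ∘ Sum.inl) x.1.1 x.2 ∧
        ((¬ nx p x.1.1 x.2.1 x.2.2.2 = 3 ∧ x.1.2 = nx p x.1.1 x.2.1 x.2.2.2) ∨
        (nx p x.1.1 x.2.1 x.2.2.2 = 3 ∧
          (((Y (.inr (.inl x.1.1)) = true ∧ ¬ Y (.inr (.inr x.1.1)) = true) ∧ x.1.2 = 4) ∨
          (¬ (Y (.inr (.inl x.1.1)) = true ∧ ¬ Y (.inr (.inr x.1.1)) = true) ∧ x.1.2 = 5)))) :=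
    .and ((sig_Guessed hm .snd).pull .sumInl)
      (.or (.and (he hn (.const 3)).2 (he hq hn).1) (.and (he hn (.const 3)).1
        (.or (.and hy.1 (he hq (.const 4)).1) (.and hy.2 (he hq (.const 5)).1))))
  exact h1.ex

theorem sig_rule : Sig (rule p) := by
  have he : ∀ {α β : Type} [Primcodable α] [Primcodable β] {f g : α → β}, Primrec f → Primrec g →
      Sig fun (_ : Cell ⊕ (ℕ ⊕ ℕ) → Bool) x => f x = g x := fun hf hg =>
    .of_primrecPred (Primrec.eq.comp hf hg)
  have h1 : Sig fun (Y : Cell ⊕ (ℕ ⊕ ℕ) → Bool) (x : Cell × (ℕ × Tape × ℕ)) =>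
      x.1 = (1, x.2.1, (x.2.2.1 : ℕ), x.2.2.2) ∧ NextTape (Y ∘ Sum.inl) x.2.1 x.2.2.2 x.2.2.1 p :=
    .and (he .fst (primrec_cell (.const 1) (.comp .fst .snd)
      (Primrec.fin_val.comp (Primrec.fst.comp (.comp .snd .snd)))
      (Primrec.snd.comp (.comp .snd .snd)))) ((sig_NextTape.pull .sumInl).comp .snd)
  have h2 : Sig fun (Y : Cell ⊕ (ℕ ⊕ ℕ) → Bool) (x : Cell × (ℕ × ℕ)) =>
      x.1 = (2, x.2.1, x.2.2, 0) ∧ NextState (Y ∘ Sum.inl) x.2.1 x.2.2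
        (Y (.inr (.inl x.2.1)) = true ∧ ¬ Y (.inr (.inr x.2.1)) = true) p :=
    .and (he .fst (primrec_cell (.const 2) (.comp .fst .snd) (.comp .snd .snd) (.const 0)))
      ((sig_NextState p).comp .snd)
  have h3 : Sig fun (Y : Cell ⊕ (ℕ ⊕ ℕ) → Bool) (x : Cell × (ℕ × ℕ)) =>
      x.1 = (3, x.2.1, x.2.2, 0) ∧ NextHead (Y ∘ Sum.inl) x.2.1 x.2.2 p :=
    .and (he .fst (primrec_cell (.const 3) (.comp .fst .snd) (.comp .snd .snd) (.const 0)))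
      ((sig_NextHead.pull .sumInl).comp .snd)
  have h4 : Sig fun (Y : Cell ⊕ (ℕ ⊕ ℕ) → Bool) (x : Cell × ℕ) =>
      x.1 = (4, x.2, 0, 0) ∧ (Done (Y ∘ Sum.inl) x.2 ∨ StateAt (Y ∘ Sum.inl) x.2 2) :=
    .and (he .fst (primrec_cell (.const 4) .snd (.const 0) (.const 0)))
      (.or ((sigDec_Done .snd).1.pull .sumInl) ((sigDec_StateAt .snd (.const 2)).1.pull .sumInl))
  have h0 : SigDec fun (Y : Cell ⊕ (ℕ ⊕ ℕ) → Bool) (_ : Cell) => Y (.inl (0, 1, 0, 0)) = true :=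
    .lit (.const _)
  exact .or (.and (he .id (.const _)) h0.1) (.or (.and (he .id (.const _)) h0.2)
    (.or h1.ex (.or h2.ex (.or h3.ex (.or h4.ex
      (.and (he .id (.const _)) (sig_Change.pull .sumInl)))))))

/-- The simulation. -/
noncomputable def stage (α : Ordinal.{0}) : Cell → Bool :=
  cellRun (phaseStep (auxBit p) (rule p)) (fun _ => false) α

end rules

variable {p : Program} {α : Ordinal.{0}}

theorem stage_zero (c : Cell) : stage p 0 c = false := by rw [stage, cellRun_zero]

theorem stage_add_one (c : Cell) : stage p (α + 1) c = true ↔ open scoped Classical in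
    rule p (Sum.elim (stage p α) fun w => decide (auxBit p (stage p α) w)) c := by
  rw [stage, cellRun_add_one]
  rfl

theorem stage_limit (hα : Order.IsSuccLimit α) (c : Cell) :
    stage p α c = true ↔ ∀ β < α, ∃ γ < α, β ≤ γ ∧ stage p γ c = true := cellRun_limit _ _ hα c

theorem stage_limit_add (a : Ordinal.{0}) (hα : Order.IsSuccLimit α) (c : Cell) :
    stage p (a + α) c = true ↔ ∀ β < α, ∃ γ < α, β ≤ γ ∧ stage p (a + γ) c = true := by
  rw [stage_limit (Ordinal.isSuccLimit_add a hα)]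
  constructor
  · intro H β hβ
    obtain ⟨γ, hγ, hle, h⟩ := H (a + β) ((add_lt_add_iff_left a).2 hβ)
    obtain ⟨δ, rfl⟩ : ∃ δ, γ = a + δ :=
      ⟨γ - a, (Ordinal.add_sub_cancel_of_le (le_self_add.trans hle)).symm⟩
    exact ⟨δ, (add_lt_add_iff_left a).1 hγ, (add_le_add_iff_left a).1 hle, h⟩
  · intro H β hβ
    rcases le_total β a with hle | hle
    · obtain ⟨γ, hγ, -, h⟩ := H 0 hα.bot_lt
      exact ⟨a + γ, (add_lt_add_iff_left a).2 hγ, hle.trans le_self_add, h⟩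
    · obtain ⟨δ, rfl⟩ : ∃ δ, β = a + δ := ⟨β - a, (Ordinal.add_sub_cancel_of_le hle).symm⟩
      obtain ⟨γ, hγ, hle, h⟩ := H δ ((add_lt_add_iff_left a).1 hβ)
      exact ⟨a + γ, (add_lt_add_iff_left a).2 hγ, (add_le_add_iff_left a).2 hle, h⟩

theorem stage_flag0 : stage p (α + 1) (0, 0, 0, 0) = true ↔ stage p α (0, 1, 0, 0) = true := by
  rw [stage_add_one]; simp [rule]

theorem stage_flag1 : stage p (α + 1) (0, 1, 0, 0) = true ↔ ¬ stage p α (0, 1, 0, 0) = true := by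
  rw [stage_add_one]; simp [rule]

theorem stage_tape (m j : ℕ) (t : Tape) :
    stage p (α + 1) (1, m, t, j) = true ↔ NextTape (stage p α) m j t p := by
  rw [stage_add_one]
  simp only [rule, Prod.mk.injEq, Nat.one_ne_zero, false_and, false_or, or_false, true_and,
    OfNat.one_ne_ofNat, exists_const, Fin.val_inj]
  constructor
  · rintro ⟨⟨m', t', j'⟩, ⟨rfl, rfl, rfl⟩, h⟩; exact h
  · exact fun h => ⟨(m, t, j), ⟨rfl, rfl, rfl⟩, h⟩

theorem stage_state (m q : ℕ) : stage p (α + 1) (2, m, q, 0) = true ↔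
    NextState (stage p α) m q (MemBit (stage p α) m p ∧ ¬ VioBit (stage p α) m p) p := by
  classical
  rw [stage_add_one]
  simp only [rule, Prod.mk.injEq, OfNat.ofNat_ne_zero, OfNat.ofNat_ne_one, false_and, false_or,
    or_false, true_and, exists_const, and_true, Sum.elim_inr, decide_eq_true_eq,
    show ¬ (2 : ℕ) = 3 by simp, show ¬ (2 : ℕ) = 4 by simp, show ¬ (2 : ℕ) = 5 by simp]
  constructor
  · rintro ⟨⟨m', q'⟩, ⟨rfl, rfl⟩, h⟩; exact h
  · exact fun h => ⟨(m, q), ⟨rfl, rfl⟩, h⟩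

theorem stage_head (m k : ℕ) :
    stage p (α + 1) (3, m, k, 0) = true ↔ NextHead (stage p α) m k p := by
  rw [stage_add_one]
  simp only [rule, Prod.mk.injEq, OfNat.ofNat_ne_zero, OfNat.ofNat_ne_one, false_and, false_or,
    or_false, true_and, exists_const, and_true,
    show ¬ (3 : ℕ) = 2 by simp, show ¬ (3 : ℕ) = 4 by simp, show ¬ (3 : ℕ) = 5 by simp]
  constructor
  · rintro ⟨⟨m', q'⟩, ⟨rfl, rfl⟩, h⟩; exact h
  · exact fun h => ⟨(m, k), ⟨rfl, rfl⟩, h⟩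

theorem stage_done (m : ℕ) : stage p (α + 1) (4, m, 0, 0) = true ↔
    Done (stage p α) m ∨ StateAt (stage p α) m 2 := by
  rw [stage_add_one]
  simp only [rule, Prod.mk.injEq, OfNat.ofNat_ne_zero, OfNat.ofNat_ne_one, false_and, false_or,
    or_false, true_and, exists_const, and_true, exists_eq_left',
    show ¬ (4 : ℕ) = 2 by simp, show ¬ (4 : ℕ) = 3 by simp, show ¬ (4 : ℕ) = 5 by simp]
  rfl

theorem stage_change : stage p (α + 1) (5, 0, 0, 0) = true ↔ Change (stage p α) := by
  rw [stage_add_one]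
  simp [rule]

/-- The second flag alternates and the first one follows it with a delay of one stage. So exactly
one is on at successor stages, both are on at limits by the limit superior, and none is on at stage
`0`. -/
theorem stage_flags : (St (stage p α) ↔ α = 0) ∧ (Lm (stage p α) ↔ Order.IsSuccLimit α) := by
  have hs : ∀ γ, ¬ St (stage p (γ + 1)) ∧ ¬ Lm (stage p (γ + 1)) := by
    intro γ
    simp only [St, Lm, stage_flag0, stage_flag1]
    tauto
  have hl : ∀ l, Order.IsSuccLimit l → Lm (stage p l) := by
    intro l hl
    have key : ∀ c, (∀ γ, stage p (γ + 1) c = true ∨ stage p (γ + 1 + 1) c = true) →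
        stage p l c = true := by
      intro c hc
      rw [stage_limit hl]
      intro β hβ
      rcases hc β with h | h
      · exact ⟨_, hl.add_one_lt hβ, le_self_add, h⟩
      · exact ⟨_, hl.add_one_lt (hl.add_one_lt hβ), le_self_add.trans le_self_add, h⟩
    refine ⟨key _ fun γ => ?_, key _ fun γ => ?_⟩
    · rw [stage_flag0, stage_flag0, stage_flag1]; tauto
    · rw [stage_flag1, stage_flag1, stage_flag1]; tauto
  rcases Ordinal.zero_or_succ_or_isSuccLimit α with rfl | ⟨γ, rfl⟩ | hα
  · simp [St, Lm, stage_zero]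
  · rw [Order.succ_eq_add_one]
    refine ⟨iff_of_false (hs γ).1 (by simp), iff_of_false (hs γ).2 ?_⟩
    exact Order.not_isSuccLimit_succ γ
  · refine ⟨iff_of_false ?_ hα.ne_bot, iff_of_true (hl α hα) hα⟩
    exact fun h => h.1 (hl α hα).1

end Sim
end ITTM

namespace ITTM

/-! ### Numbers as reals -/

theorem natReal_injective : Function.Injective natReal := by
  intro a b h
  have h1 := congrFun h a
  have h2 := congrFun h b
  simp only [natReal, lt_self_iff_false, decide_false] at h1 h2
  rw [eq_comm, decide_eq_false_iff_not] at h1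
  rw [decide_eq_false_iff_not] at h2
  omega

/-- If no zero is directly followed by a one, then the one at `k` spreads to the left and the zero
at `k + 1` to the right. In this form membership is a combination of two existential conditions on
bits. -/
theorem mem_natReal_succ {H : ℕ → Prop} {y : CReal} :
    ((∃ k, H k ∧ y k = true ∧ y (k + 1) = false) ∧ ¬ ∃ j, y j = false ∧ y (j + 1) = true) ↔
      ∃ k, H k ∧ y = natReal (k + 1) := by
  constructor
  · rintro ⟨⟨k, hk, h1, h2⟩, hv⟩
    refine ⟨k, hk, ?_⟩
    push Not at hv
    have up : ∀ n, y (k + 1 + n) = false := by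
      intro n
      induction n with
      | zero => exact h2
      | succ n ih => exact Bool.eq_false_iff.2 (hv _ ih)
    have down : ∀ n, n ≤ k → y (k - n) = true := by
      intro n hn
      induction n with
      | zero => exact h1
      | succ n ih =>
        by_contra h
        refine hv (k - (n + 1)) (by simpa using h) ?_
        rw [show k - (n + 1) + 1 = k - n by omega]
        exact ih (by omega)
    funext n
    rcases le_or_gt n k with h | h
    · have := down (k - n) (by omega)
      rw [show k - (k - n) = n by omega] at this
      rw [this]
      simp [natReal]; omega
    · have := up (n - (k + 1))
      rw [show k + 1 + (n - (k + 1)) = n by omega] at this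
      rw [this]
      simp [natReal]; omega
  · rintro ⟨k, hk, rfl⟩
    refine ⟨⟨k, hk, by simp [natReal], by simp [natReal]⟩, ?_⟩
    rintro ⟨j, h1, h2⟩
    simp only [natReal, decide_eq_false_iff_not, decide_eq_true_eq] at h1 h2
    omega

/-- In unary the tag `1` of the second component just adds one to the number. -/
theorem mem_join_empty {H : ℕ → Prop} {y : CReal} :
    y ∈ join ∅ {x | ∃ k, x = natReal k ∧ H k} ↔ ∃ k, H k ∧ y = natReal (k + 1) := by
  simp only [join, Set.mem_empty_iff_false, and_false, false_or, Set.mem_ofPred_eq]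
  constructor
  · rintro ⟨h0, k, hk, hH⟩
    refine ⟨k, hH, ?_⟩
    funext n
    rcases n with _ | n
    · rw [h0, natReal_succ_bit]
    · rw [congrFun hk n]; simp [natReal]
  · rintro ⟨k, hk, rfl⟩
    exact ⟨natReal_succ_bit k, k, natReal_pop k, hk⟩

namespace Sim

/-! ### The simulation follows the machines -/

section follow

/-- Machine `m` is in configuration `c`. -/
structure Shows (E : Cell → Bool) (m : ℕ) (c : Config) : Prop where
  state : ∀ q, StateAt E m q ↔ q = c.state
  head : ∀ k, HeadAt E m k ↔ k = c.head
  tape : ∀ t j, TapeAt E m j t ↔ c.tape t j = true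

def inputOf (m : ℕ) : CReal := natReal (if m % 2 = 1 then m / 2 else 0)

/-- The programs known to halt. -/
def haltSet (E : Cell → Bool) : Set CReal := {x | ∃ n, x = natReal n ∧ IsCode n ∧ Done E (2 * n)}

open scoped Classical in
noncomputable def oracleOf (E : Cell → Bool) (m : ℕ) : Set CReal :=
  if m % 2 = 1 then join ∅ (haltSet E) else ∅

variable {E : Cell → Bool} {m : ℕ} {c : Config} {p : Program} {α : Ordinal.{0}}

theorem shows_of_ini (h : Ini E m) : Shows E m (initConfig (inputOf m)) := by
  refine ⟨fun q => by simp [StateAt, h, initConfig], fun k => by simp [HeadAt, h, initConfig],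
    fun t j => ?_⟩
  simp only [TapeAt, h, true_and, not_true, false_and, or_false, initConfig, inputOf]
  by_cases ht : t = 0
  · subst ht
    by_cases hm : m % 2 = 1 <;> simp [hm, natReal]
  · simp [ht]

def guessOf (c : Config) : Guess := (c.state, c.head, fun t => c.tape t c.head)

theorem Shows.guessed_iff (h : Shows E m c) (g : Guess) : Guessed E m g ↔ g = guessOf c := by
  obtain ⟨q, k, s⟩ := g
  simp only [Guessed, h.state, h.head, h.tape, guessOf, Prod.mk.injEq]
  refine and_congr_right fun _ => and_congr_right fun hk => ?_
  subst hk
  rw [funext_iff]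
  refine forall_congr' fun t => ?_
  rw [← Bool.eq_iff_iff, eq_comm]

/-- The bits written in a step from `c`. -/
def writeOf (p : Program) (m : ℕ) (c : Config) : Tape → Bool :=
  wr p m c.state fun t => c.tape t c.head

theorem step_eq (A : Set CReal) : step A (prg p m) c =
    { state := enterState A (nx p m c.state fun t => c.tape t c.head)
        (c.written (writeOf p m c) oracleTape)
      head := mv p m c.state c.head fun t => c.tape t c.head
      tape := c.written (writeOf p m c) } := by
  unfold step
  cases h : (prg p m).lookup c.state fun t => c.tape t c.head with
  | some i =>
    have h1 : writeOf p m c = i.write := by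
      funext t
      simp [writeOf, wr, info, h]
    simp [h1, nx, mv, info, h]
  | none =>
    have h1 : c.written (writeOf p m c) = c.tape := by
      funext t j
      simp only [Config.written, writeOf, wr, info, h, Option.map_none, Option.getD_none]
      rw [Function.update_eq_self]
    simp [h1, nx, mv, info, h, enterState]

theorem Shows.written_iff (h : Shows E m c) (j : ℕ) (t : Tape) :
    Written E m j t p (guessOf c) ↔ c.written (writeOf p m c) t j = true := by
  simp only [Written, guessOf, h.tape, Config.written, writeOf, Function.update_apply]
  split_ifs with hj <;> simp [hj]

theorem Shows.mem_oracle (h : Shows E m c) : (MemBit E m p ∧ ¬ VioBit E m p) ↔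
    c.written (writeOf p m c) oracleTape ∈ oracleOf E m := by
  have h1 : MemBit E m p ↔ m % 2 = 1 ∧ ∃ j, (IsCode j ∧ Done E (2 * j)) ∧
      c.written (writeOf p m c) oracleTape j = true ∧
      c.written (writeOf p m c) oracleTape (j + 1) = false := by
    simp only [MemBit, h.guessed_iff, exists_eq_left, h.written_iff, Bool.not_eq_true]
    refine and_congr_right fun _ => exists_congr fun j => ?_
    tauto
  have h2 : VioBit E m p ↔ ∃ j, c.written (writeOf p m c) oracleTape j = false ∧
      c.written (writeOf p m c) oracleTape (j + 1) = true := by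
    simp only [VioBit, h.guessed_iff, exists_eq_left, h.written_iff, Bool.not_eq_true]
  rw [h1, h2, and_assoc, mem_natReal_succ, oracleOf]
  split_ifs with hm
  · rw [haltSet, mem_join_empty]
    simp [hm]
  · simp [hm]

theorem shows_next (h : Shows (stage p α) m c) (hi : ¬ Ini (stage p (α + 1)) m)
    (hd : ¬ Done (stage p α) m) (hs : c.state ≠ haltState) :
    Shows (stage p (α + 1)) m (step (oracleOf (stage p α) m) (prg p m) c) := by
  have hl : ¬ Lm (stage p (α + 1)) := fun h => Order.not_isSuccLimit_succ α (stage_flags.2.1 h)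
  have hs2 : ¬ StateAt (stage p α) m 2 := fun h' => hs ((h.state 2).1 h').symm
  rw [step_eq]
  refine ⟨fun q => ?_, fun k => ?_, fun t j => ?_⟩
  · simp only [StateAt, hi, hl, false_and, false_or, not_false_eq_true, true_and, stage_state,
      NextState, h.guessed_iff, exists_eq_left, h.mem_oracle, enterState, guessOf]
    split_ifs with h1 h2 <;> simp [h1] <;> simp [h2]
  · simp only [HeadAt, hi, hl, false_and, false_or, not_false_eq_true, true_and, stage_head,
      NextHead, h.guessed_iff, exists_eq_left, guessOf, or_self]
  · simp only [TapeAt, hi, false_and, false_or, not_false_eq_true, true_and, stage_tape,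
      NextTape, h.guessed_iff, exists_eq_left, hd, hs2, or_self, h.written_iff]

theorem tape_frozen (h : Done (stage p α) m ∨ StateAt (stage p α) m 2)
    (hi : ¬ Ini (stage p (α + 1)) m) (t : Tape) (j : ℕ) :
    TapeAt (stage p (α + 1)) m j t ↔ TapeAt (stage p α) m j t := by
  rw [TapeAt]
  simp only [hi, false_and, false_or, not_false_eq_true, true_and, stage_tape, NextTape, h,
    not_true, or_false]

theorem done_next (hi : ¬ Ini (stage p (α + 1)) m) : Done (stage p (α + 1)) m ↔
    Done (stage p α) m ∨ StateAt (stage p α) m 2 := by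
  simp [Done, hi, stage_done]

end follow

end Sim
end ITTM

/-! ### Transfinite faithfulness of the simulation -/

namespace ITTM
namespace Sim

variable {p : Program} {m : ℕ}

/-- From a stage where machine `m` is started and as long as its oracle does not change, the
simulation follows the computation of the machine. -/
theorem follows {a β : Ordinal.{0}} {O : Set CReal} (hini : Ini (stage p a) m)
    (hno : ∀ δ, 0 < δ → δ ≤ β → ¬ Ini (stage p (a + δ)) m)
    (hO : ∀ δ < β, oracleOf (stage p (a + δ)) m = O) :
    ∀ δ ≤ β,
      (Done (stage p (a + δ)) m ↔ ∃ γ < δ, (run O (prg p m) (inputOf m) γ).state = haltState) ∧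
      ((∀ γ < δ, (run O (prg p m) (inputOf m) γ).state ≠ haltState) →
        Shows (stage p (a + δ)) m (run O (prg p m) (inputOf m) δ)) ∧
      ∀ γ < δ, HaltsAt O (prg p m) (inputOf m) γ →
        ∀ t j, TapeAt (stage p (a + δ)) m j t ↔
          (run O (prg p m) (inputOf m) γ).tape t j = true := by
  intro δ
  induction δ using WellFoundedLT.induction with
  | ind δ ih =>
  intro hδ
  rcases Ordinal.zero_or_succ_or_isSuccLimit δ with rfl | ⟨ε, rfl⟩ | hlim
  · rw [add_zero, run_zero]
    exact ⟨iff_of_false (fun h => h.1 hini) (by simp), fun _ => shows_of_ini hini, by simp⟩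
  · have hεδ := Order.lt_succ ε
    obtain ⟨i1, i2, i3⟩ := ih ε hεδ (hεδ.le.trans hδ)
    have hi : ¬ Ini (stage p (a + ε + 1)) m := by
      rw [add_assoc, ← Order.succ_eq_add_one]; exact hno _ (zero_le.trans_lt (Order.lt_succ ε)) hδ
    have hstate : ¬ Done (stage p (a + ε)) m →
        (StateAt (stage p (a + ε)) m 2 ↔ (run O (prg p m) (inputOf m) ε).state = haltState) := by
      intro hd
      rw [(i2 fun γ hγ h => hd (i1.2 ⟨γ, hγ, h⟩)).state, eq_comm]
    rw [Order.succ_eq_add_one, ← add_assoc]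
    refine ⟨?_, fun h => ?_, fun γ hγ h t j => ?_⟩
    · rw [done_next hi]
      by_cases hd : Done (stage p (a + ε)) m
      · obtain ⟨γ, hγ, h⟩ := i1.1 hd
        exact iff_of_true (.inl hd) ⟨γ, Order.lt_add_one_iff.2 hγ.le, h⟩
      · rw [hstate hd]
        constructor
        · rintro (h | h)
          exacts [absurd h hd, ⟨ε, lt_add_one ε, h⟩]
        · rintro ⟨γ, hγ, h⟩
          rcases (Order.lt_add_one_iff.1 hγ).lt_or_eq with h' | rfl
          exacts [absurd (i1.2 ⟨γ, h', h⟩) hd, .inr h]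
    · have hd : ¬ Done (stage p (a + ε)) m := fun hd => by
        obtain ⟨γ, hγ, h'⟩ := i1.1 hd
        exact h γ (Order.lt_add_one_iff.2 hγ.le) h'
      have h' := i2 fun γ hγ => h γ (Order.lt_add_one_iff.2 hγ.le)
      rw [run_add_one, ← hO ε (hεδ.trans_le hδ)]
      exact shows_next (by rw [hO ε (hεδ.trans_le hδ)]; exact h') hi hd
        (by rw [hO ε (hεδ.trans_le hδ)]; exact h ε (lt_add_one ε))
    · rcases (Order.lt_add_one_iff.1 hγ).lt_or_eq with h' | rfl
      · rw [tape_frozen (.inl (i1.2 ⟨γ, h', h.1⟩)) hi, i3 γ h' h]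
      · have hd : ¬ Done (stage p (a + γ)) m := fun hd => by
          obtain ⟨γ', hγ', h''⟩ := i1.1 hd
          exact h.2 γ' hγ' h''
        rw [tape_frozen (.inr ((hstate hd).2 h.1)) hi, (i2 h.2).tape]
  · have hpos : 0 < δ := hlim.bot_lt
    have hi := hno δ hpos hδ
    have hl : Lm (stage p (a + δ)) := stage_flags.2.2 (Ordinal.isSuccLimit_add a hlim)
    have hno' : ∀ ε, 0 < ε → ε < δ → ¬ Ini (stage p (a + ε)) m := fun ε h h' =>
      hno ε h (h'.le.trans hδ)
    have htape : ∀ t j, TapeAt (stage p (a + δ)) m j t ↔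
        ∀ β < δ, ∃ γ < δ, β ≤ γ ∧ TapeAt (stage p (a + γ)) m j t := by
      intro t j
      -- At stage `a` itself the cells may still hold what was there before the restart. The limit
      -- superior is therefore compared beyond `a`, by passing from `β` to `β + 1`.
      have hr : ∀ γ, 0 < γ → γ < δ → (stage p (a + γ) (1, m, t, j) = true ↔
          TapeAt (stage p (a + γ)) m j t) := fun γ h h' => by simp [TapeAt, hno' γ h h']
      simp only [TapeAt, hi, false_and, false_or, not_false_eq_true, true_and,
        stage_limit_add a hlim]
      constructor
      · intro H β hβ
        obtain ⟨γ, hγ, hle, h⟩ := H (β + 1) (hlim.add_one_lt hβ)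
        have hβγ : β < γ := (lt_add_one β).trans_le hle
        exact ⟨γ, hγ, hβγ.le, (hr γ (zero_le.trans_lt hβγ) hγ).1 h⟩
      · intro H β hβ
        obtain ⟨γ, hγ, hle, h⟩ := H (β + 1) (hlim.add_one_lt hβ)
        have hβγ : β < γ := (lt_add_one β).trans_le hle
        exact ⟨γ, hγ, hβγ.le, (hr γ (zero_le.trans_lt hβγ) hγ).2 h⟩
    refine ⟨?_, fun h => ⟨fun q => ?_, fun k => ?_, fun t j => ?_⟩, fun γ hγ h t j => ?_⟩
    · simp only [Done, hi, not_false_eq_true, true_and, stage_limit_add a hlim]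
      constructor
      · intro H
        obtain ⟨γ, hγ, hle, h⟩ := H 1 (by simpa using hlim.add_one_lt hpos)
        have hd : Done (stage p (a + γ)) m := ⟨hno' γ (one_pos.trans_le hle) hγ, h⟩
        obtain ⟨ε, hε, h'⟩ := (ih γ hγ (hγ.le.trans hδ)).1.1 hd
        exact ⟨ε, hε.trans hγ, h'⟩
      · rintro ⟨ε, hε, h⟩ β hβ
        have hm : max β (ε + 1) < δ := max_lt hβ (hlim.add_one_lt hε)
        exact ⟨_, hm, le_max_left _ _, ((ih _ hm (hm.le.trans hδ)).1.2
          ⟨ε, (lt_add_one ε).trans_le (le_max_right _ _), h⟩).2⟩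
    · simp only [StateAt, hi, hl, run_limit _ _ _ hlim, limitConfig]
      simp
    · simp only [HeadAt, hi, hl, run_limit _ _ _ hlim, limitConfig]
      simp
    · rw [htape, run_limit_tape _ _ _ hlim]
      refine forall₂_congr fun β _ => exists_congr fun γ => and_congr_right fun hγ => ?_
      rw [((ih γ hγ (hγ.le.trans hδ)).2.1 fun ε hε => h ε (hε.trans hγ)).tape]
    · have hγ' : ∀ ε, γ < ε → ε < δ → (TapeAt (stage p (a + ε)) m j t ↔
          (run O (prg p m) (inputOf m) γ).tape t j = true) := fun ε h1 h2 =>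
        (ih ε h2 (h2.le.trans hδ)).2.2 γ h1 h t j
      rw [htape]
      constructor
      · intro H
        obtain ⟨ε, hε, hle, h'⟩ := H (γ + 1) (hlim.add_one_lt hγ)
        exact (hγ' ε ((lt_add_one γ).trans_le hle) hε).1 h'
      · intro h' β hβ
        have hm : max β (γ + 1) < δ := max_lt hβ (hlim.add_one_lt hγ)
        exact ⟨_, hm, le_max_left _ _,
          (hγ' _ ((lt_add_one γ).trans_le (le_max_right _ _)) hm).2 h'⟩

/-- What is on the tapes of a machine that has halted remains there until it is started again. -/
theorem done_persists {a β : Ordinal.{0}} (hd : Done (stage p a) m)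
    (hno : ∀ δ, 0 < δ → δ ≤ β → ¬ Ini (stage p (a + δ)) m) :
    ∀ δ ≤ β, Done (stage p (a + δ)) m ∧
      ∀ t j, TapeAt (stage p (a + δ)) m j t ↔ TapeAt (stage p a) m j t := by
  intro δ
  induction δ using WellFoundedLT.induction with
  | ind δ ih =>
  intro hδ
  rcases Ordinal.zero_or_succ_or_isSuccLimit δ with rfl | ⟨ε, rfl⟩ | hlim
  · rw [add_zero]; exact ⟨hd, fun _ _ => Iff.rfl⟩
  · have hεδ := Order.lt_succ ε
    obtain ⟨i1, i2⟩ := ih ε hεδ (hεδ.le.trans hδ)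
    have hi : ¬ Ini (stage p (a + ε + 1)) m := by
      rw [add_assoc, ← Order.succ_eq_add_one]; exact hno _ (zero_le.trans_lt (Order.lt_succ ε)) hδ
    rw [Order.succ_eq_add_one, ← add_assoc]
    exact ⟨(done_next hi).2 (.inl i1), fun t j => (tape_frozen (.inl i1) hi t j).trans (i2 t j)⟩
  · have hi := hno δ hlim.bot_lt hδ
    refine ⟨⟨hi, ?_⟩, fun t j => ?_⟩
    · rw [stage_limit_add a hlim]
      exact fun β hβ => ⟨β, hβ, le_rfl, (ih β hβ (hβ.le.trans hδ)).1.2⟩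
    · have hr : ∀ γ < δ, (stage p (a + γ) (1, m, t, j) = true ↔ TapeAt (stage p a) m j t) := by
        intro γ hγ
        obtain ⟨i1, i2⟩ := ih γ hγ (hγ.le.trans hδ)
        rw [← i2]
        simp [TapeAt, i1.1]
      rw [TapeAt]
      simp only [hi, false_and, false_or, not_false_eq_true, true_and, stage_limit_add a hlim]
      constructor
      · intro H
        obtain ⟨γ, hγ, -, h⟩ := H 0 hlim.bot_lt
        exact (hr γ hγ).1 h
      · exact fun h β hβ => ⟨β, hβ, le_rfl, (hr β hβ).2 h⟩

end Sim
end ITTM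

namespace ITTM
namespace Sim

variable {p : Program} {α : Ordinal.{0}} {n : ℕ}

/-! ### Halting of the programs without oracle -/

/-- The program with code `n` halts at stage `α`. -/
def Stops (n : ℕ) (α : Ordinal.{0}) : Prop := IsCode n ∧ HaltsAt ∅ (prog n) (natReal 0) α

theorem exists_haltsAt {A : Set CReal} {P : Program} {x : CReal} {γ : Ordinal.{0}}
    (h : (run A P x γ).state = haltState) : ∃ δ ≤ γ, HaltsAt A P x δ := by
  obtain ⟨δ, h1, h2⟩ := WellFounded.has_min (r := ((· < ·) : Ordinal.{0} → Ordinal.{0} → Prop))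
    wellFounded_lt {δ | (run A P x δ).state = haltState} ⟨γ, h⟩
  exact ⟨δ, not_lt.1 (h2 γ h), h1, fun β hβ h' => h2 β h' hβ⟩

theorem prog_code (P : Program) : prog P.code = P := by
  simp [prog, Program.code]

theorem isCode_code (P : Program) : IsCode P.code := by rw [IsCode, prog_code]

theorem ini_even : Ini (stage p α) (2 * n) ↔ α = 0 := by
  rw [Ini, stage_flags.1, or_iff_left]
  omega

theorem ini_odd : Ini (stage p α) (2 * n + 1) ↔ α = 0 ∨ stage p α (5, 0, 0, 0) = true := by
  rw [Ini, stage_flags.1, and_iff_right]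
  omega

theorem prg_even : prg p (2 * n) = prog n := by simp [prg]

theorem prg_odd : prg p (2 * n + 1) = p := by simp [prg, Nat.add_mod]

theorem inputOf_even : inputOf (2 * n) = natReal 0 := by simp [inputOf]

theorem inputOf_odd : inputOf (2 * n + 1) = natReal n := by
  rw [inputOf, if_pos (by omega), show (2 * n + 1) / 2 = n by omega]

/-- These machines are started at stage `0` only, and their oracle is always empty. -/
theorem even_follows (α : Ordinal.{0}) :
    (Done (stage p α) (2 * n) ↔
      ∃ γ < α, (run ∅ (prog n) (natReal 0) γ).state = haltState) ∧
    ((∀ γ < α, (run ∅ (prog n) (natReal 0) γ).state ≠ haltState) →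
      Shows (stage p α) (2 * n) (run ∅ (prog n) (natReal 0) α)) := by
  have h := follows (p := p) (m := 2 * n) (a := 0) (β := α) (O := ∅) (ini_even.2 rfl)
    (fun δ h _ => by rw [zero_add, ini_even]; exact h.ne') (fun δ _ => by simp [oracleOf])
    α le_rfl
  rw [zero_add, prg_even, inputOf_even] at h
  exact ⟨h.1, h.2.1⟩

theorem stateAt_even (hd : ∀ γ < α, (run ∅ (prog n) (natReal 0) γ).state ≠ haltState) :
    StateAt (stage p α) (2 * n) 2 ↔ (run ∅ (prog n) (natReal 0) α).state = haltState := by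
  rw [((even_follows α).2 hd).state, eq_comm]

theorem change_iff : Change (stage p α) ↔ ∃ n, Stops n α := by
  refine exists_congr fun n => and_congr_right fun _ => ?_
  have hd : ¬ Done (stage p α) (2 * n) ↔
      ∀ γ < α, (run ∅ (prog n) (natReal 0) γ).state ≠ haltState := by
    rw [(even_follows α).1]; push Not; rfl
  rw [hd]
  constructor
  · rintro ⟨h1, h2⟩
    exact ⟨(stateAt_even h1).1 h2, h1⟩
  · rintro ⟨h1, h2⟩
    exact ⟨h2, (stateAt_even h2).2 h1⟩

theorem code_done_iff : IsCode n ∧ Done (stage p α) (2 * n) ↔ ∃ γ < α, Stops n γ := by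
  rw [(even_follows α).1]
  constructor
  · rintro ⟨h1, γ, hγ, h⟩
    obtain ⟨δ, hδ, h'⟩ := exists_haltsAt h
    exact ⟨δ, hδ.trans_lt hγ, h1, h'⟩
  · rintro ⟨γ, hγ, h1, h2⟩
    exact ⟨h1, γ, hγ, h2.1⟩

theorem mem_lightHalting {x : CReal} :
    x ∈ lightHalting ∅ ↔ ∃ n, x = natReal n ∧ ∃ γ, Stops n γ := by
  constructor
  · rintro ⟨P, rfl, γ, h⟩
    exact ⟨_, rfl, γ, isCode_code P, by rw [prog_code]; exact h⟩
  · rintro ⟨n, rfl, γ, h1, h2⟩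
    exact ⟨prog n, by rw [h1], γ, h2⟩

/-! ### Stages without change -/

/-- A halt at stage `γ` shows in the restart cell at stage `γ + 1`, so the interval shifts from
closed on the left to closed on the right. -/
theorem no_change {a β : Ordinal.{0}} (h : ∀ γ, a ≤ γ → γ < a + β → ∀ n, ¬ Stops n γ) :
    ∀ δ, 0 < δ → δ ≤ β → ¬ stage p (a + δ) (5, 0, 0, 0) = true := by
  intro δ
  induction δ using WellFoundedLT.induction with
  | ind δ ih =>
  intro hpos hδ
  rcases Ordinal.zero_or_succ_or_isSuccLimit δ with rfl | ⟨ε, rfl⟩ | hlim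
  · exact absurd hpos (lt_irrefl _)
  · rw [Order.succ_eq_add_one, ← add_assoc, stage_change, change_iff]
    rintro ⟨n, hn⟩
    exact h _ le_self_add ((add_lt_add_iff_left a).2 ((Order.lt_succ ε).trans_le hδ)) n hn
  · rw [stage_limit_add a hlim]
    intro H
    obtain ⟨γ, hγ, hle, h'⟩ := H 1 (by simpa using hlim.add_one_lt hpos)
    exact ih γ hγ (one_pos.trans_le hle) (hγ.le.trans hδ) h'

theorem not_ini_odd {a β : Ordinal.{0}} (h : ∀ γ, a ≤ γ → γ < a + β → ∀ n, ¬ Stops n γ) (n : ℕ) :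
    ∀ δ, 0 < δ → δ ≤ β → ¬ Ini (stage p (a + δ)) (2 * n + 1) := by
  intro δ hpos hδ
  rw [ini_odd, not_or]
  exact ⟨(hpos.trans_le le_add_self).ne', no_change h δ hpos hδ⟩

/-- There are only countably many programs, and each of them stops at one stage at most. -/
theorem exists_bound_stops : ∃ σ : Ordinal.{0}, ∀ n γ, Stops n γ → γ < σ := by
  classical
  let f : ℕ → Ordinal.{0} := fun n => if h : ∃ γ, Stops n γ then h.choose + 1 else 0
  refine ⟨⨆ n, f n, fun n γ h => ?_⟩
  have hex : ∃ γ, Stops n γ := ⟨γ, h⟩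
  have huniq : γ = hex.choose := by
    have h' := hex.choose_spec
    rcases lt_trichotomy γ hex.choose with hlt | heq | hlt
    exacts [absurd h.2.1 (h'.2.2 _ hlt), heq, absurd h'.2.1 (h.2.2 _ hlt)]
  refine lt_of_lt_of_le ?_ (Ordinal.le_iSup f n)
  simp only [f, dif_pos hex, ← huniq]
  exact lt_add_one γ

/-- After some stage at which the machines with oracle are started no program halts. -/
theorem exists_last_start (p : Program) : ∃ ρ : Ordinal.{0},
    (ρ = 0 ∨ stage p ρ (5, 0, 0, 0) = true) ∧ ∀ γ, ρ ≤ γ → ∀ n, ¬ Stops n γ := by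
  obtain ⟨σ, hσ⟩ := exists_bound_stops
  let R : Set Ordinal.{0} := {ρ | ρ = 0 ∨ stage p ρ (5, 0, 0, 0) = true}
  have hR : ∀ ρ ∈ R, ρ ≤ σ := by
    intro ρ
    induction ρ using WellFoundedLT.induction with
    | ind ρ ih =>
    rintro (rfl | h)
    · exact zero_le
    rcases Ordinal.zero_or_succ_or_isSuccLimit ρ with rfl | ⟨ε, rfl⟩ | hlim
    · exact zero_le
    · rw [Order.succ_eq_add_one, stage_change, change_iff] at h
      obtain ⟨n, hn⟩ := h
      exact Order.succ_le_of_lt (hσ n ε hn)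
    · rw [stage_limit hlim] at h
      refine le_of_forall_lt fun β hβ => ?_
      obtain ⟨γ, hγ, hle, h'⟩ := h (β + 1) (hlim.add_one_lt hβ)
      exact (lt_add_one β).trans_le (hle.trans (ih γ hγ (.inr h')))
  have hbdd : BddAbove R := ⟨σ, hR⟩
  have hne : R.Nonempty := ⟨0, .inl rfl⟩
  -- A limit of restart stages is itself one, because the restart cell is on there by the limit
  -- superior. So a last restart exists.
  have hmem : sSup R ∈ R := by
    rcases Ordinal.zero_or_succ_or_isSuccLimit (sSup R) with h | ⟨ε, h⟩ | hlim
    · exact .inl h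
    · obtain ⟨r, hr, hlt⟩ := exists_lt_of_lt_csSup hne (h ▸ Order.lt_succ ε)
      have : r = sSup R := le_antisymm (le_csSup hbdd hr) (h ▸ Order.succ_le_of_lt hlt)
      exact this ▸ hr
    · by_contra hno
      refine hno (.inr ?_)
      rw [stage_limit hlim]
      intro β hβ
      obtain ⟨r, hr, hlt⟩ := exists_lt_of_lt_csSup hne hβ
      have hrs : r ≠ sSup R := fun h => hno (h ▸ hr)
      refine ⟨r, lt_of_le_of_ne (le_csSup hbdd hr) hrs, hlt.le, ?_⟩
      exact hr.resolve_left (zero_le.trans_lt hlt).ne'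
  refine ⟨sSup R, hmem, fun γ hγ n hn => ?_⟩
  -- A program halting at `γ` would cause a restart at `γ + 1`, after the last one.
  have h1 : γ + 1 ∈ R := .inr (stage_change.2 (change_iff.2 ⟨n, hn⟩))
  exact absurd (le_csSup hbdd h1) (not_le.2 (hγ.trans_lt (lt_add_one γ)))

/-- All machines with oracle have halted and their answers are the bits of `z`. -/
def Agrees (p : Program) (z : CReal) (α : Ordinal.{0}) : Prop :=
  ∀ n, Done (stage p α) (2 * n + 1) ∧ (TapeAt (stage p α) (2 * n + 1) 0 2 ↔ z n = true)

theorem mem_realSet {z : CReal} : natReal n ∈ realSet z ↔ z n = true := by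
  constructor
  · rintro ⟨k, hk, h⟩
    rw [natReal_injective h]; exact hk
  · exact fun h => ⟨n, h, rfl⟩

/-- From the last restart on, the approximation is the true jump. The computations of `p` then take
their real course, and the supremum of their halting times is waited for. -/
theorem exists_agrees {z : CReal}
    (hp : ∀ x, Yields (lightJump ∅) p x (charFun (realSet z) x)) : ∃ α, Agrees p z α := by
  obtain ⟨ρ, h1, h2⟩ := exists_last_start p
  choose δ hδ1 hδ2 using fun n => hp (natReal n)
  have hlt : ∀ n, δ n < (⨆ n, δ n) + 1 := fun n =>
    (Ordinal.le_iSup δ n).trans_lt (lt_add_one _)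
  refine ⟨ρ + ((⨆ n, δ n) + 1), fun n => ?_⟩
  -- Every program that ever halts has done so before `ρ`.
  have hO : ∀ ε, oracleOf (stage p (ρ + ε)) (2 * n + 1) = lightJump ∅ := by
    intro ε
    rw [oracleOf, if_pos (by omega), lightJump]
    congr 1
    ext x
    rw [mem_lightHalting]
    refine exists_congr fun k => and_congr_right fun _ => ?_
    rw [code_done_iff]
    refine ⟨fun ⟨γ, _, h⟩ => ⟨γ, h⟩, fun ⟨γ, h⟩ => ⟨γ, ?_, h⟩⟩
    by_contra hle
    exact h2 γ (le_self_add.trans (not_lt.1 hle)) k h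
  obtain ⟨k1, -, k3⟩ := follows (p := p) (m := 2 * n + 1) (a := ρ) (β := (⨆ n, δ n) + 1)
    (O := lightJump ∅) (ini_odd.2 h1) (not_ini_odd (fun γ hγ _ => h2 γ hγ) n)
    (fun ε _ => hO ε) _ le_rfl
  rw [prg_odd, inputOf_odd] at k1 k3
  refine ⟨k1.2 ⟨δ n, hlt n, (hδ1 n).1⟩, ?_⟩
  rw [k3 (δ n) (hlt n) (hδ1 n), show (2 : Tape) = outputTape from rfl, hδ2, charFun,
    ← mem_realSet (z := z)]
  split_ifs with h
  · simp [h, natReal]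
  · simp [h, natReal]

end Sim
end ITTM

namespace ITTM
namespace Sim

variable {p : Program} {α : Ordinal.{0}}

/-! ### Observers -/

section observers

abbrev cells (Y : Observed ⊕ ℕ → Bool) : Cell → Bool := Y ∘ fun c => .inl (.inl c)

abbrev inp (Y : Observed ⊕ ℕ → Bool) (j : ℕ) : Prop := Y (.inl (.inr (.inl j))) = true

abbrev aux (Y : Observed ⊕ ℕ → Bool) (i : ℕ) : Prop := Y (.inr i) = true

/-- A `0` before a `1` in the input, and (for `i = 0`) a missing or wrong answer. -/
def auxObs (o : Observed → Bool) (i : ℕ) : Prop :=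
  (i = 1 ∧ ∃ j, o (.inr (.inl j)) = false ∧ o (.inr (.inl (j + 1))) = true) ∨
  (i = 0 ∧ ∃ n, ¬ Done (o ∘ Sum.inl) (2 * n + 1) ∨
    (TapeAt (o ∘ Sum.inl) (2 * n + 1) 0 2 ∧ ¬ o (.inr (.inr n)) = true) ∨
    (¬ TapeAt (o ∘ Sum.inl) (2 * n + 1) 0 2 ∧ o (.inr (.inr n)) = true))

variable {β : Type} [Primcodable β]

theorem primrec_double : Primrec fun n : ℕ => 2 * n := Primrec.nat_mul.comp (.const 2) .id

theorem primrec_double_succ : Primrec fun n : ℕ => 2 * n + 1 := Primrec.succ.comp primrec_double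

theorem primrec_inl_inl : Primrec fun c : Cell => (Sum.inl (Sum.inl c) : Observed ⊕ ℕ) :=
  Primrec.sumInl.comp .sumInl

theorem sig_auxObs : Sig auxObs := by
  have hi : ∀ k, Sig fun (_ : Observed → Bool) (i : ℕ) => i = k := fun k =>
    .of_primrecPred (Primrec.eq.comp .id (.const k))
  have h1 : Sig fun (o : Observed → Bool) (x : ℕ × ℕ) =>
      o (.inr (.inl x.2)) = false ∧ o (.inr (.inl (x.2 + 1))) = true :=
    .and (.lit (Primrec.sumInr.comp (Primrec.sumInl.comp .snd)) false)
      (.lit (Primrec.sumInr.comp (Primrec.sumInl.comp (Primrec.succ.comp .snd))) true)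
  have hd := (sigDec_Done (primrec_double_succ.comp (Primrec.snd (α := ℕ) (β := ℕ)))).pull
    (Primrec.sumInl (α := Cell) (β := ℕ ⊕ ℕ))
  have ht := (sigDec_TapeAt (primrec_double_succ.comp (Primrec.snd (α := ℕ) (β := ℕ))) (.const 2)
    (.const 0)).pull (Primrec.sumInl (α := Cell) (β := ℕ ⊕ ℕ))
  have ho : SigDec fun (o : Observed → Bool) (x : ℕ × ℕ) => o (.inr (.inr x.2)) = true :=
    .lit (Primrec.sumInr.comp (Primrec.sumInr.comp .snd))
  have h2 : Sig fun (o : Observed → Bool) (x : ℕ × ℕ) =>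
      ¬ Done (o ∘ Sum.inl) (2 * x.2 + 1) ∨
      (TapeAt (o ∘ Sum.inl) (2 * x.2 + 1) 0 2 ∧ ¬ o (.inr (.inr x.2)) = true) ∨
      (¬ TapeAt (o ∘ Sum.inl) (2 * x.2 + 1) 0 2 ∧ o (.inr (.inr x.2)) = true) :=
    .or hd.2 (.or (.and ht.1 ho.2) (.and ht.2 ho.1))
  exact .or (.and (hi 1) h1.ex) (.and (hi 0) h2.ex)

theorem sig_stateAt (r : ℕ) :
    Sig fun (Y : Observed ⊕ ℕ → Bool) (_ : β) => StateAt (cells Y) r 2 :=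
  (sigDec_StateAt (.const r) (.const 2)).1.pull primrec_inl_inl

theorem sigDec_inp {f : β → ℕ} (hf : Primrec f) :
    SigDec fun (Y : Observed ⊕ ℕ → Bool) (b : β) => inp Y (f b) :=
  .lit (Primrec.sumInl.comp (Primrec.sumInr.comp (Primrec.sumInl.comp hf)))

theorem sigDec_aux (i : ℕ) : SigDec fun (Y : Observed ⊕ ℕ → Bool) (_ : β) => aux Y i :=
  .lit (.const _)

/-- The array seen by an observer at stage `α`. -/
noncomputable def seen (p : Program) (A : Set CReal) (x : CReal) (α : Ordinal.{0}) :
    Observed ⊕ ℕ → Bool := view auxObs (observe A x (stage p α))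

theorem exists_program (p : Program) {halt : (Observed ⊕ ℕ → Bool) → Unit → Prop}
    {out : (Observed ⊕ ℕ → Bool) → ℕ → Prop} (hhalt : Sig halt) (hout : Sig out) :
    ∃ P : Program, ∀ (A : Set CReal) (x y : CReal) (β : Ordinal.{0}),
      (∀ γ < β, ¬ halt (seen p A x γ) ()) → halt (seen p A x β) () →
      (∀ n, y n = true ↔ out (seen p A x β) n) → Yields A P x y :=
  exists_observer_program (sig_auxBit p) (sig_rule p) sig_auxObs hhalt hout

variable {A : Set CReal} {x : CReal}

theorem cells_seen : cells (seen p A x α) = stage p α := rfl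

theorem inp_seen (j : ℕ) : inp (seen p A x α) j ↔ x j = true := Iff.rfl

theorem aux_one_seen : aux (seen p A x α) 1 ↔ ∃ j, x j = false ∧ x (j + 1) = true := by
  simp only [aux, seen, view, auxObs, observe, Sum.elim_inr, Sum.elim_inl]
  refine (@decide_eq_true_iff _ (_)).trans ?_
  simp

theorem aux_zero_seen : aux (seen p A x α) 0 ↔ ∃ n, ¬ Done (stage p α) (2 * n + 1) ∨
    (TapeAt (stage p α) (2 * n + 1) 0 2 ∧ natReal n ∉ A) ∨
    (¬ TapeAt (stage p α) (2 * n + 1) 0 2 ∧ natReal n ∈ A) := by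
  have : observe A x (stage p α) ∘ Sum.inl = stage p α := rfl
  simp only [aux, seen, view, auxObs, Sum.elim_inr, this]
  refine (@decide_eq_true_iff _ (_)).trans ?_
  simp [observe]

end observers

/-! ### The dichotomy for reals below the jump -/

theorem not_aux_zero_seen {z x : CReal} :
    ¬ aux (seen p (realSet z) x α) 0 ↔ Agrees p z α := by
  rw [aux_zero_seen, not_exists]
  refine forall_congr' fun n => ?_
  rw [mem_realSet]
  by_cases h₁ : Done (stage p α) (2 * n + 1) <;>
    by_cases h₂ : TapeAt (stage p α) (2 * n + 1) 0 2 <;>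
    by_cases h₃ : z n = true <;> simp [h₁, h₂, h₃]

/-- If the answers are right when a program halts then they are writable. -/
theorem writable_of_stops {z : CReal} {r : ℕ} (hr : Stops r α)
    (hz : ∀ n, TapeAt (stage p α) (2 * n + 1) 0 2 ↔ z n = true) : Writable z := by
  have hout : Sig fun (Y : Observed ⊕ ℕ → Bool) (n : ℕ) => TapeAt (cells Y) (2 * n + 1) 0 2 :=
    (sigDec_TapeAt primrec_double_succ (.const 2) (.const 0)).1.pull primrec_inl_inl
  obtain ⟨P, hP⟩ := exists_program p (sig_stateAt (2 * r)) hout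
  refine ⟨P, hP ∅ (natReal 0) z α (fun γ hγ h => ?_) ?_ fun n => (hz n).symm⟩
  · exact hr.2.2 γ hγ ((stateAt_even fun δ hδ => hr.2.2 δ (hδ.trans hγ)).1 h)
  · exact (stateAt_even hr.2.2).2 hr.2.1

/-- The heart of the argument. Otherwise take the first stage from `α` on at which some program `r`
halts. No restart occurs after `α` up to that stage, so the answers are still the bits of `z`, and
waiting for `r` to halt writes `z`. -/
theorem stops_lt_of_agrees {z : CReal} (hz : ¬ Writable z) (h : Agrees p z α) {n : ℕ}
    {γ : Ordinal.{0}} (hn : Stops n γ) : γ < α := by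
  by_contra hle
  obtain ⟨δ, ⟨h1, r, hr⟩, h2⟩ := WellFounded.has_min
    (r := ((· < ·) : Ordinal.{0} → Ordinal.{0} → Prop)) wellFounded_lt
    {δ | α ≤ δ ∧ ∃ r, Stops r δ} ⟨γ, not_lt.1 hle, n, hn⟩
  obtain ⟨ε, rfl⟩ : ∃ ε, δ = α + ε := ⟨δ - α, (Ordinal.add_sub_cancel_of_le h1).symm⟩
  refine hz (writable_of_stops (p := p) hr fun k => ?_)
  have hno : ∀ γ, α ≤ γ → γ < α + ε → ∀ n, ¬ Stops n γ := fun γ hγ hlt n hn =>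
    h2 γ ⟨hγ, n, hn⟩ hlt
  rw [(done_persists (h k).1 (not_ini_odd hno k) ε le_rfl).2, (h k).2]

theorem charFun_apply (B : Set CReal) (x : CReal) (n : ℕ) :
    charFun B x n = true ↔ n = 0 ∧ x ∈ B := by
  unfold charFun
  split_ifs with h <;> simp [h, natReal]

/-- A real that computes its own answers to the programs halts decides the jump. -/
theorem lightJump_reducible {z : CReal} (h : Reducible (realSet z) (lightJump ∅))
    (hz : ¬ Writable z) : Reducible (lightJump ∅) (realSet z) := by
  obtain ⟨p, hp⟩ := h
  have h1 : Sig fun (Y : Observed ⊕ ℕ → Bool) (x : ℕ × ℕ) =>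
      (IsCode x.2 ∧ Done (cells Y) (2 * x.2)) ∧ inp Y x.2 ∧ ¬ inp Y (x.2 + 1) :=
    .and (.and (.of_primrecPred (primrecPred_isCode.comp .snd))
      ((sigDec_Done (primrec_double.comp .snd)).1.pull primrec_inl_inl))
      (.and (sigDec_inp .snd).1 (sigDec_inp (Primrec.succ.comp .snd)).2)
  have hout : Sig fun (Y : Observed ⊕ ℕ → Bool) (n : ℕ) => n = 0 ∧ ¬ aux Y 1 ∧
      ∃ k, (IsCode k ∧ Done (cells Y) (2 * k)) ∧ inp Y k ∧ ¬ inp Y (k + 1) :=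
    .and (.of_primrecPred (Primrec.eq.comp .id (.const 0))) (.and (sigDec_aux 1).2 h1.ex)
  obtain ⟨P, hP⟩ := exists_program p (sigDec_aux 0).2 hout
  -- The observer halts at the first stage of agreement. This may be well before the last restart
  -- has been reached in `exists_agrees`, with the right answers given for wrong reasons;
  -- non-writability makes any such stage late enough.
  obtain ⟨α, h2, h3⟩ := WellFounded.has_min
    (r := ((· < ·) : Ordinal.{0} → Ordinal.{0} → Prop)) wellFounded_lt _ (exists_agrees hp)
  refine ⟨P, fun x => hP (realSet z) x _ α (fun γ hγ h => ?_) (not_aux_zero_seen.2 h2) fun n => ?_⟩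
  · exact h3 γ (not_aux_zero_seen.1 h) hγ
  · rw [charFun_apply]
    refine and_congr_right fun _ => ?_
    -- By `stops_lt_of_agrees`, the programs done at stage `α` are all that ever halt.
    have hH : lightHalting ∅ = {x | ∃ k, x = natReal k ∧ IsCode k ∧ Done (stage p α) (2 * k)} := by
      ext y
      rw [mem_lightHalting]
      refine exists_congr fun k => and_congr_right fun _ => ?_
      rw [code_done_iff]
      exact ⟨fun ⟨γ, h⟩ => ⟨γ, stops_lt_of_agrees hz h2 h, h⟩, fun ⟨γ, _, h⟩ => ⟨γ, h⟩⟩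
    rw [lightJump, hH, mem_join_empty, ← mem_natReal_succ, aux_one_seen, and_comm]
    simp only [cells_seen, inp_seen, Bool.not_eq_true]

theorem eq_natReal_zero {x : CReal} :
    x = natReal 0 ↔ x 0 = false ∧ ¬ ∃ j, x j = false ∧ x (j + 1) = true := by
  constructor
  · rintro rfl
    simp [natReal]
  · rintro ⟨h0, h⟩
    push Not at h
    funext n
    induction n with
    | zero => exact h0
    | succ n ih => exact Bool.eq_false_iff.2 (h n ih)

/-- Wait for the program that writes `z` to halt in the simulation; its output tape then shows `z`,
and the bit belonging to the input is looked up. -/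
theorem reducible_of_writable {z : CReal} (hz : Writable z) : Reducible (realSet z) ∅ := by
  obtain ⟨Q, α, hQ, hz⟩ := hz
  have hr : Stops Q.code α := ⟨isCode_code Q, by rwa [prog_code]⟩
  have hbit : ∀ {β : Type} [Primcodable β] {f : β → ℕ}, Primrec f →
      Sig fun (Y : Observed ⊕ ℕ → Bool) (b : β) => TapeAt (cells Y) (2 * Q.code) (f b) 2 :=
    fun hf => (sigDec_TapeAt (.const _) (.const 2) hf).1.pull primrec_inl_inl
  have h1 : Sig fun (Y : Observed ⊕ ℕ → Bool) (x : ℕ × ℕ) =>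
      TapeAt (cells Y) (2 * Q.code) (x.2 + 1) 2 ∧ inp Y x.2 ∧ ¬ inp Y (x.2 + 1) :=
    .and (hbit (Primrec.succ.comp .snd)) (.and (sigDec_inp .snd).1
      (sigDec_inp (Primrec.succ.comp .snd)).2)
  have hout : Sig fun (Y : Observed ⊕ ℕ → Bool) (n : ℕ) => n = 0 ∧ ¬ aux Y 1 ∧
      ((TapeAt (cells Y) (2 * Q.code) 0 2 ∧ ¬ inp Y 0) ∨
        ∃ k, TapeAt (cells Y) (2 * Q.code) (k + 1) 2 ∧ inp Y k ∧ ¬ inp Y (k + 1)) :=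
    .and (.of_primrecPred (Primrec.eq.comp .id (.const 0))) (.and (sigDec_aux 1).2
      (.or (.and (hbit (.const 0)) (sigDec_inp (.const 0)).2) h1.ex))
  -- The machines with oracle play no role here; the empty program is put in their place.
  obtain ⟨P, hP⟩ := exists_program [] (sig_stateAt (2 * Q.code)) hout
  refine ⟨P, fun x => hP ∅ x _ α (fun γ hγ h => ?_) ?_ fun n => ?_⟩
  · exact hr.2.2 γ hγ ((stateAt_even fun δ hδ => hr.2.2 δ (hδ.trans hγ)).1 h)
  · exact (stateAt_even hr.2.2).2 hr.2.1
  · rw [charFun_apply]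
    refine and_congr_right fun _ => ?_
    have hT : ∀ k, TapeAt (stage [] α) (2 * Q.code) k 2 ↔ z k = true := fun k => by
      rw [((even_follows α).2 hr.2.2).tape, prog_code, ← hz]
    -- The number `0` is treated apart, since `mem_natReal_succ` recognises only positive numbers.
    have hx : x ∈ realSet z ↔ (z 0 = true ∧ x = natReal 0) ∨
        ∃ k, z (k + 1) = true ∧ x = natReal (k + 1) := by
      constructor
      · rintro ⟨_ | k, hk, rfl⟩
        exacts [.inl ⟨hk, rfl⟩, .inr ⟨k, hk, rfl⟩]
      · rintro (⟨h, rfl⟩ | ⟨k, h, rfl⟩)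
        exacts [⟨0, h, rfl⟩, ⟨k + 1, h, rfl⟩]
    rw [hx, ← mem_natReal_succ, eq_natReal_zero, aux_one_seen]
    simp only [cells_seen, inp_seen, hT, Bool.not_eq_true]
    tauto

end Sim
end ITTM

theorem mainTheorem3 :
    (¬ ∃ z : ITTM.CReal,
      ITTM.StrictlyBelow ∅ (ITTM.realSet z) ∧
      ITTM.StrictlyBelow (ITTM.realSet z) (ITTM.lightJump ∅)) ∧
    ∀ z : ITTM.CReal, ITTM.Reducible (ITTM.realSet z) (ITTM.lightJump ∅) →
      ITTM.Writable z ∨ ITTM.Reducible (ITTM.lightJump ∅) (ITTM.realSet z) := by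
  have key : ∀ z : ITTM.CReal, ITTM.Reducible (ITTM.realSet z) (ITTM.lightJump ∅) →
      ITTM.Writable z ∨ ITTM.Reducible (ITTM.lightJump ∅) (ITTM.realSet z) := fun z h =>
    or_iff_not_imp_left.2 (ITTM.Sim.lightJump_reducible h)
  refine ⟨?_, key⟩
  rintro ⟨z, ⟨h1, h2⟩, h3, h4⟩
  rcases key z h3 with h | h
  · exact h2 ⟨h1, ITTM.Sim.reducible_of_writable h⟩
  · exact h4 ⟨h3, h⟩
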